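/- Let $0\le k\le n$ be integers such that $N:=k(n-k)\ge 4$, and let $\mathbb G_{n,k}$ be the complex Grassmann manifold of $k$-dimensional linear subspaces of $\mathbb C^n$, of complex dimension $N$, with its complex orientation and fundamental class $\mu_{n,k}\in H_{2N}(\mathbb G_{n,k};\mathbb Z)$. Let $\gamma_{n,k}^{\perp}$ be the bundle over $\mathbb G_{n,k}$ whose fibre at $V$ is the orthogonal complement $V^\perp\subset\mathbb C^n$, let $\bar c_i=c_i(\gamma_{n,k}^\perp)$ be its Chern classes, regarded in the cohomology of $\mathbb G_{n,k}$ with complex coefficients (in de Rham cohomology, through Chern--Weil theory), and put $\omega=\bar c_1$. For $\alpha\in H^{2r}(\mathbb G_{n,k})$ let $\deg\alpha=\langle\alpha\,\omega^{N-r},\mu_{n,k}\rangle$, let $\deg\mathbb G_{n,k}=\langle\omega^{N},\mu_{n,k}\rangle$, and for $\alpha,\beta\in H^4(\mathbb G_{n,k})$ let $(\alpha,\beta)=\langle\alpha\beta\,\omega^{N-4},\mu_{n,k}\rangle$. Then $\deg\mathbb G_{n,k}\neq0$, and the class $$v_2=\bar c_2-\frac{\deg\bar c_2}{\deg\mathbb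 G_{n,k}}\,\omega^2\in H^4(\mathbb G_{n,k})$$ satisfies $$(v_2,v_2)=\deg\mathbb G_{n,k}\cdot\frac{(k^2-1)\big((n-k)^2-1\big)}{2(N-1)^2(N-2)(N-3)} .$$ -/

import Mathlib

noncomputable section

namespace ComplexGrassmann

/-- The complex Grassmann manifold of `k`-dimensional subspaces of `ℂⁿ`. -/
def Grassmannian (n k : ℕ) : Type :=
  {V : Submodule ℂ (EuclideanSpace ℂ (Fin n)) // Module.finrank ℂ V = k}

/-! ### The standard atlas -/

/-- The model space of `(n - k) × k` complex matrices, a real vector space of dimension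
`2 k (n - k)`. -/
abbrev Model (n k : ℕ) : Type := Fin (n - k) → Fin k → ℂ

/-- The index set of the atlas: a chart is given by a choice of `k` of the `n` coordinates of
`ℂⁿ`, together with an ordering of the chosen and of the remaining coordinates. -/
abbrev ChartIndex (n k : ℕ) : Type := Fin k ⊕ Fin (n - k) ≃ Fin n

/-- The `n × k` matrix which has the identity matrix in the `k` chosen rows and `Z` in the
remaining rows. -/
def frameMatrix {n k : ℕ} (e : ChartIndex n k) (Z : Model n k) (b : Fin k) (i : Fin n) : ℂ :=
  Sum.elim (fun b' => if b' = b then 1 else 0) (fun a => Z a b) (e.symm i)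

/-- The columns of `frameMatrix e Z` as vectors of `ℂⁿ`. -/
def frameVector {n k : ℕ} (e : ChartIndex n k) (Z : Model n k) (b : Fin k) :
    EuclideanSpace ℂ (Fin n) :=
  WithLp.toLp 2 (frameMatrix e Z b)

theorem frameVector_linearIndependent {n k : ℕ} (e : ChartIndex n k) (Z : Model n k) :
    LinearIndependent ℂ (frameVector e Z) := by
  rw [Fintype.linearIndependent_iff]
  intro g hg b
  have h := congrArg (fun x : EuclideanSpace ℂ (Fin n) => x (e (Sum.inl b))) hg
  simpa [frameVector, frameMatrix] using h

/-- The parametrization of a chart domain: `Z` goes to the column space of `frameMatrix e Z`. -/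
def chart {n k : ℕ} (e : ChartIndex n k) (Z : Model n k) : Grassmannian n k :=
  ⟨Submodule.span ℂ (Set.range (frameVector e Z)), by
    rw [finrank_span_eq_card (frameVector_linearIndependent e Z), Fintype.card_fin]⟩

/-- The coordinate change from the chart `e` to the chart `e'`, meaningful at those `Z` for which
`chart e Z` lies in the domain of the chart `e'`. -/
def transition {n k : ℕ} (e e' : ChartIndex n k) : Model n k → Model n k :=
  Function.invFun (chart e') ∘ chart e

/-! ### Differential forms -/

section Wedge

variable {E : Type*} [NormedAddCommGroup E] [NormedSpace ℝ E] {p q : ℕ}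

/-- The multilinear map `v ↦ α (v₁, …, v_p) β (v_{p+1}, …, v_{p+q})`. -/
def tensorForm (α : E [⋀^Fin p]→L[ℝ] ℂ) (β : E [⋀^Fin q]→L[ℝ] ℂ) :
    ContinuousMultilinearMap ℝ (fun _ : Fin (p + q) => E) ℂ where
  toFun v := α (v ∘ Fin.castAdd q) * β (v ∘ Fin.natAdd p)
  map_update_add' := by
    intro inst v i x y
    have hd : inst = instDecidableEqFin (p + q) := Subsingleton.elim _ _
    subst hd
    induction i using Fin.addCases with
    | left i =>
      have h (z : E) : Function.update v (Fin.castAdd q i) z ∘ Fin.natAdd p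
          = v ∘ Fin.natAdd p :=
        Function.update_comp_eq_of_forall_ne _ _ fun j => by simp [Fin.ext_iff]; omega
      simp only [h, Function.update_comp_eq_of_injective _ (Fin.castAdd_injective p q),
        α.map_update_add, add_mul]
    | right i =>
      have h (z : E) : Function.update v (Fin.natAdd p i) z ∘ Fin.castAdd q
          = v ∘ Fin.castAdd q :=
        Function.update_comp_eq_of_forall_ne _ _ fun j => by simp [Fin.ext_iff]; omega
      simp only [h, Function.update_comp_eq_of_injective _ (Fin.natAdd_injective q p),
        β.map_update_add, mul_add]
  map_update_smul' := by
    intro inst v i c x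
    have hd : inst = instDecidableEqFin (p + q) := Subsingleton.elim _ _
    subst hd
    induction i using Fin.addCases with
    | left i =>
      have h (z : E) : Function.update v (Fin.castAdd q i) z ∘ Fin.natAdd p
          = v ∘ Fin.natAdd p :=
        Function.update_comp_eq_of_forall_ne _ _ fun j => by simp [Fin.ext_iff]; omega
      simp only [h, Function.update_comp_eq_of_injective _ (Fin.castAdd_injective p q),
        α.map_update_smul, smul_mul_assoc]
    | right i =>
      have h (z : E) : Function.update v (Fin.natAdd p i) z ∘ Fin.castAdd q
          = v ∘ Fin.castAdd q :=
        Function.update_comp_eq_of_forall_ne _ _ fun j => by simp [Fin.ext_iff]; omega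
      simp only [h, Function.update_comp_eq_of_injective _ (Fin.natAdd_injective q p),
        β.map_update_smul, mul_smul_comm]
  cont := by
    refine Continuous.mul ?_ ?_
    · exact α.cont.comp (by fun_prop)
    · exact β.cont.comp (by fun_prop)

/-- The exterior product of alternating forms,
`(α ∧ β) v = (1 / (p! q!)) ∑_σ sgn σ · α (v_{σ 1}, …, v_{σ p}) β (v_{σ (p+1)}, …, v_{σ (p+q)})`. -/
def wedgeAt (α : E [⋀^Fin p]→L[ℝ] ℂ) (β : E [⋀^Fin q]→L[ℝ] ℂ) : E [⋀^Fin (p + q)]→L[ℝ] ℂ :=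
  ((p.factorial * q.factorial : ℝ)⁻¹) • ContinuousMultilinearMap.alternatization (tensorForm α β)

end Wedge

/-- A family of complex-valued `p`-forms, one in the coordinates of every chart. -/
abbrev LocalForms (n k p : ℕ) : Type := ChartIndex n k → Model n k → Model n k [⋀^Fin p]→L[ℝ] ℂ

/-- The local forms are smooth and agree on overlaps, that is, they are the coordinate
expressions of one smooth differential form on the Grassmann manifold. -/
def IsForm {n k p : ℕ} (α : LocalForms n k p) : Prop :=
  (∀ e, ContDiff ℝ ((⊤ : ℕ∞) : WithTop ℕ∞) (α e)) ∧
    ∀ e e' Z, chart e Z ∈ Set.range (chart e') →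
      α e Z = (α e' (transition e e' Z)).compContinuousLinearMap (fderiv ℝ (transition e e') Z)

/-- The exterior derivative. -/
def extD {n k p : ℕ} (α : LocalForms n k p) : LocalForms n k (p + 1) :=
  fun e => extDeriv (α e)

/-- The exterior product. -/
def wedge {n k p q : ℕ} (α : LocalForms n k p) (β : LocalForms n k q) : LocalForms n k (p + q) :=
  fun e Z => wedgeAt (α e Z) (β e Z)

/-- The powers `ωʲ` of a `2`-form. -/
def wedgePow {n k : ℕ} (ω : LocalForms n k 2) : (j : ℕ) → LocalForms n k (2 * j)
  | 0 => fun _ _ => ContinuousAlternatingMap.constOfIsEmpty ℝ (Model n k) (Fin 0) (1 : ℂ)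
  | j + 1 => wedge (wedgePow ω j) ω

/-- A closed differential form on the Grassmann manifold. -/
def IsClosedForm {n k p : ℕ} (α : LocalForms n k p) : Prop :=
  IsForm α ∧ extD α = 0

/-- `α` and `β` differ by the exterior derivative of a differential form on the Grassmann
manifold; for closed `β` this says that `α` is a closed form in the de Rham class of `β`. -/
def Cohomologous {n k p : ℕ} (α β : LocalForms n k (p + 1)) : Prop :=
  ∃ η : LocalForms n k p, IsForm η ∧ α - β = extD η

/-! ### Integration -/

/-- The oriented real basis `∂/∂x₁, ∂/∂y₁, ∂/∂x₂, ∂/∂y₂, …` of the model space, where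
`zⱼ = xⱼ + i yⱼ` runs through the matrix entries; it induces the complex orientation. -/
def orientedFrame (n k : ℕ) (i : ℕ) : Model n k :=
  fun a b => if i / 2 = a.val * k + b.val then (if i % 2 = 0 then 1 else Complex.I) else 0

/-- The chart in which the first `k` coordinates are chosen. -/
def stdChart {n k : ℕ} (h : k ≤ n) : ChartIndex n k :=
  finSumFinEquiv.trans (finCongr (Nat.add_sub_of_le h))

/-- The pairing of a differential form with the fundamental class: the integral over the
Grassmann manifold, which vanishes by convention unless the form has top degree.
It is computed in the standard chart, the complement of whose domain is a proper subvariety and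
so a null set; the volume on the model space is Lebesgue measure. -/
def integral {n k p : ℕ} (h : k ≤ n) (α : LocalForms n k p) : ℂ :=
  if p = 2 * (k * (n - k)) then
    ∫ Z : Model n k, α (stdChart h) Z (fun i : Fin p => orientedFrame n k i.val)
  else 0

/-- The degree `⟨α ωᴺ⁻ʳ, μ⟩` of a class of degree `2r`, with `N = k (n - k)`. -/
def degree {n k : ℕ} (h : k ≤ n) (ω : LocalForms n k 2) (r : ℕ) (α : LocalForms n k (2 * r)) : ℂ :=
  integral h (wedge α (wedgePow ω (k * (n - k) - r)))

/-- The degree `⟨ωᴺ, μ⟩` of the Grassmann manifold, with `N = k (n - k)`. -/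
def degreeGrassmannian {n k : ℕ} (h : k ≤ n) (ω : LocalForms n k 2) : ℂ :=
  integral h (wedgePow ω (k * (n - k)))

/-- The bilinear form `(α, β)_ω = ⟨α β ωᴺ⁻ʳ, μ⟩` in degree `r`, with `N = k (n - k)`. -/
def pairing {n k r : ℕ} (h : k ≤ n) (ω : LocalForms n k 2) (α β : LocalForms n k r) : ℂ :=
  integral h (wedge (wedge α β) (wedgePow ω (k * (n - k) - r)))

/-! ### Chern forms of the orthogonal complement of the tautological bundle -/

/-- The matrix of the orthogonal projection of `ℂⁿ` onto `V^⊥`, the fibre at `V` of the bundle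
`γ^⊥` as a subbundle of the trivial bundle. -/
def complProjection {n k : ℕ} (V : Grassmannian n k) : Matrix (Fin n) (Fin n) ℂ :=
  fun i j => (V.1ᗮ.starProjection (EuclideanSpace.single j (1 : ℂ))) i

/-- The differential `dP` of the projection, a matrix of `1`-forms. -/
def dProjection {n k : ℕ} (i j : Fin n) : LocalForms n k 1 :=
  fun e Z => ContinuousAlternatingMap.ofSubsingleton ℝ (Model n k) ℂ (0 : Fin 1)
    (fderiv ℝ (fun W => complProjection (chart e W) i j) Z)

/-- The curvature `F = P dP ∧ dP` of the connection `∇ s = P ds` that the trivial bundle induces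
on `γ^⊥`, as an endomorphism-valued `2`-form (a matrix of `2`-forms that vanishes on `γ`). -/
def curvature {n k : ℕ} (i j : Fin n) : LocalForms n k 2 :=
  fun e Z => ∑ a, ∑ b, complProjection (chart e Z) i a •
    wedgeAt (dProjection a b e Z) (dProjection b j e Z)

/-- The trace of the curvature. -/
def traceF (n k : ℕ) : LocalForms n k 2 := ∑ i, curvature i i

/-- The trace of the square of the curvature. -/
def traceFF (n k : ℕ) : LocalForms n k 4 := ∑ i, ∑ j, wedge (curvature i j) (curvature j i)

/-- The first Chern form of `γ^⊥`, the degree `2` part of `det (1 + (i/2π) F)`. -/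
def chernForm₁ (n k : ℕ) : LocalForms n k 2 :=
  (Complex.I / (2 * Real.pi)) • traceF n k

/-- The second Chern form of `γ^⊥`, the degree `4` part of `det (1 + (i/2π) F)`, which is
`(i/2π)² (tr F ∧ tr F - tr (F ∧ F)) / 2`. -/
def chernForm₂ (n k : ℕ) : LocalForms n k 4 :=
  ((Complex.I / (2 * Real.pi)) ^ 2 / 2) • (wedge (traceF n k) (traceF n k) - traceFF n k)

end ComplexGrassmann

end

/-! ### Exterior products and exterior derivatives inside an exterior algebra -/

noncomputable section

namespace ComplexGrassmann

section ExteriorAlgebra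

variable {E : Type*} [NormedAddCommGroup E] [NormedSpace ℝ E] {p q : ℕ}

/-! The intersection numbers are ratios of integrals of forms invariant under the unitary group, so
they can be computed at one point.

The projection onto `V^⊥` is equivariant under the unitary group, hence the Chern forms are
invariant. The group acts transitively, and the reflection in a point is unitary, so an invariant
form of odd degree vanishes (`Invariant.eq_zero_of_odd`); this makes the Chern forms closed.
Invariant forms of top degree that are proportional at the origin of a chart are proportional
everywhere with the same factor, and so are their integrals (`Invariant.integral_eq_mul`). Stokes'
theorem (`integral_topCoeff_extD`), proved with a partition of unity built from the minors of a
frame, allows every class to be replaced by its Chern form.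

At the origin the curvature is the matrix `Ω_ac = ∑_b dz_ab ∧ dz̄_cb`. Put `W = tr Ω`, `T = tr Ω²`,
`N = k(n-k)`, `δ = k-(n-k)`. The even derivation replacing `dz̄_ab` by `dz̄_cb` for all `b` acts on
top degree as the scalar `k` if `a = c` and as `0` otherwise. Applying it to `W^(j+1) X` gives an
integration by parts formula (`wick`), and three uses of it give `W^(N-2) T = τ W^N`, `W^(N-3) tr Ω³
= ρ W^N`, `W^(N-4) T² = σ W^N`, where `τ = δ/(N-1)`, `ρ = (δτ-1)/(N-2)`, `σ = (δτ-2ρ)/(N-3)`. With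
`κ = i/2π` one has `c̄₁ = κW` and `c̄₂ = κ²(W²-T)/2`. Hence `deg c̄₂ / deg 𝔾 = (1-τ)/2`, the class
`v₂` is represented by a form with value `κ²(τW²-T)/2` at the origin, and `(v₂,v₂)/deg 𝔾 =
(σ-τ²)/4`, which is the asserted constant.

The degree is nonzero because `W^N ≠ 0` at the origin and holomorphic coordinate changes have
positive real Jacobian, so the integrand is everywhere a positive multiple of its value there. -/

theorem wedgeAt_apply (α : E [⋀^Fin p]→L[ℝ] ℂ) (β : E [⋀^Fin q]→L[ℝ] ℂ) (v : Fin (p + q) → E) :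
    wedgeAt α β v = ((p.factorial * q.factorial : ℝ)⁻¹) • ∑ σ : Equiv.Perm (Fin (p + q)),
      Equiv.Perm.sign σ • (α (v ∘ σ ∘ Fin.castAdd q) * β (v ∘ σ ∘ Fin.natAdd p)) := by
  simp only [wedgeAt, ContinuousAlternatingMap.smul_apply,
    ContinuousMultilinearMap.alternatization_apply_apply]
  rfl

/-- Pullback of alternating forms is compatible with the exterior product. -/
theorem wedgeAt_compContinuousLinearMap {E' : Type*} [NormedAddCommGroup E'] [NormedSpace ℝ E']
    (α : E [⋀^Fin p]→L[ℝ] ℂ) (β : E [⋀^Fin q]→L[ℝ] ℂ) (f : E' →L[ℝ] E) :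
    (wedgeAt α β).compContinuousLinearMap f =
      wedgeAt (α.compContinuousLinearMap f) (β.compContinuousLinearMap f) := by
  ext v
  simp only [ContinuousAlternatingMap.compContinuousLinearMap_apply, wedgeAt_apply]
  rfl

theorem norm_wedgeAt_le (α : E [⋀^Fin p]→L[ℝ] ℂ) (β : E [⋀^Fin q]→L[ℝ] ℂ) :
    ‖wedgeAt α β‖ ≤ ((p.factorial * q.factorial : ℝ)⁻¹ *
      Fintype.card (Equiv.Perm (Fin (p + q)))) * ‖α‖ * ‖β‖ := by
  refine ContinuousAlternatingMap.opNorm_le_bound _ (by positivity) fun v => ?_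
  rw [wedgeAt_apply, norm_smul, Real.norm_of_nonneg (by positivity)]
  have hterm (σ : Equiv.Perm (Fin (p + q))) :
      ‖Equiv.Perm.sign σ • (α (v ∘ σ ∘ Fin.castAdd q) * β (v ∘ σ ∘ Fin.natAdd p))‖ ≤
        ‖α‖ * ‖β‖ * ∏ i, ‖v i‖ := by
    have h1 := α.le_opNorm (v ∘ σ ∘ Fin.castAdd q)
    have h2 := β.le_opNorm (v ∘ σ ∘ Fin.natAdd p)
    have h3 : (∏ i, ‖v i‖) = (∏ i, ‖(v ∘ σ ∘ Fin.castAdd q) i‖) *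
        ∏ i, ‖(v ∘ σ ∘ Fin.natAdd p) i‖ := by
      rw [← Equiv.prod_comp σ, Fin.prod_univ_add]; rfl
    have h4 : ‖Equiv.Perm.sign σ • (α (v ∘ σ ∘ Fin.castAdd q) * β (v ∘ σ ∘ Fin.natAdd p))‖ =
        ‖α (v ∘ σ ∘ Fin.castAdd q)‖ * ‖β (v ∘ σ ∘ Fin.natAdd p)‖ := by
      rcases Int.units_eq_one_or (Equiv.Perm.sign σ) with h | h <;> simp [h]
    rw [h4, h3]
    calc _ ≤ (‖α‖ * ∏ i, ‖(v ∘ σ ∘ Fin.castAdd q) i‖) *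
          (‖β‖ * ∏ i, ‖(v ∘ σ ∘ Fin.natAdd p) i‖) := by gcongr
      _ = _ := by ring
  calc _ ≤ (p.factorial * q.factorial : ℝ)⁻¹ *
        ∑ _σ : Equiv.Perm (Fin (p + q)), ‖α‖ * ‖β‖ * ∏ i, ‖v i‖ := by
          gcongr
          exact (norm_sum_le _ _).trans (Finset.sum_le_sum fun σ _ => hterm σ)
    _ = _ := by simp; ring

/-- The exterior product as a continuous bilinear map. -/
def wedgeCLM (E : Type*) [NormedAddCommGroup E] [NormedSpace ℝ E] (p q : ℕ) :
    (E [⋀^Fin p]→L[ℝ] ℂ) →L[ℝ] (E [⋀^Fin q]→L[ℝ] ℂ) →L[ℝ] (E [⋀^Fin (p + q)]→L[ℝ] ℂ) :=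
  LinearMap.mkContinuous₂
    (LinearMap.mk₂ ℝ wedgeAt
      (fun a b c => by
        ext v
        simp only [wedgeAt_apply, ContinuousAlternatingMap.add_apply, ← smul_add,
          ← Finset.sum_add_distrib, add_mul])
      (fun r a b => by
        ext v
        simp only [wedgeAt_apply, ContinuousAlternatingMap.smul_apply, Finset.smul_sum,
          smul_mul_assoc, smul_comm r])
      (fun a b c => by
        ext v
        simp only [wedgeAt_apply, ContinuousAlternatingMap.add_apply, ← smul_add,
          ← Finset.sum_add_distrib, mul_add])
      (fun r a b => by
        ext v
        simp only [wedgeAt_apply, ContinuousAlternatingMap.smul_apply, Finset.smul_sum,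
          mul_smul_comm, smul_comm r]))
    _ norm_wedgeAt_le

variable (E) in
/-- The exterior algebra generated by the complex valued `ℝ`-linear forms on `E`. -/
abbrev Ext : Type _ := _root_.ExteriorAlgebra ℂ (E →L[ℝ] ℂ)

/-- Evaluation of an element of the exterior algebra on a tuple of vectors. -/
def evalExt (v : Fin p → E) : Ext E →ₗ[ℂ] ℂ :=
  ExteriorAlgebra.liftAlternating fun i =>
    if h : i = p then
      h ▸ (Matrix.detRowAlternating : (Fin p → ℂ) [⋀^Fin p]→ₗ[ℂ] ℂ).compLinearMap
        { toFun := fun φ a => φ (v a), map_add' := fun _ _ => rfl, map_smul' := fun _ _ => rfl }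
    else 0

theorem evalExt_ιMulti (v : Fin p → E) (w : Fin p → (E →L[ℝ] ℂ)) :
    evalExt v (ExteriorAlgebra.ιMulti ℂ p w) = Matrix.det (Matrix.of fun a c => w a (v c)) := by
  rw [evalExt, ExteriorAlgebra.liftAlternating_apply_ιMulti, dif_pos rfl]
  rfl

variable [FiniteDimensional ℝ E]

/-- The complex valued coordinate forms of a fixed basis of `E`. -/
def coordForm (i : Fin (Module.finrank ℝ E)) : E →L[ℝ] ℂ :=
  Complex.ofRealCLM.comp (LinearMap.toContinuousLinearMap ((Module.finBasis ℝ E).coord i))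

theorem coordForm_apply (i : Fin (Module.finrank ℝ E)) (v : E) :
    coordForm i v = ((Module.finBasis ℝ E).repr v i : ℂ) := rfl

theorem sum_coordForm (φ : E →L[ℝ] ℂ) :
    ∑ i, φ (Module.finBasis ℝ E i) • coordForm i = φ := by
  ext v
  conv_rhs => rw [← (Module.finBasis ℝ E).sum_repr v, map_sum]
  simp [coordForm_apply, mul_comm]

theorem sum_prod_coordForm (α : E [⋀^Fin p]→L[ℝ] ℂ) (w : Fin p → E) :
    ∑ I : Fin p → Fin (Module.finrank ℝ E),
      (∏ a, coordForm (I a) (w a)) * α (fun a => Module.finBasis ℝ E (I a)) = α w := by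
  have h : w = fun a => ∑ i, (Module.finBasis ℝ E).repr (w a) i • Module.finBasis ℝ E i := by
    ext1 a; exact ((Module.finBasis ℝ E).sum_repr (w a)).symm
  conv_rhs => rw [h]
  have := α.toMultilinearMap.map_sum
    (fun a i => (Module.finBasis ℝ E).repr (w a) i • Module.finBasis ℝ E i)
  refine Eq.trans ?_ this.symm
  refine Finset.sum_congr rfl fun I _ => ?_
  have := α.toMultilinearMap.map_smul_univ (fun a => (Module.finBasis ℝ E).repr (w a) (I a))
    (fun a => Module.finBasis ℝ E (I a))
  refine Eq.trans ?_ this.symm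
  simp [coordForm_apply]

/-- The product `ε_{I 0} ε_{I 1} ⋯` of coordinate forms. -/
def coordProd (I : Fin p → Fin (Module.finrank ℝ E)) : Ext E :=
  ExteriorAlgebra.ιMulti ℂ p fun a => coordForm (I a)

theorem coordProd_comp_perm (I : Fin p → Fin (Module.finrank ℝ E)) (σ : Equiv.Perm (Fin p)) :
    coordProd (I ∘ σ) = Equiv.Perm.sign σ • (coordProd I : Ext E) :=
  AlternatingMap.map_perm (ExteriorAlgebra.ιMulti ℂ p) (fun a => coordForm (I a)) σ

theorem coordProd_append (I : Fin p → Fin (Module.finrank ℝ E))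
    (J : Fin q → Fin (Module.finrank ℝ E)) :
    coordProd (Fin.append I J) = (coordProd I : Ext E) * coordProd J := by
  rw [coordProd, coordProd, coordProd, ExteriorAlgebra.ιMulti_mul_ιMulti]
  congr 1
  ext1 a
  induction a using Fin.addCases <;> simp

/-- An alternating form as an element of the exterior algebra. -/
def toExt : (E [⋀^Fin p]→L[ℝ] ℂ) →ₗ[ℂ] Ext E where
  toFun α := (p.factorial : ℂ)⁻¹ • ∑ I : Fin p → Fin (Module.finrank ℝ E),
    α (fun a => Module.finBasis ℝ E (I a)) • coordProd I
  map_add' α β := by simp [add_smul, Finset.sum_add_distrib]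
  map_smul' c α := by
    simp only [ContinuousAlternatingMap.smul_apply, smul_eq_mul, mul_smul, ← Finset.smul_sum,
      RingHom.id_apply]
    rw [smul_comm]

theorem toExt_apply (α : E [⋀^Fin p]→L[ℝ] ℂ) :
    toExt α = (p.factorial : ℂ)⁻¹ • ∑ I : Fin p → Fin (Module.finrank ℝ E),
      α (fun a => Module.finBasis ℝ E (I a)) • coordProd I := rfl

/-- The exterior product is the multiplication of the exterior algebra. -/
theorem toExt_wedgeAt (α : E [⋀^Fin p]→L[ℝ] ℂ) (β : E [⋀^Fin q]→L[ℝ] ℂ) :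
    toExt (wedgeAt α β) = toExt α * toExt β := by
  set b := Module.finBasis ℝ E
  -- Reindexing `I` by `σ` cancels the sign, so all `(p+q)!` permutations contribute equally. This
  -- cancels the factor `1/(p+q)!` in `toExt` and leaves `1/(p! q!)`.
  have key (σ : Equiv.Perm (Fin (p + q))) :
      ∑ I : Fin (p + q) → Fin (Module.finrank ℝ E), (Equiv.Perm.sign σ •
        (α ((fun a => b (I a)) ∘ σ ∘ Fin.castAdd q) *
          β ((fun a => b (I a)) ∘ σ ∘ Fin.natAdd p))) • (coordProd I : Ext E) =
      ∑ I : Fin (p + q) → Fin (Module.finrank ℝ E),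
        (α (fun a => b (I (Fin.castAdd q a))) * β (fun a => b (I (Fin.natAdd p a)))) •
          (coordProd I : Ext E) := by
    rw [← (Equiv.arrowCongr σ (Equiv.refl (Fin (Module.finrank ℝ E)))).sum_comp]
    refine Finset.sum_congr rfl fun I _ => ?_
    have h : (Equiv.arrowCongr σ (Equiv.refl (Fin (Module.finrank ℝ E)))) I = I ∘ σ.symm := rfl
    have h2 : (coordProd (I ∘ σ.symm) : Ext E) = Equiv.Perm.sign σ • coordProd I := by
      rw [coordProd_comp_perm, Equiv.Perm.sign_symm]
    rw [h, h2, smul_comm, ← smul_assoc, smul_smul, Int.units_mul_self, one_smul]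
    simp [Function.comp_def]
  have split : ∑ I : Fin (p + q) → Fin (Module.finrank ℝ E),
        (α (fun a => b (I (Fin.castAdd q a))) * β (fun a => b (I (Fin.natAdd p a)))) •
          (coordProd I : Ext E) =
      (∑ I : Fin p → Fin (Module.finrank ℝ E), α (fun a => b (I a)) • coordProd I) *
        ∑ J : Fin q → Fin (Module.finrank ℝ E), β (fun a => b (J a)) • coordProd J := by
    rw [Finset.sum_mul_sum, ← Fintype.sum_prod_type', ← (Fin.appendEquiv p q).sum_comp]
    refine Finset.sum_congr rfl fun IJ _ => ?_
    simp only [smul_mul_smul_comm]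
    simp [Fin.appendEquiv, coordProd_append]
  rw [toExt_apply, toExt_apply, toExt_apply, smul_mul_smul_comm, ← split]
  simp only [wedgeAt_apply]
  have h1 : ∑ I : Fin (p + q) → Fin (Module.finrank ℝ E),
      (((p.factorial * q.factorial : ℝ)⁻¹) • ∑ σ : Equiv.Perm (Fin (p + q)),
      Equiv.Perm.sign σ • (α ((fun a => b (I a)) ∘ σ ∘ Fin.castAdd q) *
        β ((fun a => b (I a)) ∘ σ ∘ Fin.natAdd p))) • (coordProd I : Ext E) =
      ((p.factorial * q.factorial : ℂ)⁻¹) • ((p + q).factorial : ℂ) •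
      ∑ I : Fin (p + q) → Fin (Module.finrank ℝ E),
        (α (fun a => b (I (Fin.castAdd q a))) * β (fun a => b (I (Fin.natAdd p a)))) •
          (coordProd I : Ext E) := by
    have h2 : ∀ z : ℂ, ((p.factorial * q.factorial : ℝ)⁻¹) • z =
        ((p.factorial * q.factorial : ℂ)⁻¹) * z := fun z => by
      rw [Complex.real_smul]; push_cast; rfl
    simp only [h2, mul_smul (((p.factorial * q.factorial : ℂ))⁻¹), ← Finset.smul_sum]
    congr 1
    simp only [Finset.sum_smul]
    rw [Finset.sum_comm, Finset.sum_congr rfl fun σ _ => key σ, Finset.sum_const,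
      Finset.card_univ, Fintype.card_perm, Fintype.card_fin, ← Nat.cast_smul_eq_nsmul ℂ]
  rw [h1, smul_smul, smul_smul]
  congr 1
  have := Nat.factorial_ne_zero (p + q)
  field_simp

theorem toExt_ofSubsingleton (φ : E →L[ℝ] ℂ) :
    toExt (ContinuousAlternatingMap.ofSubsingleton ℝ E ℂ (0 : Fin 1) φ) =
      ExteriorAlgebra.ι ℂ φ := by
  rw [toExt_apply, ← (Equiv.funUnique (Fin 1) (Fin (Module.finrank ℝ E))).symm.sum_comp]
  conv_rhs => rw [← sum_coordForm φ, map_sum]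
  simp [coordProd, ExteriorAlgebra.ιMulti_apply]

theorem toExt_constOfIsEmpty (c : ℂ) :
    toExt (ContinuousAlternatingMap.constOfIsEmpty ℝ E (Fin 0) c) = algebraMap ℂ (Ext E) c := by
  simp [toExt_apply, coordProd, Algebra.algebraMap_eq_smul_one]

/-- The exterior derivative in the exterior algebra. -/
theorem toExt_alternatizeUncurryFin (A : E →L[ℝ] E [⋀^Fin p]→L[ℝ] ℂ) :
    toExt (ContinuousAlternatingMap.alternatizeUncurryFin A) =
      ∑ i, ExteriorAlgebra.ι ℂ (coordForm i) * toExt (A (Module.finBasis ℝ E i)) := by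
  set b := Module.finBasis ℝ E
  -- Moving the `j`-th covector to the front costs `(-1)^j`, the sign in the exterior derivative.
  -- The `p + 1` slots therefore contribute equally and turn `1/(p+1)!` into `1/p!`.
  have key (j : Fin (p + 1)) :
      ∑ I : Fin (p + 1) → Fin (Module.finrank ℝ E),
        ((-1 : ℤ) ^ j.val • A (b (I j)) (j.removeNth fun a => b (I a))) • (coordProd I : Ext E) =
      ∑ i, ∑ J : Fin p → Fin (Module.finrank ℝ E),
        A (b i) (fun a => b (J a)) • (ExteriorAlgebra.ι ℂ (coordForm i) * coordProd J) := by
    rw [← Fintype.sum_prod_type', ← (Fin.insertNthEquiv (fun _ => Fin (Module.finrank ℝ E))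
      j).sum_comp]
    refine Finset.sum_congr rfl fun iJ _ => ?_
    have h1 : (j.removeNth fun a => b ((Fin.insertNthEquiv
        (fun _ => Fin (Module.finrank ℝ E)) j) iJ a)) = fun a => b (iJ.2 a) := by
      ext1 a; simp [Fin.removeNth]
    have h2 : (coordProd ((Fin.insertNthEquiv (fun _ => Fin (Module.finrank ℝ E)) j) iJ) : Ext E) =
        (-1 : ℤ) ^ j.val • (ExteriorAlgebra.ι ℂ (coordForm iJ.1) * coordProd iJ.2) := by
      have h3 : (fun a => (coordForm ((Fin.insertNthEquiv
          (fun _ => Fin (Module.finrank ℝ E)) j) iJ a) : E →L[ℝ] ℂ)) =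
          j.insertNth (coordForm iJ.1) (fun a => coordForm (iJ.2 a)) := by
        ext1 a
        induction a using Fin.succAboveCases j <;> simp
      rw [coordProd, h3, AlternatingMap.map_insertNth]
      simp [Matrix.vecCons, coordProd, ExteriorAlgebra.ιMulti_succ_apply, Matrix.vecTail,
        Function.comp_def]
    rw [h1, h2]
    simp only [Fin.insertNthEquiv_apply, Fin.insertNth_apply_same]
    rcases neg_one_pow_eq_or ℤ j.val with h | h <;> simp [h]
  rw [toExt_apply]
  simp only [ContinuousAlternatingMap.alternatizeUncurryFin_apply, Finset.sum_smul]
  rw [Finset.sum_comm, Finset.sum_congr rfl fun j _ => key j, Finset.sum_const, Finset.card_univ,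
    Fintype.card_fin, ← Nat.cast_smul_eq_nsmul ℂ, smul_smul]
  simp only [toExt_apply, mul_smul_comm, Finset.mul_sum, ← Finset.smul_sum]
  congr 1
  rw [Nat.factorial_succ]
  push_cast
  have : (p : ℂ) + 1 ≠ 0 := by exact_mod_cast Nat.succ_ne_zero p
  field_simp

/-- Coordinate forms anticommute with forms up to the sign given by the degree. -/
theorem ι_mul_toExt (φ : E →L[ℝ] ℂ) (α : E [⋀^Fin p]→L[ℝ] ℂ) :
    ExteriorAlgebra.ι ℂ φ * toExt α = (-1 : ℂ) ^ p • (toExt α * ExteriorAlgebra.ι ℂ φ) := by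
  have key : ∀ (p : ℕ) (w : Fin p → (E →L[ℝ] ℂ)),
      ExteriorAlgebra.ι ℂ φ * ExteriorAlgebra.ιMulti ℂ p w =
        (-1 : ℂ) ^ p • (ExteriorAlgebra.ιMulti ℂ p w * ExteriorAlgebra.ι ℂ φ) := by
    intro p
    induction p with
    | zero => intro w; simp
    | succ p ih =>
      intro w
      have h := eq_neg_of_add_eq_zero_left (ExteriorAlgebra.ι_add_mul_swap (R := ℂ) φ (w 0))
      rw [ExteriorAlgebra.ιMulti_succ_apply, ← mul_assoc, h, neg_mul, mul_assoc, ih]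
      simp [pow_succ, mul_assoc]
  rw [toExt_apply, mul_smul_comm, smul_mul_assoc, smul_comm, Finset.mul_sum, Finset.sum_mul]
  congr 1
  rw [Finset.smul_sum]
  refine Finset.sum_congr rfl fun I _ => ?_
  rw [mul_smul_comm, smul_mul_assoc, coordProd, key, smul_comm]

/-- Each of the `p!` terms of the determinant contributes `α v`, against the factor `1/p!`.
Identities proved in the exterior algebra can thus be read back as identities of forms. -/
theorem evalExt_toExt (v : Fin p → E) (α : E [⋀^Fin p]→L[ℝ] ℂ) : evalExt v (toExt α) = α v := by
  rw [toExt_apply, map_smul, map_sum]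
  simp only [map_smul, coordProd, evalExt_ιMulti, Matrix.det_apply, Matrix.of_apply]
  have h : ∀ σ : Equiv.Perm (Fin p), ∑ I : Fin p → Fin (Module.finrank ℝ E),
      α (fun a => Module.finBasis ℝ E (I a)) •
        Equiv.Perm.sign σ • ∏ a, coordForm (I (σ a)) (v a) = α v := by
    intro σ
    have h1 : ∀ I : Fin p → Fin (Module.finrank ℝ E),
        ∏ a, coordForm (I (σ a)) (v a) = ∏ a, coordForm (I a) (v (σ.symm a)) := by
      intro I
      rw [← Equiv.prod_comp σ.symm]; simp
    have h2 := sum_prod_coordForm α (v ∘ σ.symm)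
    have h3 : α (v ∘ σ.symm) = Equiv.Perm.sign σ • α v := by
      have := α.toAlternatingMap.map_perm v σ.symm
      rw [Equiv.Perm.sign_symm] at this
      exact this
    simp only [h1]
    rw [h3] at h2
    have h4 : α v = Equiv.Perm.sign σ • Equiv.Perm.sign σ • α v := by
      rw [smul_smul, Int.units_mul_self, one_smul]
    rw [h4, ← h2, Finset.smul_sum]
    refine Finset.sum_congr rfl fun I _ => ?_
    rw [smul_comm, smul_eq_mul, mul_comm]; rfl
  simp only [Finset.smul_sum]
  rw [Finset.sum_comm]
  simp only [← Finset.smul_sum]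
  rw [Finset.sum_congr rfl fun σ _ => h σ, Finset.sum_const, Finset.card_univ, Fintype.card_perm,
    Fintype.card_fin, ← Nat.cast_smul_eq_nsmul ℂ, smul_smul,
    inv_mul_cancel₀ (by exact_mod_cast Nat.factorial_ne_zero p), one_smul]

/-- The Leibniz rule for the exterior derivative, in the exterior algebra. -/
theorem toExt_extDeriv_wedgeAt {α : E → E [⋀^Fin p]→L[ℝ] ℂ} {β : E → E [⋀^Fin q]→L[ℝ] ℂ} {x : E}
    (hα : DifferentiableAt ℝ α x) (hβ : DifferentiableAt ℝ β x) :
    toExt (extDeriv (fun y => wedgeAt (α y) (β y)) x) =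
      toExt (extDeriv α x) * toExt (β x) +
        (-1 : ℂ) ^ p • (toExt (α x) * toExt (extDeriv β x)) := by
  have h : fderiv ℝ (fun y => wedgeAt (α y) (β y)) x =
      (wedgeCLM E p q).precompR E (α x) (fderiv ℝ β x) +
        (wedgeCLM E p q).precompL E (fderiv ℝ α x) (β x) :=
    (wedgeCLM E p q).fderiv_of_bilinear hα hβ
  rw [extDeriv, h, toExt_alternatizeUncurryFin, extDeriv, extDeriv, toExt_alternatizeUncurryFin,
    toExt_alternatizeUncurryFin, Finset.sum_mul, Finset.mul_sum, Finset.smul_sum,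
    ← Finset.sum_add_distrib]
  refine Finset.sum_congr rfl fun i _ => ?_
  have h1 : ((wedgeCLM E p q).precompR E (α x) (fderiv ℝ β x) +
        (wedgeCLM E p q).precompL E (fderiv ℝ α x) (β x)) (Module.finBasis ℝ E i) =
      wedgeAt (α x) (fderiv ℝ β x (Module.finBasis ℝ E i)) +
        wedgeAt (fderiv ℝ α x (Module.finBasis ℝ E i)) (β x) := rfl
  rw [h1, map_add, toExt_wedgeAt, toExt_wedgeAt, mul_add, ← mul_assoc, ← mul_assoc, ι_mul_toExt,
    add_comm, smul_mul_assoc, mul_assoc (toExt (α x))]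

end ExteriorAlgebra

end ComplexGrassmann

end

/-! ### Linear maps in the coordinates of the atlas -/

noncomputable section

namespace ComplexGrassmann

open Filter Topology

section Smoothness

variable {𝕜 E : Type*} [NontriviallyNormedField 𝕜] [NormedAlgebra 𝕜 ℂ] [NormedAddCommGroup E]
  [NormedSpace 𝕜 E] {ι : Type*} [Fintype ι] [DecidableEq ι] {f : E → Matrix ι ι ℂ} {x : E}
  {m : WithTop ℕ∞}

theorem contDiffAt_det (hf : ∀ i j, ContDiffAt 𝕜 m (fun y => f y i j) x) :
    ContDiffAt 𝕜 m (fun y => (f y).det) x := by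
  simp only [Matrix.det_apply]
  refine ContDiffAt.sum fun σ _ => ?_
  have h : ContDiffAt 𝕜 m (fun y => ∏ i, f y (σ i) i) x := contDiffAt_prod fun i _ => hf _ _
  rcases Int.units_eq_one_or (Equiv.Perm.sign σ) with hσ | hσ
  · simpa [hσ] using h
  · simpa [hσ] using h.neg

theorem contDiffAt_inv_apply (hf : ∀ i j, ContDiffAt 𝕜 m (fun y => f y i j) x)
    (hx : (f x).det ≠ 0) (i j : ι) : ContDiffAt 𝕜 m (fun y => (f y)⁻¹ i j) x := by
  simp only [Matrix.inv_def, Matrix.smul_apply, Ring.inverse_eq_inv', smul_eq_mul,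
    Matrix.adjugate_apply]
  refine ((contDiffAt_det hf).inv hx).mul (contDiffAt_det fun a b => ?_)
  by_cases h : a = j
  · subst h
    simpa using contDiffAt_const
  · simpa [Matrix.updateRow_ne h] using hf a b

theorem contDiffAt_matrix_mul_apply {ι₁ ι₂ ι₃ : Type*} [Fintype ι₂] {f : E → Matrix ι₁ ι₂ ℂ}
    {g : E → Matrix ι₂ ι₃ ℂ} (hf : ∀ i j, ContDiffAt 𝕜 m (fun y => f y i j) x)
    (hg : ∀ i j, ContDiffAt 𝕜 m (fun y => g y i j) x) (i : ι₁) (j : ι₃) :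
    ContDiffAt 𝕜 m (fun y => (f y * g y) i j) x := by
  simp only [Matrix.mul_apply]
  exact ContDiffAt.sum fun a _ => (hf _ _).mul (hg _ _)

end Smoothness

variable {n k : ℕ}

/-- The frame of a chart as an `n × k` matrix. -/
def frame (e : ChartIndex n k) (Z : Model n k) : Matrix (Fin n) (Fin k) ℂ :=
  Matrix.of fun i b => frameMatrix e Z b i

/-- The rows of a matrix which are chosen by a chart. -/
def topRows (e : ChartIndex n k) (B : Matrix (Fin n) (Fin k) ℂ) : Matrix (Fin k) (Fin k) ℂ :=
  B.submatrix (fun b => e (Sum.inl b)) id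

/-- The rows of a matrix which are not chosen by a chart. -/
def botRows (e : ChartIndex n k) (B : Matrix (Fin n) (Fin k) ℂ) :
    Matrix (Fin (n - k)) (Fin k) ℂ :=
  B.submatrix (fun a => e (Sum.inr a)) id

@[simp] theorem frame_inl (e : ChartIndex n k) (Z : Model n k) (c b : Fin k) :
    frame e Z (e (Sum.inl c)) b = if c = b then 1 else 0 := by
  simp [frame, frameMatrix]

@[simp] theorem frame_inr (e : ChartIndex n k) (Z : Model n k) (a : Fin (n - k)) (b : Fin k) :
    frame e Z (e (Sum.inr a)) b = Z a b := by
  simp [frame, frameMatrix]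

theorem topRows_frame (e : ChartIndex n k) (Z : Model n k) : topRows e (frame e Z) = 1 := by
  ext c b
  simp [topRows, Matrix.one_apply]

theorem botRows_frame (e : ChartIndex n k) (Z : Model n k) :
    botRows e (frame e Z) = Matrix.of Z := by
  ext a b
  simp [botRows]

theorem topRows_mul (e : ChartIndex n k) (B : Matrix (Fin n) (Fin k) ℂ)
    (C : Matrix (Fin k) (Fin k) ℂ) : topRows e (B * C) = topRows e B * C := by
  ext c b
  simp [topRows, Matrix.mul_apply]

theorem botRows_mul (e : ChartIndex n k) (B : Matrix (Fin n) (Fin k) ℂ)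
    (C : Matrix (Fin k) (Fin k) ℂ) : botRows e (B * C) = botRows e B * C := by
  ext c b
  simp [botRows, Matrix.mul_apply]

theorem ext_rows (e : ChartIndex n k) {B C : Matrix (Fin n) (Fin k) ℂ}
    (h₁ : topRows e B = topRows e C) (h₂ : botRows e B = botRows e C) : B = C := by
  ext i b
  obtain ⟨s, rfl⟩ := e.surjective i
  rcases s with c | a
  · exact congrFun (congrFun h₁ c) b
  · exact congrFun (congrFun h₂ a) b

/-- The determinant which decides whether the linear map `M` sends `chart e Z` into the domain of
the chart `e'`. -/
def minor (M : Matrix (Fin n) (Fin n) ℂ) (e e' : ChartIndex n k) (Z : Model n k) : ℂ :=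
  (topRows e' (M * frame e Z)).det

/-- The action of the linear map `M` in the coordinates of the charts `e` and `e'`. -/
def coordChange (M : Matrix (Fin n) (Fin n) ℂ) (e e' : ChartIndex n k) (Z : Model n k) :
    Model n k :=
  fun a b => (botRows e' (M * frame e Z) * (topRows e' (M * frame e Z))⁻¹) a b

/-- The matrix form of the statement that `M` carries one subspace to the other: the moved frame is
the standard frame of the image times a change of basis. -/
theorem mul_frame {M : Matrix (Fin n) (Fin n) ℂ} {e e' : ChartIndex n k} {Z : Model n k}
    (h : minor M e e' Z ≠ 0) :
    M * frame e Z = frame e' (coordChange M e e' Z) * topRows e' (M * frame e Z) := by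
  apply ext_rows e'
  · rw [topRows_mul, topRows_frame, one_mul]
  · rw [botRows_mul, botRows_frame]
    have : Matrix.of (coordChange M e e' Z) =
        botRows e' (M * frame e Z) * (topRows e' (M * frame e Z))⁻¹ := rfl
    rw [this, Matrix.mul_assoc, Matrix.nonsing_inv_mul _ (isUnit_iff_ne_zero.2 h), Matrix.mul_one]

/-- Such a factorization is unique: the chosen rows give `C`, the other rows give `W * C`. Applying
`M'` and reading the rows chosen by `e` exhibits a left inverse of `C`. -/
theorem coordChange_eq_of_mul_frame_eq {M M' : Matrix (Fin n) (Fin n) ℂ} (hM : M' * M = 1)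
    {e e' : ChartIndex n k} {Z W : Model n k} {C : Matrix (Fin k) (Fin k) ℂ}
    (h : M * frame e Z = frame e' W * C) :
    minor M e e' Z ≠ 0 ∧ coordChange M e e' Z = W := by
  have h1 : topRows e' (M * frame e Z) = C := by rw [h, topRows_mul, topRows_frame, one_mul]
  have h2 : botRows e' (M * frame e Z) = Matrix.of W * C := by
    rw [h, botRows_mul, botRows_frame]
  have h3 : topRows e (M' * frame e' W) * C = 1 := by
    rw [← topRows_mul, Matrix.mul_assoc, ← h, ← Matrix.mul_assoc, hM, Matrix.one_mul, topRows_frame]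
  have h4 : IsUnit C.det := Matrix.isUnit_det_of_left_inverse h3
  refine ⟨by rw [minor, h1]; exact h4.ne_zero, ?_⟩
  have : coordChange M e e' Z =
      botRows e' (M * frame e Z) * (topRows e' (M * frame e Z))⁻¹ := rfl
  rw [this, h1, h2, Matrix.mul_assoc, Matrix.mul_nonsing_inv _ h4, Matrix.mul_one]
  rfl

theorem coordChange_coordChange {M M' : Matrix (Fin n) (Fin n) ℂ} (hM : M' * M = 1)
    {e e' : ChartIndex n k} {Z : Model n k} (h : minor M e e' Z ≠ 0) :
    minor M' e' e (coordChange M e e' Z) ≠ 0 ∧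
      coordChange M' e' e (coordChange M e e' Z) = Z := by
  refine coordChange_eq_of_mul_frame_eq (C := (topRows e' (M * frame e Z))⁻¹)
    (mul_eq_one_comm.1 hM) ?_
  have h1 := congrArg (fun B => M' * B * (topRows e' (M * frame e Z))⁻¹) (mul_frame h)
  rw [← Matrix.mul_assoc, hM, Matrix.one_mul, Matrix.mul_assoc M', Matrix.mul_assoc (frame e' _),
    Matrix.mul_nonsing_inv _ (isUnit_iff_ne_zero.2 h), Matrix.mul_one] at h1
  exact h1.symm

/-! ### Smoothness of the coordinate changes -/

theorem contDiff_frame (e : ChartIndex n k) (i : Fin n) (b : Fin k) {m : WithTop ℕ∞} :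
    ContDiff ℂ m (fun Z : Model n k => frame e Z i b) := by
  obtain ⟨s, rfl⟩ := e.surjective i
  rcases s with c | a
  · simpa using contDiff_const
  · simp only [frame_inr]
    fun_prop

theorem contDiff_mul_frame (M : Matrix (Fin n) (Fin n) ℂ) (e : ChartIndex n k) (i : Fin n)
    (b : Fin k) {m : WithTop ℕ∞} : ContDiff ℂ m (fun Z : Model n k => (M * frame e Z) i b) := by
  simp only [Matrix.mul_apply]
  exact ContDiff.sum fun j _ => contDiff_const.mul (contDiff_frame e j b)

theorem contDiff_minor (M : Matrix (Fin n) (Fin n) ℂ) (e e' : ChartIndex n k) {m : WithTop ℕ∞} :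
    ContDiff ℂ m (minor M e e') :=
  contDiff_iff_contDiffAt.2 fun _ => contDiffAt_det fun _ _ =>
    (contDiff_mul_frame M e _ _).contDiffAt

theorem continuous_minor (M : Matrix (Fin n) (Fin n) ℂ) (e e' : ChartIndex n k) :
    Continuous (minor M e e') := (contDiff_minor M e e' (m := 0)).continuous

theorem isOpen_minor_ne_zero (M : Matrix (Fin n) (Fin n) ℂ) (e e' : ChartIndex n k) :
    IsOpen {Z | minor M e e' Z ≠ 0} :=
  isOpen_compl_singleton.preimage (continuous_minor M e e')

theorem contDiffAt_coordChange {M : Matrix (Fin n) (Fin n) ℂ} {e e' : ChartIndex n k}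
    {Z : Model n k} (h : minor M e e' Z ≠ 0) {m : WithTop ℕ∞} :
    ContDiffAt ℂ m (coordChange M e e') Z := by
  refine contDiffAt_pi.2 fun a => contDiffAt_pi.2 fun b => ?_
  exact contDiffAt_matrix_mul_apply (fun _ _ => (contDiff_mul_frame M e _ _).contDiffAt)
    (contDiffAt_inv_apply (fun _ _ => (contDiff_mul_frame M e _ _).contDiffAt) h) a b

theorem contDiffAt_real_coordChange {M : Matrix (Fin n) (Fin n) ℂ} {e e' : ChartIndex n k}
    {Z : Model n k} (h : minor M e e' Z ≠ 0) {m : WithTop ℕ∞} :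
    ContDiffAt ℝ m (coordChange M e e') Z :=
  (contDiffAt_coordChange h).restrict_scalars ℝ

theorem differentiableAt_coordChange {M : Matrix (Fin n) (Fin n) ℂ} {e e' : ChartIndex n k}
    {Z : Model n k} (h : minor M e e' Z ≠ 0) :
    DifferentiableAt ℝ (coordChange M e e') Z :=
  (contDiffAt_real_coordChange h (m := 1)).differentiableAt one_ne_zero

/-- Coordinate changes preserve the complex orientation. -/
theorem det_fderiv_coordChange_pos {M M' : Matrix (Fin n) (Fin n) ℂ} (hM : M' * M = 1)
    {e e' : ChartIndex n k} {Z : Model n k} (h : minor M e e' Z ≠ 0) :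
    0 < (fderiv ℝ (coordChange M e e') Z).det := by
  obtain ⟨h', hinv⟩ := coordChange_coordChange hM h
  have hd : DifferentiableAt ℂ (coordChange M e e') Z :=
    (contDiffAt_coordChange h (m := 1)).differentiableAt one_ne_zero
  have hd' : DifferentiableAt ℂ (coordChange M' e' e) (coordChange M e e' Z) :=
    (contDiffAt_coordChange h' (m := 1)).differentiableAt one_ne_zero
  have hid : coordChange M' e' e ∘ coordChange M e e' =ᶠ[𝓝 Z] id := by
    filter_upwards [(isOpen_minor_ne_zero M e e').mem_nhds h] with W hW
    exact (coordChange_coordChange hM hW).2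
  have hcomp := fderiv_comp Z hd' hd
  rw [hid.fderiv_eq, fderiv_id] at hcomp
  have hdet : LinearMap.det (fderiv ℂ (coordChange M e e') Z : Model n k →ₗ[ℂ] Model n k) ≠ 0 := by
    intro h0
    have h1 := congrArg
      (fun L : Model n k →L[ℂ] Model n k => LinearMap.det (L : Model n k →ₗ[ℂ] Model n k)) hcomp
    simp [h0] at h1
  -- The real determinant of a complex linear map is the squared modulus of its complex determinant.
  have hr : (fderiv ℝ (coordChange M e e') Z).det =
      Complex.normSq
        (LinearMap.det (fderiv ℂ (coordChange M e e') Z : Model n k →ₗ[ℂ] Model n k)) := by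
    rw [hd.fderiv_restrictScalars ℝ, ← Algebra.norm_complex_apply, ← LinearMap.det_restrictScalars]
    rfl
  rw [hr]
  exact Complex.normSq_pos.2 hdet

/-! ### Charts and their overlaps -/

/-- The subspace is the graph of `Z` over the chosen coordinates. -/
theorem mem_chart {e : ChartIndex n k} {Z : Model n k} {x : EuclideanSpace ℂ (Fin n)} :
    x ∈ (chart e Z).1 ↔ ∀ a, x (e (Sum.inr a)) = ∑ b, Z a b * x (e (Sum.inl b)) := by
  constructor
  · intro hx
    refine Submodule.span_induction (p := fun x _ => ∀ a, x (e (Sum.inr a)) =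
      ∑ b, Z a b * x (e (Sum.inl b))) ?_ ?_ ?_ ?_ hx
    · rintro _ ⟨b, rfl⟩ a
      simp [frameVector, frameMatrix]
    · simp
    · intro x y _ _ hx hy a
      simp [hx a, hy a, mul_add, Finset.sum_add_distrib]
    · intro c x _ hx a
      simp [hx a, Finset.mul_sum, mul_left_comm]
  · intro hx
    have : x = ∑ b, x (e (Sum.inl b)) • frameVector e Z b := by
      ext i
      obtain ⟨s, rfl⟩ := e.surjective i
      rcases s with c | a
      · simp [frameVector, frameMatrix]
      · simp [frameVector, frameMatrix, hx a, mul_comm]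
    rw [this]
    exact Submodule.sum_mem _ fun b _ =>
      Submodule.smul_mem _ _ (Submodule.subset_span ⟨b, rfl⟩)

theorem frameVector_mem_chart (e : ChartIndex n k) (Z : Model n k) (b : Fin k) :
    frameVector e Z b ∈ (chart e Z).1 := Submodule.subset_span ⟨b, rfl⟩

theorem frameVector_apply (e : ChartIndex n k) (Z : Model n k) (b : Fin k) (i : Fin n) :
    frameVector e Z b i = frame e Z i b := rfl

theorem chart_injective (e : ChartIndex n k) : Function.Injective (chart e) := by
  intro Z W h
  ext a b
  have h1 := frameVector_mem_chart e Z b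
  rw [h, mem_chart] at h1
  simpa [frameVector_apply] using h1 a

theorem chart_coordChange_one {e e' : ChartIndex n k} {Z : Model n k} (h : minor 1 e e' Z ≠ 0) :
    chart e' (coordChange 1 e e' Z) = chart e Z := by
  have h1 := mul_frame h
  rw [Matrix.one_mul] at h1
  refine (Subtype.ext (Submodule.eq_of_le_of_finrank_eq ?_ ?_)).symm
  · refine Submodule.span_le.2 ?_
    rintro _ ⟨b, rfl⟩
    have h2 : frameVector e Z b =
        ∑ c, topRows e' (frame e Z) c b • frameVector e' (coordChange 1 e e' Z) c := by
      ext i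
      refine (congrFun (congrFun h1 i) b).trans ?_
      rw [Matrix.mul_apply]
      simp [frameVector_apply, mul_comm]
    rw [h2]
    exact Submodule.sum_mem _ fun c _ => Submodule.smul_mem _ _ (frameVector_mem_chart _ _ _)
  · rw [(chart e Z).2, (chart e' _).2]

theorem minor_one_ne_zero_of_chart_eq {e e' : ChartIndex n k} {Z W : Model n k}
    (h : chart e' W = chart e Z) : minor 1 e e' Z ≠ 0 := by
  refine (coordChange_eq_of_mul_frame_eq (M' := 1) (W := W) (C := topRows e' (frame e Z))
    (one_mul 1) ?_).1
  rw [Matrix.one_mul]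
  apply ext_rows e'
  · rw [topRows_mul, topRows_frame, one_mul]
  · ext a b
    have h1 := frameVector_mem_chart e Z b
    rw [← h, mem_chart] at h1
    rw [botRows_mul, botRows_frame, Matrix.mul_apply]
    exact h1 a

theorem mem_range_chart_iff {e e' : ChartIndex n k} {Z : Model n k} :
    chart e Z ∈ Set.range (chart e') ↔ minor 1 e e' Z ≠ 0 :=
  ⟨fun ⟨_, hW⟩ => minor_one_ne_zero_of_chart_eq hW, fun h => ⟨_, chart_coordChange_one h⟩⟩

theorem transition_eq {e e' : ChartIndex n k} {Z : Model n k} (h : minor 1 e e' Z ≠ 0) :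
    transition e e' Z = coordChange 1 e e' Z := by
  rw [transition, Function.comp_apply, ← chart_coordChange_one h]
  exact Function.leftInverse_invFun (chart_injective e') _

theorem transition_eventuallyEq {e e' : ChartIndex n k} {Z : Model n k}
    (h : minor 1 e e' Z ≠ 0) : transition e e' =ᶠ[𝓝 Z] coordChange 1 e e' := by
  filter_upwards [(isOpen_minor_ne_zero 1 e e').mem_nhds h] with W hW
  exact transition_eq hW

/-- Trades `transition`, which is defined through `Function.invFun`, for the rational map
`coordChange 1`. Both agree on an open set, so their derivatives agree as well. -/
theorem isForm_iff {p : ℕ} {α : LocalForms n k p} :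
    IsForm α ↔ (∀ e, ContDiff ℝ ((⊤ : ℕ∞) : WithTop ℕ∞) (α e)) ∧
      ∀ e e' Z, minor 1 e e' Z ≠ 0 → α e Z = (α e' (coordChange 1 e e' Z)).compContinuousLinearMap
        (fderiv ℝ (coordChange 1 e e') Z) := by
  refine and_congr_right fun _ => forall_congr' fun e => forall_congr' fun e' =>
    forall_congr' fun Z => ?_
  rw [mem_range_chart_iff]
  refine forall_congr' fun h => ?_
  rw [transition_eq h, (transition_eventuallyEq h).fderiv_eq]

end ComplexGrassmann

end

/-! ### The orthogonal projection and the unitary action -/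

noncomputable section

namespace ComplexGrassmann

open Filter Topology Matrix
open scoped ComplexOrder

variable {n k : ℕ}

/-! ### The orthogonal projection in coordinates -/

theorem frame_mulVec_eq_zero {e : ChartIndex n k} {Z : Model n k} {v : Fin k → ℂ}
    (h : frame e Z *ᵥ v = 0) : v = 0 := by
  ext b
  have h1 := congrFun h (e (Sum.inl b))
  simpa [Matrix.mulVec, dotProduct] using h1

theorem det_gram_ne_zero (e : ChartIndex n k) (Z : Model n k) :
    ((frame e Z)ᴴ * frame e Z).det ≠ 0 := by
  intro h
  obtain ⟨v, hv, h0⟩ := Matrix.exists_mulVec_eq_zero_iff.2 h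
  exact hv (frame_mulVec_eq_zero ((Matrix.conjTranspose_mul_self_mulVec_eq_zero _ _).1 h0))

/-- The matrix of the orthogonal projection onto the complement of `chart e Z`. -/
def proj (e : ChartIndex n k) (Z : Model n k) : Matrix (Fin n) (Fin n) ℂ :=
  1 - frame e Z * ((frame e Z)ᴴ * frame e Z)⁻¹ * (frame e Z)ᴴ

theorem proj_mul_frame (e : ChartIndex n k) (Z : Model n k) : proj e Z * frame e Z = 0 := by
  rw [proj, Matrix.sub_mul, Matrix.one_mul, Matrix.mul_assoc _ (frame e Z)ᴴ, Matrix.mul_assoc,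
    Matrix.nonsing_inv_mul _ (isUnit_iff_ne_zero.2 (det_gram_ne_zero e Z)), Matrix.mul_one,
    sub_self]

theorem proj_conjTranspose (e : ChartIndex n k) (Z : Model n k) : (proj e Z)ᴴ = proj e Z := by
  simp [proj, Matrix.conjTranspose_nonsing_inv, Matrix.mul_assoc]

theorem frame_conjTranspose_mul_proj (e : ChartIndex n k) (Z : Model n k) :
    (frame e Z)ᴴ * proj e Z = 0 := by
  have h := congrArg Matrix.conjTranspose (proj_mul_frame e Z)
  rwa [Matrix.conjTranspose_mul, proj_conjTranspose, Matrix.conjTranspose_zero] at h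

theorem proj_mul_proj (e : ChartIndex n k) (Z : Model n k) : proj e Z * proj e Z = proj e Z := by
  have h : proj e Z * proj e Z = (1 - frame e Z * ((frame e Z)ᴴ * frame e Z)⁻¹ * (frame e Z)ᴴ) *
    proj e Z := rfl
  rw [h, Matrix.sub_mul, Matrix.one_mul, Matrix.mul_assoc _ (frame e Z)ᴴ,
    frame_conjTranspose_mul_proj, Matrix.mul_zero, sub_zero]

theorem toLp_frame_mulVec_mem_chart (e : ChartIndex n k) (Z : Model n k) (w : Fin k → ℂ) :
    WithLp.toLp 2 (frame e Z *ᵥ w) ∈ (chart e Z).1 := by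
  have h : WithLp.toLp 2 (frame e Z *ᵥ w) = ∑ b, w b • frameVector e Z b := by
    ext i
    simp [frameVector_apply, Matrix.mulVec, dotProduct, mul_comm]
  rw [h]
  exact Submodule.sum_mem _ fun b _ => Submodule.smul_mem _ _ (frameVector_mem_chart e Z b)

/-- The `j`-th column of `proj e Z` is orthogonal to the subspace and differs from the `j`-th basis
vector by an element of the subspace; this characterizes the projection. -/
theorem complProjection_chart (e : ChartIndex n k) (Z : Model n k) :
    complProjection (chart e Z) = proj e Z := by
  ext i j
  have h1 : (WithLp.toLp 2 fun l => proj e Z l j) ∈ ((chart e Z).1)ᗮ := by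
    have h0 : ∀ x ∈ (chart e Z).1, inner ℂ x (WithLp.toLp 2 fun l => proj e Z l j) = 0 := by
      intro x hx
      refine Submodule.span_induction
        (p := fun x _ => inner ℂ x (WithLp.toLp 2 fun l => proj e Z l j) = 0) ?_ ?_ ?_ ?_ hx
      · rintro _ ⟨b, rfl⟩
        have h2 := congrFun (congrFun (frame_conjTranspose_mul_proj e Z) b) j
        simpa [Matrix.mul_apply, PiLp.inner_apply, frameVector_apply, mul_comm] using h2
      · simp
      · intro x y _ _ hx hy
        rw [inner_add_left, hx, hy, add_zero]
      · intro c x _ hx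
        rw [inner_smul_left, hx, mul_zero]
    exact (Submodule.mem_orthogonal _ _).2 h0
  have h2 : EuclideanSpace.single j (1 : ℂ) - WithLp.toLp 2 (fun l => proj e Z l j) =
      WithLp.toLp 2 (frame e Z *ᵥ
        fun b => ((((frame e Z)ᴴ * frame e Z)⁻¹ * (frame e Z)ᴴ) b j)) := by
    ext l
    have h3 : (frame e Z * (((frame e Z)ᴴ * frame e Z)⁻¹ * (frame e Z)ᴴ)) l j =
        (1 - proj e Z) l j := by rw [proj, sub_sub_cancel, Matrix.mul_assoc]
    rw [Matrix.mul_apply, Matrix.sub_apply, Matrix.one_apply] at h3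
    simpa [Matrix.mulVec, dotProduct, Pi.single_apply] using h3.symm
  have h3 := Submodule.eq_starProjection_of_mem_orthogonal h1
    (u := EuclideanSpace.single j (1 : ℂ)) (by
      rw [h2]
      exact Submodule.le_orthogonal_orthogonal _ (toLp_frame_mulVec_mem_chart e Z _))
  rw [complProjection, h3]

theorem contDiff_proj (e : ChartIndex n k) (i j : Fin n) {m : WithTop ℕ∞} :
    ContDiff ℝ m (fun Z : Model n k => proj e Z i j) := by
  have hA : ∀ (i : Fin n) (b : Fin k), ContDiff ℝ m (fun Z : Model n k => frame e Z i b) :=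
    fun i b => (contDiff_frame e i b).restrict_scalars ℝ
  have hA' : ∀ (b : Fin k) (i : Fin n), ContDiff ℝ m (fun Z : Model n k => (frame e Z)ᴴ b i) :=
    fun b i => Complex.conjCLE.contDiff.comp (hA i b)
  refine contDiff_iff_contDiffAt.2 fun Z => ?_
  simp only [proj, Matrix.sub_apply]
  refine contDiffAt_const.sub ?_
  refine contDiffAt_matrix_mul_apply (contDiffAt_matrix_mul_apply (fun _ _ => (hA _ _).contDiffAt)
    (contDiffAt_inv_apply ?_ (det_gram_ne_zero e Z))) (fun _ _ => (hA' _ _).contDiffAt) i j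
  exact contDiffAt_matrix_mul_apply (fun _ _ => (hA' _ _).contDiffAt)
    (fun _ _ => (hA _ _).contDiffAt)

/-- The new frame is `B = M F G⁻¹`, where `F` is the old frame and `G` the change of basis. `G`
cancels in `B (Bᴴ B)⁻¹ Bᴴ`, and unitarity removes `M` from the Gram matrix. -/
theorem proj_coordChange {M : Matrix (Fin n) (Fin n) ℂ} (hM : Mᴴ * M = 1)
    {e e' : ChartIndex n k} {Z : Model n k} (h : minor M e e' Z ≠ 0) :
    proj e Z = Mᴴ * proj e' (coordChange M e e' Z) * M := by
  have hA := mul_frame h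
  have hU : IsUnit (topRows e' (M * frame e Z)).det := isUnit_iff_ne_zero.2 h
  set G := topRows e' (M * frame e Z)
  set B := frame e' (coordChange M e e' Z) with hB
  have h1 : B = M * frame e Z * G⁻¹ := by
    rw [hA, Matrix.mul_assoc, Matrix.mul_nonsing_inv _ hU, Matrix.mul_one]
  have hUH : IsUnit Gᴴ.det := by rw [Matrix.det_conjTranspose]; exact hU.star
  have h2 : Bᴴ * B = Gᴴ⁻¹ * ((frame e Z)ᴴ * frame e Z) * G⁻¹ := by
    rw [h1, Matrix.conjTranspose_mul, Matrix.conjTranspose_mul, Matrix.conjTranspose_nonsing_inv]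
    calc _ = Gᴴ⁻¹ * ((frame e Z)ᴴ * ((Mᴴ * M) * frame e Z)) * G⁻¹ := by
          simp only [Matrix.mul_assoc]
      _ = _ := by rw [hM, Matrix.one_mul]
  have h3 : (Bᴴ * B)⁻¹ = G * ((frame e Z)ᴴ * frame e Z)⁻¹ * Gᴴ := by
    rw [h2, Matrix.mul_inv_rev, Matrix.mul_inv_rev, Matrix.nonsing_inv_nonsing_inv _ hU,
      Matrix.nonsing_inv_nonsing_inv _ hUH, Matrix.mul_assoc]
  rw [proj, proj, ← hB, Matrix.mul_sub, Matrix.sub_mul, Matrix.mul_one, hM, h3]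
  congr 1
  have h4 : M * frame e Z = B * G := hA
  have h5 : Mᴴ * (B * G) = frame e Z := by rw [← h4, ← Matrix.mul_assoc, hM, Matrix.one_mul]
  have h6 : (B * G)ᴴ * M = (frame e Z)ᴴ := by
    rw [← h4, Matrix.conjTranspose_mul, Matrix.mul_assoc, hM, Matrix.mul_one]
  calc frame e Z * ((frame e Z)ᴴ * frame e Z)⁻¹ * (frame e Z)ᴴ
      = (Mᴴ * (B * G)) * ((frame e Z)ᴴ * frame e Z)⁻¹ * ((B * G)ᴴ * M) := by rw [h5, h6]
    _ = _ := by simp only [Matrix.conjTranspose_mul, Matrix.mul_assoc]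

/-! ### The unitary group acts transitively -/

/-- Both subspaces have dimension `k`, so there is an isometry between them, and it extends to `ℂⁿ`.
Pointwise statements on invariant forms thereby reduce to the origin. -/
theorem exists_unitary_coordChange_eq_zero (e : ChartIndex n k) (Z : Model n k) :
    ∃ M : Matrix (Fin n) (Fin n) ℂ, Mᴴ * M = 1 ∧ minor M e e Z ≠ 0 ∧
      coordChange M e e Z = 0 := by
  let V := (chart e Z).1
  let V₀ := (chart e (0 : Model n k)).1
  have hdim : Module.finrank ℂ V = Module.finrank ℂ V₀ := (chart e Z).2.trans (chart e 0).2.symm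
  let f : V ≃ₗᵢ[ℂ] V₀ := (stdOrthonormalBasis ℂ V).equiv (stdOrthonormalBasis ℂ V₀) (finCongr hdim)
  let L : EuclideanSpace ℂ (Fin n) →ₗᵢ[ℂ] EuclideanSpace ℂ (Fin n) :=
    (V₀.subtypeₗᵢ.comp f.toLinearIsometry).extend
  have hL : ∀ x ∈ V, L x ∈ V₀ := by
    intro x hx
    have h1 : L x = f ⟨x, hx⟩ :=
      LinearIsometry.extend_apply (V₀.subtypeₗᵢ.comp f.toLinearIsometry) ⟨x, hx⟩
    rw [h1]
    exact (f ⟨x, hx⟩).2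
  let M : Matrix (Fin n) (Fin n) ℂ := Matrix.of fun i j => L (EuclideanSpace.single j (1 : ℂ)) i
  have hM : Mᴴ * M = 1 := by
    ext i j
    have h1 := L.inner_map_map (EuclideanSpace.single i (1 : ℂ)) (EuclideanSpace.single j (1 : ℂ))
    rw [EuclideanSpace.inner_single_left, PiLp.inner_apply] at h1
    simpa [Matrix.mul_apply, M, Matrix.one_apply, Pi.single_apply, mul_comm] using h1
  have hMf : ∀ b i, (M * frame e Z) i b = L (frameVector e Z b) i := by
    intro b i
    have h1 : frameVector e Z b = ∑ j, frame e Z j b • EuclideanSpace.single j (1 : ℂ) := by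
      ext l
      simp [frameVector_apply, Pi.single_apply]
    rw [h1, map_sum]
    simp [Matrix.mul_apply, M, mul_comm]
  refine ⟨M, hM, coordChange_eq_of_mul_frame_eq (C := topRows e (M * frame e Z)) hM ?_⟩
  apply ext_rows e
  · rw [topRows_mul, topRows_frame, one_mul]
  · rw [botRows_mul, botRows_frame]
    ext a b
    have h1 := mem_chart.1 (hL _ (frameVector_mem_chart e Z b)) a
    rw [← hMf] at h1
    simpa [botRows, Matrix.mul_apply] using h1

/-- The reflection in the origin of a chart. -/
theorem exists_unitary_coordChange_eq_neg (e : ChartIndex n k) :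
    ∃ M : Matrix (Fin n) (Fin n) ℂ, Mᴴ * M = 1 ∧ ∀ Z : Model n k, minor M e e Z ≠ 0 ∧
      coordChange M e e Z = -Z := by
  -- Changing the sign of the coordinates that are not chosen fixes the identity block of the frame
  -- and negates `Z`.
  let d : Fin n → ℂ := fun i => Sum.elim (fun _ => 1) (fun _ => -1) (e.symm i)
  have hd : ∀ i, d i * d i = 1 := by
    intro i
    obtain ⟨s, rfl⟩ := e.surjective i
    rcases s with c | a <;> simp [d]
  have hd' : star d = d := by
    ext i
    obtain ⟨s, rfl⟩ := e.surjective i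
    rcases s with c | a <;> simp [d]
  have hM : (Matrix.diagonal d)ᴴ * Matrix.diagonal d = 1 := by
    rw [Matrix.diagonal_conjTranspose, hd', Matrix.diagonal_mul_diagonal]
    simp [hd]
  refine ⟨Matrix.diagonal d, hM, fun Z =>
    coordChange_eq_of_mul_frame_eq (C := 1) hM ?_⟩
  rw [Matrix.mul_one]
  apply ext_rows e
  · ext c b
    simp [topRows, d]
  · ext a b
    simp [botRows, d]

end ComplexGrassmann

end

/-! ### Invariant forms and closedness of the Chern forms -/

noncomputable section

namespace ComplexGrassmann

open Filter Topology Matrix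

variable {n k p q : ℕ}

/-! ### Operations on differential forms -/

theorem contDiff_extD {α : LocalForms n k p} {e : ChartIndex n k}
    (h : ContDiff ℝ ((⊤ : ℕ∞) : WithTop ℕ∞) (α e)) :
    ContDiff ℝ ((⊤ : ℕ∞) : WithTop ℕ∞) (extD α e) := by
  change ContDiff ℝ _
    (ContinuousAlternatingMap.alternatizeUncurryFinCLM (n := p) ℝ (Model n k) ℂ ∘ fderiv ℝ (α e))
  exact ContinuousLinearMap.contDiff _ |>.comp (h.fderiv_right (m := ((⊤ : ℕ∞) : WithTop ℕ∞)) (by exact_mod_cast le_refl _))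

theorem contDiff_wedge {α : LocalForms n k p} {β : LocalForms n k q} {e : ChartIndex n k}
    {m : WithTop ℕ∞} (hα : ContDiff ℝ m (α e)) (hβ : ContDiff ℝ m (β e)) :
    ContDiff ℝ m (wedge α β e) :=
  (wedgeCLM (Model n k) p q).isBoundedBilinearMap.contDiff.comp₂ hα hβ

/-- The exterior derivative commutes with pullback, and the hypothesis holds in a neighbourhood of
`Z`. A general `M` covers both compatibility of charts (`M = 1`) and invariance. -/
theorem extDeriv_eq_pullback {α : LocalForms n k p}
    (hα : ∀ e, ContDiff ℝ ((⊤ : ℕ∞) : WithTop ℕ∞) (α e)) {M : Matrix (Fin n) (Fin n) ℂ}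
    {e e' : ChartIndex n k}
    (h : ∀ Z, minor M e e' Z ≠ 0 → α e Z = (α e' (coordChange M e e' Z)).compContinuousLinearMap
        (fderiv ℝ (coordChange M e e') Z)) {Z : Model n k} (hZ : minor M e e' Z ≠ 0) :
    extDeriv (α e) Z = (extDeriv (α e') (coordChange M e e' Z)).compContinuousLinearMap
      (fderiv ℝ (coordChange M e e') Z) := by
  have h1 : α e =ᶠ[𝓝 Z] fun Z => (α e' (coordChange M e e' Z)).compContinuousLinearMap
        (fderiv ℝ (coordChange M e e') Z) := by
    filter_upwards [(isOpen_minor_ne_zero M e e').mem_nhds hZ] with W hW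
    exact h W hW
  rw [h1.extDeriv_eq]
  refine extDeriv_pullback (r := 2) ?_ (contDiffAt_real_coordChange hZ) (by simp)
  exact ((hα e').differentiable (by simp)).differentiableAt

theorem IsForm.extD {α : LocalForms n k p} (hα : IsForm α) : IsForm (extD α) := by
  rw [isForm_iff] at hα ⊢
  exact ⟨fun e => contDiff_extD (hα.1 e), fun e e' Z hZ =>
    extDeriv_eq_pullback hα.1 (hα.2 e e') hZ⟩

theorem IsForm.wedge {α : LocalForms n k p} {β : LocalForms n k q} (hα : IsForm α)
    (hβ : IsForm β) : IsForm (wedge α β) := by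
  refine ⟨fun e => contDiff_wedge (hα.1 e) (hβ.1 e), fun e e' Z hZ => ?_⟩
  rw [ComplexGrassmann.wedge, hα.2 e e' Z hZ, hβ.2 e e' Z hZ, ← wedgeAt_compContinuousLinearMap]
  rfl

theorem IsForm.add {α β : LocalForms n k p} (hα : IsForm α) (hβ : IsForm β) :
    IsForm (α + β) := by
  refine ⟨fun e => (hα.1 e).add (hβ.1 e), fun e e' Z hZ => ?_⟩
  rw [Pi.add_apply, Pi.add_apply, hα.2 e e' Z hZ, hβ.2 e e' Z hZ]
  rfl

theorem IsForm.smul {α : LocalForms n k p} (c : ℂ) (hα : IsForm α) : IsForm (c • α) := by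
  refine ⟨fun e => (hα.1 e).const_smul c, fun e e' Z hZ => ?_⟩
  rw [Pi.smul_apply, Pi.smul_apply, hα.2 e e' Z hZ]
  rfl

theorem isForm_zero : IsForm (0 : LocalForms n k p) :=
  ⟨fun _ => contDiff_const, fun _ _ _ _ => rfl⟩

theorem isForm_wedgePow {ω : LocalForms n k 2} (hω : IsForm ω) (j : ℕ) :
    IsForm (wedgePow ω j) := by
  induction j with
  | zero => exact ⟨fun e => contDiff_const, fun e e' Z _ => by ext v; simp [wedgePow]⟩
  | succ j ih => exact ih.wedge hω

/-! ### Invariant forms -/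

/-- The local forms are invariant under the action of the unitary group. -/
def Invariant (α : LocalForms n k p) : Prop :=
  ∀ M : Matrix (Fin n) (Fin n) ℂ, Mᴴ * M = 1 → ∀ e e' Z, minor M e e' Z ≠ 0 →
    α e Z = (α e' (coordChange M e e' Z)).compContinuousLinearMap
      (fderiv ℝ (coordChange M e e') Z)

/-- Invariance under the identity matrix is compatibility on overlaps. -/
theorem Invariant.isForm {α : LocalForms n k p} (h : Invariant α)
    (hα : ∀ e, ContDiff ℝ ((⊤ : ℕ∞) : WithTop ℕ∞) (α e)) : IsForm α :=
  isForm_iff.2 ⟨hα, h 1 (by simp)⟩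

theorem Invariant.extD {α : LocalForms n k p} (h : Invariant α)
    (hα : ∀ e, ContDiff ℝ ((⊤ : ℕ∞) : WithTop ℕ∞) (α e)) : Invariant (extD α) :=
  fun M hM e e' _ hZ => extDeriv_eq_pullback hα (h M hM e e') hZ

theorem Invariant.wedge {α : LocalForms n k p} {β : LocalForms n k q} (hα : Invariant α)
    (hβ : Invariant β) : Invariant (wedge α β) := by
  intro M hM e e' Z hZ
  rw [ComplexGrassmann.wedge, hα M hM e e' Z hZ, hβ M hM e e' Z hZ,
    ← wedgeAt_compContinuousLinearMap]
  rfl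

theorem Invariant.smul {α : LocalForms n k p} (c : ℂ) (hα : Invariant α) : Invariant (c • α) := by
  intro M hM e e' Z hZ
  rw [Pi.smul_apply, Pi.smul_apply, hα M hM e e' Z hZ]
  rfl

theorem Invariant.sub {α β : LocalForms n k p} (hα : Invariant α) (hβ : Invariant β) :
    Invariant (α - β) := by
  intro M hM e e' Z hZ
  rw [Pi.sub_apply, Pi.sub_apply, hα M hM e e' Z hZ, hβ M hM e e' Z hZ]
  rfl

theorem invariant_wedgePow {ω : LocalForms n k 2} (hω : Invariant ω) (j : ℕ) :
    Invariant (wedgePow ω j) := by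
  induction j with
  | zero => exact fun M _ e e' Z _ => by ext v; simp [wedgePow]
  | succ j ih => exact ih.wedge hω

/-- Invariant forms of odd degree vanish, because the reflection in a point is unitary. -/
theorem Invariant.eq_zero_of_odd {α : LocalForms n k p} (h : Invariant α) (hp : Odd p) :
    α = 0 := by
  have h0 : ∀ e, α e 0 = 0 := by
    intro e
    obtain ⟨M, hM, hneg⟩ := exists_unitary_coordChange_eq_neg (k := k) e
    have h1 := h M hM e e 0 (hneg 0).1
    have h2 : coordChange M e e = fun Z => -Z := funext fun Z => (hneg Z).2
    simp only [h2, neg_zero] at h1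
    ext v
    have h3 := congrArg (fun β => β v) h1
    have h4 : fderiv ℝ (fun Z : Model n k => -Z) 0 = -ContinuousLinearMap.id ℝ (Model n k) := by
      rw [fderiv_fun_neg, fderiv_fun_id]
    rw [h4] at h3
    have h5 : (α e 0).compContinuousLinearMap (-ContinuousLinearMap.id ℝ (Model n k)) v =
        (-1 : ℝ) ^ p • α e 0 v := by
      have := (α e 0).toMultilinearMap.map_smul_univ (fun _ => (-1 : ℝ)) v
      simp only [Finset.prod_const, Finset.card_univ, Fintype.card_fin] at this
      refine Eq.trans ?_ this
      simp only [neg_smul, one_smul]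
      rfl
    have h6 : α e 0 v = (-1 : ℝ) ^ p • α e 0 v := h3.trans h5
    rw [hp.neg_one_pow, neg_one_smul] at h6
    simpa using self_eq_neg.1 h6
  funext e Z
  obtain ⟨M, hM, hm, hz⟩ := exists_unitary_coordChange_eq_zero e Z
  rw [h M hM e e Z hm, hz, h0]
  rfl

/-! ### The curvature -/

theorem dProjection_eq (i j : Fin n) (e : ChartIndex n k) (Z : Model n k) :
    dProjection i j e Z = ContinuousAlternatingMap.ofSubsingleton ℝ (Model n k) ℂ (0 : Fin 1)
      (fderiv ℝ (fun W => proj e W i j) Z) := by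
  simp only [dProjection, complProjection_chart]

/-- The derivative of the projection, as a matrix. -/
def dproj (e : ChartIndex n k) (Z v : Model n k) : Matrix (Fin n) (Fin n) ℂ :=
  Matrix.of fun i j => fderiv ℝ (fun W => proj e W i j) Z v

/-- The value of the curvature on two tangent vectors, as a matrix. -/
def curvatureMatrix (e : ChartIndex n k) (Z v w : Model n k) : Matrix (Fin n) (Fin n) ℂ :=
  proj e Z * (dproj e Z v * dproj e Z w - dproj e Z w * dproj e Z v)

theorem wedgeAt_ofSubsingleton {E : Type*} [NormedAddCommGroup E] [NormedSpace ℝ E]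
    [FiniteDimensional ℝ E] (φ ψ : E →L[ℝ] ℂ) (v : Fin (1 + 1) → E) :
    wedgeAt (ContinuousAlternatingMap.ofSubsingleton ℝ E ℂ (0 : Fin 1) φ)
      (ContinuousAlternatingMap.ofSubsingleton ℝ E ℂ (0 : Fin 1) ψ) v =
      φ (v 0) * ψ (v 1) - φ (v 1) * ψ (v 0) := by
  rw [← evalExt_toExt, toExt_wedgeAt, toExt_ofSubsingleton, toExt_ofSubsingleton]
  have h : ExteriorAlgebra.ι ℂ φ * ExteriorAlgebra.ι ℂ ψ =
      ExteriorAlgebra.ιMulti ℂ 2 ![φ, ψ] := by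
    simp [ExteriorAlgebra.ιMulti_apply]
  rw [h]
  refine (evalExt_ιMulti v _).trans ?_
  rw [Matrix.det_fin_two]
  simp

theorem curvature_apply (i j : Fin n) (e : ChartIndex n k) (Z : Model n k)
    (v : Fin 2 → Model n k) :
    curvature i j e Z v = curvatureMatrix e Z (v 0) (v 1) i j := by
  simp only [curvature, complProjection_chart, dProjection_eq, curvatureMatrix]
  rw [ContinuousAlternatingMap.sum_apply, Matrix.mul_apply]
  refine Finset.sum_congr rfl fun a _ => ?_
  rw [ContinuousAlternatingMap.sum_apply, Matrix.sub_apply, Matrix.mul_apply, Matrix.mul_apply,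
    ← Finset.sum_sub_distrib, Finset.mul_sum]
  refine Finset.sum_congr rfl fun b _ => ?_
  rw [ContinuousAlternatingMap.smul_apply]
  erw [wedgeAt_ofSubsingleton]
  rfl

theorem dproj_coordChange {M : Matrix (Fin n) (Fin n) ℂ} (hM : Mᴴ * M = 1)
    {e e' : ChartIndex n k} {Z : Model n k} (h : minor M e e' Z ≠ 0) (v : Model n k) :
    dproj e Z v = Mᴴ * dproj e' (coordChange M e e' Z) (fderiv ℝ (coordChange M e e') Z v) * M := by
  ext i j
  have h1 : (fun W => proj e W i j) =ᶠ[𝓝 Z] fun W => ∑ b, (∑ a, Mᴴ i a *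
      ((fun W => proj e' W a b) ∘ coordChange M e e') W) * M b j := by
    filter_upwards [(isOpen_minor_ne_zero M e e').mem_nhds h] with W hW
    rw [proj_coordChange hM hW, Matrix.mul_apply]
    simp only [Matrix.mul_apply, Function.comp_apply]
  have hd : ∀ a b, DifferentiableAt ℝ ((fun W => proj e' W a b) ∘ coordChange M e e') Z :=
    fun a b => DifferentiableAt.comp Z
      (((contDiff_proj e' a b (m := 1)).differentiable one_ne_zero).differentiableAt)
      (differentiableAt_coordChange h)
  have hc : ∀ a b, fderiv ℝ ((fun W => proj e' W a b) ∘ coordChange M e e') Z v =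
      dproj e' (coordChange M e e' Z) (fderiv ℝ (coordChange M e e') Z v) a b := by
    intro a b
    rw [fderiv_comp Z
      (((contDiff_proj e' a b (m := 1)).differentiable one_ne_zero).differentiableAt)
      (differentiableAt_coordChange h)]
    rfl
  have h2 : HasFDerivAt (fun W => ∑ b, (∑ a, Mᴴ i a *
      ((fun W => proj e' W a b) ∘ coordChange M e e') W) * M b j)
      (∑ b, M b j • ∑ a, Mᴴ i a •
        fderiv ℝ ((fun W => proj e' W a b) ∘ coordChange M e e') Z) Z := by
    refine HasFDerivAt.fun_sum fun b _ => ?_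
    refine HasFDerivAt.mul_const ?_ (M b j)
    refine HasFDerivAt.fun_sum fun a _ => ?_
    exact (hd a b).hasFDerivAt.const_mul _
  rw [dproj, Matrix.of_apply, h1.fderiv_eq, h2.fderiv, Matrix.mul_apply]
  simp [Matrix.mul_apply, hc, mul_comm]

/-- `M` is constant, so `P` and `dP` are both conjugated by it and the inner factors `M * Mᴴ`
cancel. Traces of powers of the curvature are therefore invariant. -/
theorem curvatureMatrix_coordChange {M : Matrix (Fin n) (Fin n) ℂ} (hM : Mᴴ * M = 1)
    {e e' : ChartIndex n k} {Z : Model n k} (h : minor M e e' Z ≠ 0) (v w : Model n k) :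
    curvatureMatrix e Z v w = Mᴴ * curvatureMatrix e' (coordChange M e e' Z)
      (fderiv ℝ (coordChange M e e') Z v) (fderiv ℝ (coordChange M e e') Z w) * M := by
  have hM' : M * Mᴴ = 1 := mul_eq_one_comm.1 hM
  have hc : ∀ A B : Matrix (Fin n) (Fin n) ℂ, (Mᴴ * A * M) * (Mᴴ * B * M) = Mᴴ * (A * B) * M := by
    intro A B
    calc _ = Mᴴ * (A * (M * Mᴴ) * B) * M := by simp only [Matrix.mul_assoc]
      _ = _ := by rw [hM', Matrix.mul_one]
  rw [curvatureMatrix, dproj_coordChange hM h v, dproj_coordChange hM h w,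
    proj_coordChange hM h, hc, hc, ← Matrix.sub_mul, ← Matrix.mul_sub, hc]
  rfl

theorem contDiff_dProjection (i j : Fin n) (e : ChartIndex n k) :
    ContDiff ℝ ((⊤ : ℕ∞) : WithTop ℕ∞) (dProjection (k := k) i j e) := by
  have h : dProjection (k := k) i j e = fun Z =>
      ContinuousAlternatingMap.ofSubsingletonLIE (𝕜 := ℝ) (E := Model n k) (F := ℂ) (0 : Fin 1)
        (fderiv ℝ (fun W => proj e W i j) Z) := funext fun Z => dProjection_eq i j e Z
  rw [h]
  exact (ContinuousAlternatingMap.ofSubsingletonLIE (𝕜 := ℝ) (E := Model n k) (F := ℂ) (0 : Fin 1)).contDiff.comp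
    ((contDiff_proj e i j (m := ((⊤ : ℕ∞) : WithTop ℕ∞))).fderiv_right
      (m := ((⊤ : ℕ∞) : WithTop ℕ∞)) (by exact_mod_cast le_refl _))

theorem contDiff_curvature (i j : Fin n) (e : ChartIndex n k) :
    ContDiff ℝ ((⊤ : ℕ∞) : WithTop ℕ∞) (curvature (k := k) i j e) := by
  unfold curvature
  refine ContDiff.sum fun a _ => ContDiff.sum fun b _ => ContDiff.fun_smul ?_ ?_
  · simp only [complProjection_chart]
    exact contDiff_proj e i a
  · exact contDiff_wedge (contDiff_dProjection a b e) (contDiff_dProjection b j e)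

theorem contDiff_traceF (e : ChartIndex n k) :
    ContDiff ℝ ((⊤ : ℕ∞) : WithTop ℕ∞) (traceF n k e) := by
  have h : traceF n k e = fun Z => ∑ i, curvature i i e Z := by
    ext Z; simp [traceF, Finset.sum_apply]
  rw [h]
  exact ContDiff.sum fun i _ => contDiff_curvature i i e

theorem contDiff_traceFF (e : ChartIndex n k) :
    ContDiff ℝ ((⊤ : ℕ∞) : WithTop ℕ∞) (traceFF n k e) := by
  have h : traceFF n k e = fun Z => ∑ i, ∑ j, wedge (curvature i j) (curvature j i) e Z := by
    ext Z; simp [traceFF, Finset.sum_apply]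
  rw [h]
  exact ContDiff.sum fun i _ => ContDiff.sum fun j _ =>
    contDiff_wedge (contDiff_curvature i j e) (contDiff_curvature j i e)

theorem traceF_apply (e : ChartIndex n k) (Z : Model n k) (v : Fin 2 → Model n k) :
    traceF n k e Z v = (curvatureMatrix e Z (v 0) (v 1)).trace := by
  simp only [traceF, Finset.sum_apply, ContinuousAlternatingMap.sum_apply, curvature_apply]
  rfl

theorem traceFF_apply (e : ChartIndex n k) (Z : Model n k) (v : Fin 4 → Model n k) :
    traceFF n k e Z v = (((Nat.factorial 2) * (Nat.factorial 2) : ℝ)⁻¹) •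
      ∑ σ : Equiv.Perm (Fin (2 + 2)), Equiv.Perm.sign σ •
        (curvatureMatrix e Z (v (σ 0)) (v (σ 1)) * curvatureMatrix e Z (v (σ 2)) (v (σ 3))).trace := by
  simp only [traceFF, Finset.sum_apply, ContinuousAlternatingMap.sum_apply, wedge]
  have h : ∀ i j, wedgeAt (curvature i j e Z) (curvature j i e Z) v =
      (((Nat.factorial 2) * (Nat.factorial 2) : ℝ)⁻¹) •
      ∑ σ : Equiv.Perm (Fin (2 + 2)), Equiv.Perm.sign σ •
        (curvatureMatrix e Z (v (σ 0)) (v (σ 1)) i j *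
          curvatureMatrix e Z (v (σ 2)) (v (σ 3)) j i) := by
    intro i j
    refine (wedgeAt_apply _ _ _).trans ?_
    simp only [curvature_apply]
    rfl
  simp only [h, ← Finset.smul_sum]
  congr 1
  rw [Finset.sum_congr rfl fun i _ => Finset.sum_comm, Finset.sum_comm]
  simp only [← Finset.smul_sum, Matrix.trace, Matrix.diag, Matrix.mul_apply]

theorem trace_conj {M : Matrix (Fin n) (Fin n) ℂ} (hM : Mᴴ * M = 1)
    (A : Matrix (Fin n) (Fin n) ℂ) : (Mᴴ * A * M).trace = A.trace := by
  rw [Matrix.mul_assoc, Matrix.trace_mul_comm, Matrix.mul_assoc, mul_eq_one_comm.1 hM,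
    Matrix.mul_one]

theorem invariant_traceF (n k : ℕ) : Invariant (traceF n k) := by
  intro M hM e e' Z hZ
  ext v
  simp only [ContinuousAlternatingMap.compContinuousLinearMap_apply, traceF_apply]
  rw [curvatureMatrix_coordChange hM hZ, trace_conj hM]
  rfl

theorem invariant_traceFF (n k : ℕ) : Invariant (traceFF n k) := by
  intro M hM e e' Z hZ
  have hM' : M * Mᴴ = 1 := mul_eq_one_comm.1 hM
  ext v
  simp only [ContinuousAlternatingMap.compContinuousLinearMap_apply, traceFF_apply]
  refine congrArg _ (Finset.sum_congr rfl fun σ _ => congrArg _ ?_)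
  rw [curvatureMatrix_coordChange hM hZ, curvatureMatrix_coordChange hM hZ]
  have hc : ∀ A B : Matrix (Fin n) (Fin n) ℂ, (Mᴴ * A * M) * (Mᴴ * B * M) = Mᴴ * (A * B) * M := by
    intro A B
    calc _ = Mᴴ * (A * (M * Mᴴ) * B) * M := by simp only [Matrix.mul_assoc]
      _ = _ := by rw [hM', Matrix.mul_one]
  rw [hc, trace_conj hM]
  simp only [Function.comp_apply]

theorem invariant_chernForm₁ (n k : ℕ) : Invariant (chernForm₁ n k) :=
  (invariant_traceF n k).smul _

theorem invariant_chernForm₂ (n k : ℕ) : Invariant (chernForm₂ n k) :=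
  (((invariant_traceF n k).wedge (invariant_traceF n k)).sub (invariant_traceFF n k)).smul _

theorem contDiff_chernForm₁ (e : ChartIndex n k) :
    ContDiff ℝ ((⊤ : ℕ∞) : WithTop ℕ∞) (chernForm₁ n k e) :=
  (contDiff_traceF e).const_smul (Complex.I / (2 * Real.pi))

theorem contDiff_chernForm₂ (e : ChartIndex n k) :
    ContDiff ℝ ((⊤ : ℕ∞) : WithTop ℕ∞) (chernForm₂ n k e) :=
  ((contDiff_wedge (contDiff_traceF e) (contDiff_traceF e)).sub (contDiff_traceFF e)).const_smul
    ((Complex.I / (2 * Real.pi)) ^ 2 / 2)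

/-- The exterior derivative is invariant of odd degree, hence zero; the Bianchi identity is not
needed. -/
theorem isClosedForm_chernForm₁ (n k : ℕ) : IsClosedForm (chernForm₁ n k) :=
  ⟨(invariant_chernForm₁ n k).isForm contDiff_chernForm₁,
    ((invariant_chernForm₁ n k).extD contDiff_chernForm₁).eq_zero_of_odd (by decide)⟩

theorem isClosedForm_chernForm₂ (n k : ℕ) : IsClosedForm (chernForm₂ n k) :=
  ⟨(invariant_chernForm₂ n k).isForm contDiff_chernForm₂,
    ((invariant_chernForm₂ n k).extD contDiff_chernForm₂).eq_zero_of_odd (by decide)⟩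

end ComplexGrassmann

end

/-! ### Top degree forms under change of chart -/

noncomputable section

namespace ComplexGrassmann

open Filter Topology Matrix MeasureTheory

variable {n k p q : ℕ}

instance isAddHaarMeasure_volume_model :
    (volume : Measure (Model n k)).IsAddHaarMeasure :=
  MeasureTheory.Measure.pi.isAddHaarMeasure _

/-! ### The oriented frame -/

theorem orientedFrame_linearIndependent (n k : ℕ) :
    LinearIndependent ℝ (fun i : Fin (2 * (k * (n - k))) => orientedFrame n k i.val) := by
  rw [Fintype.linearIndependent_iff]
  intro g hg i
  have hi : i.val / 2 < k * (n - k) := by omega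
  have hk : 0 < k := Nat.pos_of_ne_zero fun h => by simp [h] at hi
  have ha : i.val / 2 / k < n - k := Nat.div_lt_of_lt_mul hi
  have hb : i.val / 2 % k < k := Nat.mod_lt _ hk
  have h1 := congrFun (congrFun hg ⟨i.val / 2 / k, ha⟩) ⟨i.val / 2 % k, hb⟩
  simp only [Finset.sum_apply, Pi.smul_apply, orientedFrame, Nat.div_add_mod', Pi.zero_apply] at h1
  -- Only two frame vectors meet a given matrix entry, with values `1` and `I`; real and imaginary
  -- parts separate them.
  have hne : ∀ j : Fin (2 * (k * (n - k))), j ≠ i → j.val / 2 = i.val / 2 →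
      j.val % 2 ≠ i.val % 2 := fun j hj h2 h3 => hj (Fin.ext (by omega))
  rcases Nat.mod_two_eq_zero_or_one i.val with h0 | h0
  · have h2 := congrArg Complex.re h1
    rw [Complex.re_sum, Finset.sum_eq_single i] at h2
    · simpa [h0] using h2
    · intro j _ hj
      by_cases h3 : j.val / 2 = i.val / 2
      · have := hne j hj h3
        simp [h3, show j.val % 2 = 1 by omega]
      · simp [h3]
    · simp
  · have h2 := congrArg Complex.im h1
    rw [Complex.im_sum, Finset.sum_eq_single i] at h2
    · simpa [h0] using h2
    · intro j _ hj
      by_cases h3 : j.val / 2 = i.val / 2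
      · have := hne j hj h3
        simp [h3, show j.val % 2 = 0 by omega]
      · simp [h3]
    · simp

theorem finrank_model (n k : ℕ) : Module.finrank ℝ (Model n k) = 2 * (k * (n - k)) := by
  simp [Module.finrank_pi_fintype, Complex.finrank_real_complex]
  ring

/-- The oriented frame as a basis. -/
def orientedBasis (n k : ℕ) : Module.Basis (Fin (2 * (k * (n - k)))) ℝ (Model n k) :=
  basisOfLinearIndependentOfCardEqFinrank' _ (orientedFrame_linearIndependent n k)
    (by rw [finrank_model, Fintype.card_fin])

theorem orientedBasis_apply (i : Fin (2 * (k * (n - k)))) :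
    orientedBasis n k i = orientedFrame n k i.val := by
  simp [orientedBasis]

/-- A real form of top degree is a multiple of the determinant in a basis; this is applied to the
real and imaginary parts of `α`. -/
theorem top_form_comp (hp : p = 2 * (k * (n - k))) (α : Model n k [⋀^Fin p]→L[ℝ] ℂ)
    (L : Model n k →L[ℝ] Model n k) :
    α (fun i => L (orientedFrame n k i.val)) = L.det • α (fun i => orientedFrame n k i.val) := by
  subst hp
  have hb : (fun i : Fin (2 * (k * (n - k))) => orientedFrame n k i.val) = orientedBasis n k :=
    funext fun i => (orientedBasis_apply i).symm
  have key : ∀ f : Model n k [⋀^Fin (2 * (k * (n - k)))]→ₗ[ℝ] ℝ,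
      f (L ∘ orientedBasis n k) = L.det * f (orientedBasis n k) := by
    intro f
    have h1 := congrArg (fun g : Model n k [⋀^Fin (2 * (k * (n - k)))]→ₗ[ℝ] ℝ =>
      g (L ∘ orientedBasis n k)) (f.eq_smul_basis_det (orientedBasis n k))
    have h2 := (orientedBasis n k).det_comp (L : Model n k →ₗ[ℝ] Model n k) (orientedBasis n k)
    rw [Module.Basis.det_self, mul_one] at h2
    refine h1.trans ?_
    rw [AlternatingMap.smul_apply, smul_eq_mul, mul_comm]
    congr 1
  have hre := key (Complex.reLm.compAlternatingMap α.toAlternatingMap)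
  have him := key (Complex.imLm.compAlternatingMap α.toAlternatingMap)
  have hL : (fun i : Fin (2 * (k * (n - k))) => L (orientedFrame n k i.val)) =
      L ∘ orientedBasis n k := by rw [← hb]; rfl
  rw [hL, hb]
  apply Complex.ext
  · simpa using hre
  · simpa using him

/-- The coefficient of a top degree form in a chart. -/
def topCoeff (α : LocalForms n k p) (e : ChartIndex n k) (Z : Model n k) : ℂ :=
  α e Z fun i => orientedFrame n k i.val

theorem topCoeff_eq (hp : p = 2 * (k * (n - k))) {α : LocalForms n k p}
    {M : Matrix (Fin n) (Fin n) ℂ} {e e' : ChartIndex n k} {Z : Model n k}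
    (h : α e Z = (α e' (coordChange M e e' Z)).compContinuousLinearMap
      (fderiv ℝ (coordChange M e e') Z)) :
    topCoeff α e Z = (fderiv ℝ (coordChange M e e') Z).det •
      topCoeff α e' (coordChange M e e' Z) := by
  rw [topCoeff, h]
  exact top_form_comp hp _ _

/-! ### The complement of a chart domain is a null set -/

/-- Rows chosen by both charts are already unit vectors. The partial injection they define extends
to a permutation, and `v` is chosen so that the remaining rows complete its permutation matrix. -/
theorem exists_minor_ne_zero (e e' : ChartIndex n k) : ∃ v : Model n k, minor 1 e e' v ≠ 0 := by
  classical
  let f : Fin k → Fin k := fun b' => Sum.elim id (fun _ => b') (e.symm (e' (Sum.inl b')))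
  let s : Finset (Fin k) := Finset.univ.filter fun b' => (e.symm (e' (Sum.inl b'))).isLeft
  have hfs : Set.InjOn f s := by
    intro b₁ h₁ b₂ h₂ h
    simp only [s, Finset.coe_filter, Finset.mem_univ, true_and, Set.mem_ofPred_eq,
      Sum.isLeft_iff] at h₁ h₂
    obtain ⟨c₁, h₁⟩ := h₁
    obtain ⟨c₂, h₂⟩ := h₂
    simp only [f, h₁, h₂, Sum.elim_inl, id] at h
    have h3 := h₁.trans ((congrArg Sum.inl h).trans h₂.symm)
    exact Sum.inl_injective (e'.injective (e.symm.injective h3))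
  obtain ⟨g, hg⟩ := Finset.exists_equiv_extend_of_card_eq (t := (Finset.univ : Finset (Fin k)))
    (by simp) (s := s) (f := f) (by simp) hfs
  let π : Equiv.Perm (Fin k) := g.trans (Equiv.subtypeUnivEquiv (by simp))
  have hπ : ∀ b' c, e.symm (e' (Sum.inl b')) = Sum.inl c → π b' = c := by
    intro b' c h
    have h1 := hg b' (by simp [s, h])
    have h2 : π b' = (g b' : Fin k) := rfl
    rw [h2, h1]
    simp [f, h]
  refine ⟨fun a b => if ∃ b', e.symm (e' (Sum.inl b')) = Sum.inr a ∧ π b' = b then 1 else 0, ?_⟩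
  rw [minor, Matrix.one_mul]
  have h : topRows e' (frame e fun a b =>
      if ∃ b', e.symm (e' (Sum.inl b')) = Sum.inr a ∧ π b' = b then (1 : ℂ) else 0) =
      (Equiv.Perm.permMatrix ℂ π) := by
    ext b' b
    rw [topRows, Matrix.submatrix_apply, id, Equiv.Perm.permMatrix, PEquiv.toMatrix_apply]
    simp only [Equiv.toPEquiv_apply, Option.mem_some_iff]
    rcases hs : e.symm (e' (Sum.inl b')) with c | a
    · have : e' (Sum.inl b') = e (Sum.inl c) := by rw [← hs]; simp
      rw [this, frame_inl, hπ b' c hs]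
    · have : e' (Sum.inl b') = e (Sum.inr a) := by rw [← hs]; simp
      rw [this, frame_inr]
      congr 1
      apply propext
      constructor
      · rintro ⟨b'', h1, h2⟩
        have h3 := Sum.inl_injective (e'.injective (e.symm.injective (h1.trans hs.symm)))
        rw [← h3, h2]
      · intro h1
        exact ⟨b', hs, h1⟩
  rw [h, Matrix.det_permutation]
  simp

/-- The determinant is a polynomial in `s` with constant coefficient `B.det`. -/
theorem finite_det_smul_add_eq_zero {B C : Matrix (Fin k) (Fin k) ℂ} (hB : B.det ≠ 0) :
    {s : ℂ | (s • C + B).det = 0}.Finite := by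
  let P : Polynomial ℂ := ((Polynomial.X : Polynomial ℂ) • C.map Polynomial.C + B.map Polynomial.C).det
  have hP : P ≠ 0 := by
    intro h
    have h0 : P.coeff 0 = B.det := Polynomial.coeff_det_X_add_C_zero C B
    exact hB (by simpa [h] using h0.symm)
  refine (Polynomial.finite_setOfPred_isRoot hP).subset fun s hs => ?_
  have h1 : P.eval s = (s • C + B).det := by
    rw [← Polynomial.coe_evalRingHom, RingHom.map_det]
    congr 1
    ext i j
    simp
    exact mul_comm _ _
  rw [Set.mem_ofPred_eq, Polynomial.IsRoot, h1]
  exact hs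

/-- Rows already chosen by `e` do not depend on `Z` and `v`. Dividing each of the other rows by `t`
puts the minor along the line into the form of `finite_det_smul_add_eq_zero`, with parameter `t⁻¹`.
-/
theorem minor_add_smul_eq_zero {e e' : ChartIndex n k} {Z v : Model n k} {t : ℝ} (ht : t ≠ 0)
    (h : minor 1 e e' (Z + t • v) = 0) :
    (((t⁻¹ : ℝ) : ℂ) • (topRows e' (frame e Z) - topRows e' (frame e 0)) +
      topRows e' (frame e v)).det = 0 := by
  let d : Fin k → ℂ := fun b => Sum.elim (fun _ => 1) (fun _ => (t : ℂ)) (e.symm (e' (Sum.inl b)))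
  have hd : ∀ b, d b ≠ 0 := by
    intro b
    rcases hs : e.symm (e' (Sum.inl b)) with c | a <;> simp [d, hs, ht]
  have h1 : topRows e' (frame e (Z + t • v)) = Matrix.diagonal d *
      (((t⁻¹ : ℝ) : ℂ) • (topRows e' (frame e Z) - topRows e' (frame e 0)) +
      topRows e' (frame e v)) := by
    ext b' b
    rw [Matrix.diagonal_mul]
    rcases hs : e.symm (e' (Sum.inl b')) with c | a
    · have : e' (Sum.inl b') = e (Sum.inl c) := by rw [← hs]; simp
      simp [topRows, d, this]
    · have : e' (Sum.inl b') = e (Sum.inr a) := by rw [← hs]; simp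
      have ht' : (t : ℂ) ≠ 0 := by exact_mod_cast ht
      simp [topRows, d, this]
      field_simp
  rw [minor, Matrix.one_mul, h1, Matrix.det_mul, Matrix.det_diagonal] at h
  exact (mul_eq_zero.1 h).resolve_left (Finset.prod_ne_zero_iff.2 fun b _ => hd b)

/-- Every line in the direction `v` meets the zero set in finitely many points, so the set is null
by Fubini. -/
theorem ae_minor_ne_zero (e e' : ChartIndex n k) :
    ∀ᵐ Z : Model n k, minor 1 e e' Z ≠ 0 := by
  obtain ⟨v, hv⟩ := exists_minor_ne_zero e e'
  rw [minor, Matrix.one_mul] at hv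
  let L : ℝ →ₗ[ℝ] Model n k := LinearMap.toSpanSingleton ℝ (Model n k) v
  refine ae_mem_of_ae_add_linearMap_mem L volume volume (s := {Z | minor 1 e e' Z ≠ 0})
    (isOpen_minor_ne_zero 1 e e').measurableSet fun Z => ?_
  have hfin : ({0} ∪ (fun t : ℝ => ((t⁻¹ : ℝ) : ℂ)) ⁻¹' {s : ℂ | (s •
      (topRows e' (frame e Z) - topRows e' (frame e 0)) +
      topRows e' (frame e v)).det = 0}).Finite := by
    refine (Set.finite_singleton _).union ((finite_det_smul_add_eq_zero hv).preimage ?_)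
    intro a _ b _ hab
    simpa using hab
  refine (measure_eq_zero_iff_ae_notMem.1 (hfin.measure_zero volume)).mono fun t ht h => ?_
  apply ht
  by_cases h0 : t = 0
  · exact Or.inl h0
  · exact Or.inr (minor_add_smul_eq_zero h0 (by simpa [L] using h))

/-! ### Change of variables -/

theorem image_coordChange (e e' : ChartIndex n k) :
    coordChange 1 e e' '' {Z | minor 1 e e' Z ≠ 0} = {Z | minor 1 e' e Z ≠ 0} := by
  have h1 : (1 : Matrix (Fin n) (Fin n) ℂ) * 1 = 1 := one_mul 1
  ext W
  constructor
  · rintro ⟨Z, hZ, rfl⟩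
    exact (coordChange_coordChange h1 hZ).1
  · intro hW
    exact ⟨_, (coordChange_coordChange h1 hW).1, (coordChange_coordChange h1 hW).2⟩

theorem injOn_coordChange (e e' : ChartIndex n k) :
    Set.InjOn (coordChange 1 e e') {Z | minor 1 e e' Z ≠ 0} := by
  intro Z hZ W hW h
  have h1 : (1 : Matrix (Fin n) (Fin n) ℂ) * 1 = 1 := one_mul 1
  rw [← (coordChange_coordChange h1 hZ).2, h, (coordChange_coordChange h1 hW).2]

/-- The change of variables formula produces the absolute value of the Jacobian; orientation makes
it superfluous. -/
theorem abs_det_smul_topCoeff (hp : p = 2 * (k * (n - k))) {α : LocalForms n k p}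
    (hα : IsForm α) {e e' : ChartIndex n k} {Z : Model n k} (hZ : minor 1 e e' Z ≠ 0) :
    |(fderiv ℝ (coordChange 1 e e') Z).det| • topCoeff α e' (coordChange 1 e e' Z) =
      topCoeff α e Z := by
  rw [abs_of_pos (det_fderiv_coordChange_pos (one_mul 1) hZ),
    topCoeff_eq hp ((isForm_iff.1 hα).2 e e' Z hZ)]

theorem continuous_topCoeff {α : LocalForms n k p} {e : ChartIndex n k} (h : Continuous (α e)) :
    Continuous (topCoeff α e) :=
  (ContinuousAlternatingMap.apply ℝ (Model n k) ℂ
    (fun i : Fin p => orientedFrame n k i.val)).continuous.comp h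

/-- The form `α` has compact support in the domain of the chart `c`. -/
structure SupportedIn (α : LocalForms n k p) (c : ChartIndex n k) : Prop where
  eq_zero : ∀ e Z, minor 1 e c Z = 0 → α e Z = 0
  hasCompactSupport : HasCompactSupport (α c)

theorem SupportedIn.integrable_self {α : LocalForms n k p} {c : ChartIndex n k}
    (hs : SupportedIn α c) (hα : IsForm α) : Integrable (topCoeff α c) :=
  (continuous_topCoeff (hα.1 c).continuous).integrable_of_hasCompactSupport
    (hs.hasCompactSupport.comp_left (g := fun β : Model n k [⋀^Fin p]→L[ℝ] ℂ =>
      β fun i => orientedFrame n k i.val) rfl)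

theorem SupportedIn.integrable (hp : p = 2 * (k * (n - k))) {α : LocalForms n k p}
    {c : ChartIndex n k} (hs : SupportedIn α c) (hα : IsForm α) (e : ChartIndex n k) :
    Integrable (topCoeff α e) := by
  have h1 := (integrableOn_image_iff_integrableOn_abs_det_fderiv_smul volume
    (isOpen_minor_ne_zero 1 c e).measurableSet
    (fun Z hZ => (differentiableAt_coordChange hZ).hasFDerivAt.hasFDerivWithinAt)
    (injOn_coordChange c e) (topCoeff α e)).2 (by
      refine (hs.integrable_self hα).integrableOn.congr_fun (fun Z hZ => ?_)
        (isOpen_minor_ne_zero 1 c e).measurableSet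
      exact (abs_det_smul_topCoeff hp hα hZ).symm)
  rw [image_coordChange] at h1
  rw [← integrableOn_univ]
  refine h1.of_forall_sdiff_eq_zero MeasurableSet.univ fun Z hZ => ?_
  have h2 : minor 1 e c Z = 0 := by simpa using hZ.2
  rw [topCoeff, hs.eq_zero e Z h2]
  rfl

/-- The overlap has full measure in the chart `c`, while in the chart `e` the form vanishes off the
overlap. -/
theorem SupportedIn.integral_eq (hp : p = 2 * (k * (n - k))) {α : LocalForms n k p}
    {c : ChartIndex n k} (hs : SupportedIn α c) (hα : IsForm α) (e : ChartIndex n k) :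
    ∫ Z, topCoeff α e Z = ∫ Z, topCoeff α c Z := by
  have h1 := integral_image_eq_integral_abs_det_fderiv_smul volume
    (isOpen_minor_ne_zero 1 c e).measurableSet
    (fun Z hZ => (differentiableAt_coordChange hZ).hasFDerivAt.hasFDerivWithinAt)
    (injOn_coordChange c e) (topCoeff α e)
  rw [image_coordChange, setIntegral_congr_fun (isOpen_minor_ne_zero 1 c e).measurableSet
    (fun Z hZ => abs_det_smul_topCoeff hp hα hZ)] at h1
  rw [← setIntegral_eq_integral_of_forall_compl_eq_zero (s := {Z | minor 1 e c Z ≠ 0}), h1]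
  · refine (setIntegral_congr_set (t := Set.univ) ?_).trans setIntegral_univ
    filter_upwards [ae_minor_ne_zero c e] with Z hZ
    exact propext ⟨fun _ => trivial, fun _ => hZ⟩
  · intro Z hZ
    have h2 : minor 1 e c Z = 0 := by simpa using hZ
    rw [topCoeff, hs.eq_zero e Z h2]
    rfl

end ComplexGrassmann

end

/-! ### Partition of unity and Stokes' theorem -/

noncomputable section

namespace ComplexGrassmann

open Filter Topology Matrix MeasureTheory

variable {n k p q : ℕ}

/-! ### A partition of unity -/

theorem minor_self (e : ChartIndex n k) (Z : Model n k) : minor 1 e e Z = 1 := by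
  rw [minor, Matrix.one_mul, topRows_frame, Matrix.det_one]

/-- The minors are Plücker coordinates: a change of chart multiplies all of them by one common
factor, so `weight` is a function on the manifold. -/
theorem minor_coordChange {e e' : ChartIndex n k} {Z : Model n k} (h : minor 1 e e' Z ≠ 0)
    (c : ChartIndex n k) :
    minor 1 e c Z = minor 1 e' c (coordChange 1 e e' Z) * minor 1 e e' Z := by
  have h1 := mul_frame h
  rw [minor, h1, topRows_mul, Matrix.det_mul, minor, minor, Matrix.one_mul (frame e' _)]

/-- The sum of the squared absolute values of the minors. -/
def minorSum (e : ChartIndex n k) (Z : Model n k) : ℝ := ∑ c, Complex.normSq (minor 1 e c Z)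

theorem one_le_minorSum (e : ChartIndex n k) (Z : Model n k) : 1 ≤ minorSum e Z := by
  have h := Finset.single_le_sum (f := fun c => Complex.normSq (minor 1 e c Z))
    (fun c _ => Complex.normSq_nonneg _) (Finset.mem_univ e)
  simpa [minorSum, minor_self] using h

/-- The relative size of the minor which defines the chart `c`. -/
def weight (c e : ChartIndex n k) (Z : Model n k) : ℝ :=
  Complex.normSq (minor 1 e c Z) / minorSum e Z

theorem minorSum_coordChange {e e' : ChartIndex n k} {Z : Model n k} (h : minor 1 e e' Z ≠ 0) :
    minorSum e Z = minorSum e' (coordChange 1 e e' Z) * Complex.normSq (minor 1 e e' Z) := by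
  rw [minorSum, minorSum, Finset.sum_mul]
  exact Finset.sum_congr rfl fun c _ => by rw [minor_coordChange h c, map_mul]

theorem weight_coordChange {e e' : ChartIndex n k} {Z : Model n k} (h : minor 1 e e' Z ≠ 0)
    (c : ChartIndex n k) : weight c e Z = weight c e' (coordChange 1 e e' Z) := by
  rw [weight, weight, minorSum_coordChange h, minor_coordChange h, map_mul]
  exact mul_div_mul_right _ _ (Complex.normSq_pos.2 h).ne'

theorem sum_weight (e : ChartIndex n k) (Z : Model n k) : ∑ c, weight c e Z = 1 := by
  simp only [weight, ← Finset.sum_div]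
  exact div_self (zero_lt_one.trans_le (one_le_minorSum e Z)).ne'

theorem contDiff_normSq_minor (c e : ChartIndex n k) {m : WithTop ℕ∞} :
    ContDiff ℝ m (fun Z => Complex.normSq (minor 1 e c Z)) := by
  have h : ContDiff ℝ m (minor 1 e c) := (contDiff_minor 1 e c).restrict_scalars ℝ
  simp only [Complex.normSq_apply]
  have hre : ContDiff ℝ m (fun Z => (minor 1 e c Z).re) := Complex.reCLM.contDiff.comp h
  have him : ContDiff ℝ m (fun Z => (minor 1 e c Z).im) := Complex.imCLM.contDiff.comp h
  exact (hre.mul hre).add (him.mul him)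

theorem contDiff_weight (c e : ChartIndex n k) {m : WithTop ℕ∞} : ContDiff ℝ m (weight c e) := by
  refine (contDiff_normSq_minor c e).div (ContDiff.sum fun c _ => contDiff_normSq_minor c e)
    fun Z => ?_
  exact (zero_lt_one.trans_le (one_le_minorSum e Z)).ne'

variable (n k) in
/-- The threshold below which a chart is not used at a point. -/
def threshold : ℝ := (2 * Fintype.card (ChartIndex n k))⁻¹

/-- The unnormalized cut-off function of the chart `c`. -/
def cutoff (c e : ChartIndex n k) (Z : Model n k) : ℝ :=
  expNegInvGlue (weight c e Z - threshold n k)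

theorem contDiff_cutoff (c e : ChartIndex n k) :
    ContDiff ℝ ((⊤ : ℕ∞) : WithTop ℕ∞) (cutoff c e) :=
  expNegInvGlue.contDiff.comp ((contDiff_weight c e).sub contDiff_const)

/-- The weights sum to `1`. If none exceeded the threshold, half the average weight, their sum would
be at most `1/2`. -/
theorem sum_cutoff_pos (e : ChartIndex n k) (Z : Model n k) : 0 < ∑ c, cutoff c e Z := by
  refine Finset.sum_pos' (fun c _ => expNegInvGlue.nonneg _) ?_
  by_contra! h
  have hC : (0 : ℝ) < Fintype.card (ChartIndex n k) := by
    exact_mod_cast Fintype.card_pos_iff.2 ⟨e⟩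
  have h1 : ∀ c, weight c e Z ≤ threshold n k := by
    intro c
    by_contra! h2
    exact absurd (h c (Finset.mem_univ c)) (not_le.2 (expNegInvGlue.pos_of_pos (sub_pos.2 h2)))
  have h2 : ∑ c, weight c e Z ≤ ∑ _c : ChartIndex n k, threshold n k :=
    Finset.sum_le_sum fun c _ => h1 c
  rw [sum_weight, Finset.sum_const, Finset.card_univ, nsmul_eq_mul, threshold] at h2
  have h3 : (Fintype.card (ChartIndex n k) : ℝ) *
      (2 * (Fintype.card (ChartIndex n k) : ℝ))⁻¹ = 1 / 2 := by
    field_simp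
  rw [h3] at h2
  norm_num at h2

/-- A partition of unity subordinate to the atlas. -/
def partition (c e : ChartIndex n k) (Z : Model n k) : ℝ := cutoff c e Z / ∑ c', cutoff c' e Z

theorem contDiff_partition (c e : ChartIndex n k) :
    ContDiff ℝ ((⊤ : ℕ∞) : WithTop ℕ∞) (partition c e) :=
  (contDiff_cutoff c e).div (ContDiff.sum fun c _ => contDiff_cutoff c e)
    fun Z => (sum_cutoff_pos e Z).ne'

theorem sum_partition (e : ChartIndex n k) (Z : Model n k) : ∑ c, partition c e Z = 1 := by
  simp only [partition, ← Finset.sum_div]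
  exact div_self (sum_cutoff_pos e Z).ne'

theorem partition_coordChange {e e' : ChartIndex n k} {Z : Model n k} (h : minor 1 e e' Z ≠ 0)
    (c : ChartIndex n k) : partition c e Z = partition c e' (coordChange 1 e e' Z) := by
  simp only [partition, cutoff, weight_coordChange h]

theorem partition_eq_zero {c e : ChartIndex n k} {Z : Model n k}
    (h : weight c e Z ≤ threshold n k) : partition c e Z = 0 := by
  rw [partition, cutoff, expNegInvGlue.zero_of_nonpos (sub_nonpos.2 h), zero_div]

/-- Exchanging one chosen coordinate for one that is not chosen replaces a single row of the
identity matrix by a row of `Z`. -/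
theorem exists_minor_eq_entry (c : ChartIndex n k) (a : Fin (n - k)) (b : Fin k) :
    ∃ c' : ChartIndex n k, ∀ Z : Model n k, minor 1 c c' Z = Z a b := by
  refine ⟨(Equiv.swap (Sum.inl b) (Sum.inr a)).trans c, fun Z => ?_⟩
  rw [minor, Matrix.one_mul]
  have h : topRows ((Equiv.swap (Sum.inl b) (Sum.inr a)).trans c) (frame c Z) =
      (1 : Matrix (Fin k) (Fin k) ℂ).updateRow b (Z a) := by
    ext b' d
    simp only [topRows, Matrix.submatrix_apply, Equiv.trans_apply, id]
    by_cases hb : b' = b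
    · subst hb
      simp
    · rw [Equiv.swap_apply_of_ne_of_ne (by simpa using hb) (by simp), frame_inl,
        Matrix.updateRow_ne hb, Matrix.one_apply]
  rw [h, ← Matrix.cramer_transpose_apply, Matrix.transpose_one, Matrix.cramer_one]
  rfl

/-- In its own chart the minor of `c` is `1`, so a weight above the threshold bounds the sum of all
squared minors, and the entries of `Z` are among the minors. This gives compact support. -/
theorem norm_le_of_partition_ne_zero {c : ChartIndex n k} {Z : Model n k}
    (h : partition c c Z ≠ 0) : ‖Z‖ ≤ 1 + 2 * Fintype.card (ChartIndex n k) := by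
  have h1 : threshold n k < weight c c Z := by
    by_contra! h1
    exact h (partition_eq_zero h1)
  have hC : (0 : ℝ) < Fintype.card (ChartIndex n k) := by
    exact_mod_cast Fintype.card_pos_iff.2 ⟨c⟩
  have hS := one_le_minorSum c Z
  rw [weight, minor_self, map_one, threshold, one_div, inv_lt_inv₀ (by positivity)
    (by linarith)] at h1
  have hpos : (0 : ℝ) ≤ 1 + 2 * Fintype.card (ChartIndex n k) := by positivity
  refine (pi_norm_le_iff_of_nonneg hpos).2 fun a => (pi_norm_le_iff_of_nonneg hpos).2 fun b => ?_
  obtain ⟨c', hc'⟩ := exists_minor_eq_entry c a b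
  have h2 := Finset.single_le_sum (f := fun c' => Complex.normSq (minor 1 c c' Z))
    (fun c _ => Complex.normSq_nonneg _) (Finset.mem_univ c')
  simp only [hc'] at h2
  have h3 : Complex.normSq (Z a b) < 2 * Fintype.card (ChartIndex n k) := h2.trans_lt h1
  rw [Complex.normSq_eq_norm_sq] at h3
  nlinarith [norm_nonneg (Z a b), sq_nonneg (‖Z a b‖ - 1)]

/-- The part of a form in the domain of the chart `c`. -/
def localize (c : ChartIndex n k) (α : LocalForms n k p) : LocalForms n k p :=
  fun e Z => partition c e Z • α e Z

theorem sum_localize (α : LocalForms n k p) : ∑ c, localize c α = α := by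
  funext e Z
  simp only [Finset.sum_apply, localize, ← Finset.sum_smul, sum_partition, one_smul]

theorem IsForm.localize {α : LocalForms n k p} (hα : IsForm α) (c : ChartIndex n k) :
    IsForm (localize c α) := by
  rw [isForm_iff] at hα ⊢
  refine ⟨fun e => (contDiff_partition c e).smul (hα.1 e), fun e e' Z hZ => ?_⟩
  rw [ComplexGrassmann.localize, hα.2 e e' Z hZ, partition_coordChange hZ]
  rfl

/-- Since the threshold is positive, the cut-off vanishes near every zero of the minor and not only
on the zero set; hence the exterior derivative vanishes there too. -/
theorem localize_eventually_eq_zero {c e : ChartIndex n k} {Z : Model n k}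
    (h : minor 1 e c Z = 0) (α : LocalForms n k p) : localize c α e =ᶠ[𝓝 Z] 0 := by
  have hC : (0 : ℝ) < Fintype.card (ChartIndex n k) := by
    exact_mod_cast Fintype.card_pos_iff.2 ⟨c⟩
  have h0 : weight c e Z < threshold n k := by
    rw [weight, h, map_zero, zero_div, threshold]
    positivity
  filter_upwards [(contDiff_weight c e (m := 0)).continuous.continuousAt.eventually
    (gt_mem_nhds h0)] with W hW
  rw [localize, partition_eq_zero hW.le]
  exact zero_smul ℝ (α e W)

theorem hasCompactSupport_localize (c : ChartIndex n k) (α : LocalForms n k p) :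
    HasCompactSupport (localize c α c) := by
  refine HasCompactSupport.of_support_subset_isCompact (K := Metric.closedBall 0
    (1 + 2 * Fintype.card (ChartIndex n k))) (isCompact_closedBall _ _) fun Z hZ => ?_
  rw [mem_closedBall_zero_iff]
  refine norm_le_of_partition_ne_zero (c := c) fun h => hZ ?_
  rw [localize, h]
  exact zero_smul ℝ (α c Z)

theorem supportedIn_localize (c : ChartIndex n k) (α : LocalForms n k p) :
    SupportedIn (localize c α) c :=
  ⟨fun _ _ h => (localize_eventually_eq_zero h α).self_of_nhds, hasCompactSupport_localize c α⟩

theorem supportedIn_extD_localize (c : ChartIndex n k) (α : LocalForms n k p) :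
    SupportedIn (extD (localize c α)) c := by
  refine ⟨fun e Z h => ?_, ?_⟩
  · have h1 := (localize_eventually_eq_zero h α).extDeriv_eq
    refine h1.trans ?_
    rw [extDeriv, Pi.zero_def, fderiv_fun_const]
    exact map_zero (ContinuousAlternatingMap.alternatizeUncurryFinCLM ℝ (Model n k) ℂ)
  · refine ((hasCompactSupport_localize c α).fderiv (𝕜 := ℝ)).comp_left
      (g := ContinuousAlternatingMap.alternatizeUncurryFin) ?_
    exact map_zero (ContinuousAlternatingMap.alternatizeUncurryFinCLM ℝ (Model n k) ℂ)

/-! ### Integrability and the theorem of Stokes -/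

theorem topCoeff_sum {ι : Type*} (s : Finset ι) (α : ι → LocalForms n k p) (e : ChartIndex n k)
    (Z : Model n k) : topCoeff (∑ c ∈ s, α c) e Z = ∑ c ∈ s, topCoeff (α c) e Z := by
  simp only [topCoeff, Finset.sum_apply, ContinuousAlternatingMap.sum_apply]

theorem IsForm.integrable {α : LocalForms n k p} (hα : IsForm α) (hp : p = 2 * (k * (n - k)))
    (e : ChartIndex n k) : Integrable (topCoeff α e) := by
  have h : topCoeff α e = fun Z => ∑ c, topCoeff (ComplexGrassmann.localize c α) e Z := by
    funext Z
    rw [← topCoeff_sum, sum_localize]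
  rw [h]
  exact integrable_finsetSum _ fun c _ => (supportedIn_localize c α).integrable hp (hα.localize c) e

theorem extD_sum {ι : Type*} (s : Finset ι) {α : ι → LocalForms n k p}
    (hα : ∀ i, IsForm (α i)) : extD (∑ i ∈ s, α i) = ∑ i ∈ s, extD (α i) := by
  funext e Z
  have h1 : (∑ i ∈ s, α i) e = fun Z => ∑ i ∈ s, α i e Z := by
    funext Z; simp [Finset.sum_apply]
  simp only [extD, extDeriv, h1, Finset.sum_apply]
  rw [fderiv_fun_sum fun i _ => (((hα i).1 e).differentiable (by simp)).differentiableAt]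
  exact map_sum (ContinuousAlternatingMap.alternatizeUncurryFinCLM ℝ (Model n k) ℂ) _ _

/-- Integration by parts against the constant function `1`. -/
theorem integral_fderiv_eq_zero {E : Type*} [NormedAddCommGroup E] [NormedSpace ℝ E]
    [FiniteDimensional ℝ E] [MeasurableSpace E] [BorelSpace E] (μ : Measure E)
    [μ.IsAddHaarMeasure] {f : E → ℂ} (hf : ContDiff ℝ 1 f) (hs : HasCompactSupport f) (v : E) :
    ∫ x, fderiv ℝ f x v ∂μ = 0 := by
  have h1 : Continuous fun x => fderiv ℝ f x v := by
    have := hf.continuous_fderiv one_ne_zero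
    fun_prop
  have h2 : HasCompactSupport fun x => fderiv ℝ f x v :=
    (hs.fderiv (𝕜 := ℝ)).comp_left (g := fun L : E →L[ℝ] ℂ => L v) rfl
  have h := integral_mul_fderiv_eq_neg_fderiv_mul_of_integrable (μ := μ) (f := fun _ : E => (1 : ℂ))
    (g := f) (v := v) (by simp) (by simpa using h1.integrable_of_hasCompactSupport h2)
    (by simpa using hf.continuous.integrable_of_hasCompactSupport hs)
    (fun x _ => differentiableAt_const _)
    (fun x _ => (hf.differentiable one_ne_zero).differentiableAt)
  simpa using h

theorem integral_extDeriv_eq_zero {β : Model n k → Model n k [⋀^Fin p]→L[ℝ] ℂ}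
    (hβ : ContDiff ℝ 1 β) (hs : HasCompactSupport β) (v : Fin (p + 1) → Model n k) :
    ∫ Z, extDeriv β Z v = 0 := by
  have h1 : ∀ w : Fin p → Model n k, ContDiff ℝ 1 fun Z => β Z w := fun w =>
    (ContinuousAlternatingMap.apply ℝ (Model n k) ℂ w).contDiff.comp hβ
  have h2 : ∀ w : Fin p → Model n k, HasCompactSupport fun Z => β Z w := fun w =>
    hs.comp_left (g := fun γ : Model n k [⋀^Fin p]→L[ℝ] ℂ => γ w) rfl
  simp only [extDeriv_apply ((hβ.differentiable one_ne_zero).differentiableAt)]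
  rw [integral_finsetSum]
  · refine Finset.sum_eq_zero fun i _ => ?_
    have h3 := integral_fderiv_eq_zero volume (h1 (i.removeNth v)) (h2 _) (v i)
    rcases neg_one_pow_eq_or ℤ i.val with h | h <;> simp [h, integral_neg, h3]
  · intro i _
    suffices h : Integrable fun Z => fderiv ℝ (fun Z => β Z (i.removeNth v)) Z (v i) by
      rcases neg_one_pow_eq_or ℤ i.val with h' | h'
      · simpa [h'] using h
      · simpa [h'] using h.neg
    refine Continuous.integrable_of_hasCompactSupport ?_
      (((h2 _).fderiv (𝕜 := ℝ)).comp_left (g := fun L : Model n k →L[ℝ] ℂ => L (v i)) rfl)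
    have := (h1 (i.removeNth v)).continuous_fderiv one_ne_zero
    fun_prop

/-- The theorem of Stokes on the Grassmann manifold. -/
theorem integral_topCoeff_extD {η : LocalForms n k p} (hη : IsForm η)
    (hp : p + 1 = 2 * (k * (n - k))) (e : ChartIndex n k) :
    ∫ Z, topCoeff (extD η) e Z = 0 := by
  have h : ∀ Z, topCoeff (extD η) e Z = ∑ c, topCoeff (extD (localize c η)) e Z := by
    intro Z
    rw [← topCoeff_sum, ← extD_sum _ fun c => hη.localize c, sum_localize]
  simp only [h]
  rw [integral_finsetSum _ fun c _ =>
    (supportedIn_extD_localize c η).integrable hp (hη.localize c).extD e]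
  refine Finset.sum_eq_zero fun c _ => ?_
  -- Each piece is integrated in its own chart, where it has compact support.
  rw [(supportedIn_extD_localize c η).integral_eq hp (hη.localize c).extD e]
  exact integral_extDeriv_eq_zero (((hη.localize c).1 c).of_le (by exact_mod_cast le_top))
    (hasCompactSupport_localize c η) _

end ComplexGrassmann

end

/-! ### Traces of curvature powers in top degree -/

noncomputable section

namespace ComplexGrassmann

open CliffordAlgebra (contractLeft)

section Pointwise

variable {V : Type*} [AddCommGroup V] [Module ℂ V]

/-- The submodule of elements of degree `j`. -/
abbrev degPart (V : Type*) [AddCommGroup V] [Module ℂ V] (j : ℕ) :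
    Submodule ℂ (ExteriorAlgebra ℂ V) := LinearMap.range (ExteriorAlgebra.ι ℂ : V →ₗ[ℂ] _) ^ j

theorem ι_mem_degPart (v : V) : ExteriorAlgebra.ι ℂ v ∈ degPart V 1 := by
  rw [degPart, pow_one]
  exact ⟨v, rfl⟩

theorem mul_mem_degPart {i j : ℕ} {X Y : ExteriorAlgebra ℂ V} (hX : X ∈ degPart V i)
    (hY : Y ∈ degPart V j) : X * Y ∈ degPart V (i + j) := by
  rw [degPart, pow_add]
  exact Submodule.mul_mem_mul hX hY

theorem degPart_eq_bot [FiniteDimensional ℂ V] {j : ℕ} (h : Module.finrank ℂ V < j) :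
    degPart V j = ⊥ := by
  refine (ExteriorAlgebra.ιMulti_span_fixedDegree (R := ℂ) (M := V) j).symm.trans ?_
  rw [Submodule.span_eq_bot]
  rintro _ ⟨v, rfl⟩
  refine AlternatingMap.map_linearDependent _ v fun hv => ?_
  have := hv.fintype_card_le_finrank
  rw [Fintype.card_fin] at this
  omega

/-- Elements of degree two are central. -/
theorem ι_mul_ι_commute (u v : V) (X : ExteriorAlgebra ℂ V) :
    Commute (ExteriorAlgebra.ι ℂ u * ExteriorAlgebra.ι ℂ v) X := by
  induction X using ExteriorAlgebra.induction with
  | algebraMap r => exact (Algebra.commutes r _).symm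
  | ι w =>
    have h1 := eq_neg_of_add_eq_zero_left (ExteriorAlgebra.ι_add_mul_swap (R := ℂ) v w)
    have h2 := eq_neg_of_add_eq_zero_left (ExteriorAlgebra.ι_add_mul_swap (R := ℂ) u w)
    rw [Commute, SemiconjBy, mul_assoc, h1, mul_neg, ← mul_assoc, h2, neg_mul, neg_neg, mul_assoc]
  | mul X Y hX hY => exact hX.mul_right hY
  | add X Y hX hY => exact hX.add_right hY

theorem contractLeft_ι_mul_ι_mul (d : Module.Dual ℂ V) (u v : V) (X : ExteriorAlgebra ℂ V) :
    contractLeft d (ExteriorAlgebra.ι ℂ u * ExteriorAlgebra.ι ℂ v * X) =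
      d u • (ExteriorAlgebra.ι ℂ v * X) - d v • (ExteriorAlgebra.ι ℂ u * X) +
        ExteriorAlgebra.ι ℂ u * ExteriorAlgebra.ι ℂ v * contractLeft d X := by
  rw [mul_assoc]
  erw [CliffordAlgebra.contractLeft_ι_mul, CliffordAlgebra.contractLeft_ι_mul]
  rw [mul_sub, mul_smul_comm, mul_assoc]
  abel

section SquareZero

variable {S : Type*} (x y : S → V)

/-- The two-form attached to a pair of coordinates. -/
def area (s : S) : ExteriorAlgebra ℂ V := ExteriorAlgebra.ι ℂ (x s) * ExteriorAlgebra.ι ℂ (y s)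

theorem area_commute (s : S) (X : ExteriorAlgebra ℂ V) : Commute (area x y s) X :=
  ι_mul_ι_commute _ _ X

theorem area_mul_self (s : S) : area x y s * area x y s = 0 := by
  rw [area, mul_assoc, ((ι_mul_ι_commute (x s) (y s) (ExteriorAlgebra.ι ℂ (y s))).eq).symm,
    mul_assoc, ExteriorAlgebra.ι_sq_zero, mul_zero, mul_zero]

/-- The binomial formula for a central element of square zero stops after the linear term. -/
theorem area_add_pow (s : S) (X : ExteriorAlgebra ℂ V) (j : ℕ) :
    (area x y s + X) ^ (j + 1) = X ^ (j + 1) + (j + 1 : ℂ) • (area x y s * X ^ j) := by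
  induction j with
  | zero => simp [add_comm]
  | succ j ih =>
    have hc := (area_commute x y s (X ^ (j + 1))).eq
    rw [pow_succ', ih, add_mul, mul_add, mul_add, mul_smul_comm, mul_smul_comm, ← mul_assoc,
      area_mul_self, zero_mul, smul_zero, add_zero, ← mul_assoc,
      ← (area_commute x y s X).eq, mul_assoc, ← pow_succ', ← pow_succ']
    push_cast
    rw [add_smul ((j : ℂ) + 1) 1, one_smul]
    abel

variable {x y}

theorem contractLeft_sum_area_pow {D : Module.Dual ℂ V} {T : Finset S}
    (hx : ∀ t ∈ T, D (x t) = 0) (hy : ∀ t ∈ T, D (y t) = 0) (j : ℕ) :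
    contractLeft D ((∑ t ∈ T, area x y t) ^ j) = 0 := by
  induction j with
  | zero => rw [pow_zero]; erw [CliffordAlgebra.contractLeft_one]
  | succ j ih =>
    rw [pow_succ', Finset.sum_mul, map_sum]
    refine Finset.sum_eq_zero fun t ht => ?_
    rw [area, contractLeft_ι_mul_ι_mul, hx t ht, hy t ht, ih]
    simp

/-- The power is a nonzero multiple of the product of all areas. In the induction, the vanishing
part leaves only the term containing the new area; contracting with `d' s` and then `d s` strips
that area off. -/
theorem sum_area_pow_card [DecidableEq S] {d d' : S → Module.Dual ℂ V}
    (hdx : ∀ s t, d s (x t) = 0) (hdy : ∀ s t, d s (y t) = if s = t then 1 else 0)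
    (hdx' : ∀ s t, d' s (x t) = if s = t then 1 else 0) (hdy' : ∀ s t, d' s (y t) = 0)
    (T : Finset S) :
    (∑ t ∈ T, area x y t) ^ T.card ≠ 0 ∧ (∑ t ∈ T, area x y t) ^ (T.card + 1) = 0 := by
  induction T using Finset.induction_on with
  | empty => simp
  | insert s T hs ih =>
    rw [Finset.card_insert_of_notMem hs, Finset.sum_insert hs]
    constructor
    · rw [area_add_pow, ih.2, zero_add]
      intro h0
      have h1 := (smul_eq_zero.1 h0).resolve_left (by exact_mod_cast Nat.succ_ne_zero T.card)
      have hne : ∀ t ∈ T, s ≠ t := fun t ht h => hs (h ▸ ht)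
      have h2 := congrArg (contractLeft (d' s)) h1
      rw [area, contractLeft_ι_mul_ι_mul, hdx', hdy', if_pos rfl, one_smul, zero_smul, sub_zero,
        contractLeft_sum_area_pow (fun t ht => by rw [hdx', if_neg (hne t ht)])
          (fun t _ => hdy' s t), mul_zero, add_zero, map_zero] at h2
      have h3 := congrArg (contractLeft (d s)) h2
      erw [CliffordAlgebra.contractLeft_ι_mul] at h3
      rw [hdy, if_pos rfl, one_smul, contractLeft_sum_area_pow (fun t _ => hdx s t)
          (fun t ht => by rw [hdy, if_neg (hne t ht)]), mul_zero, sub_zero, map_zero] at h3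
      exact ih.1 h3
    · rw [area_add_pow, ih.2, mul_zero, smul_zero, add_zero, pow_succ, ih.2, zero_mul]

end SquareZero

variable {A B : Type*} [Fintype B]

/-- The curvature at the origin of a chart. -/
def curv (x y : A → B → V) (a c : A) : ExteriorAlgebra ℂ V :=
  ∑ b, ExteriorAlgebra.ι ℂ (x a b) * ExteriorAlgebra.ι ℂ (y c b)

/-- The operator which replaces the index `a` of a conjugate coordinate by the index `c`. -/
def replaceOp (y : A → B → V) (d : A → B → Module.Dual ℂ V) (a c : A) :
    ExteriorAlgebra ℂ V →ₗ[ℂ] ExteriorAlgebra ℂ V :=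
  ∑ b, (LinearMap.mulLeft ℂ (ExteriorAlgebra.ι ℂ (y c b))).comp (contractLeft (d a b))

variable {x y : A → B → V} {d : A → B → Module.Dual ℂ V}

theorem replaceOp_apply (a c : A) (X : ExteriorAlgebra ℂ V) :
    replaceOp y d a c X = ∑ b, ExteriorAlgebra.ι ℂ (y c b) * contractLeft (d a b) X := by
  simp [replaceOp, LinearMap.sum_apply]

theorem curv_commute (a c : A) (X : ExteriorAlgebra ℂ V) : Commute (curv x y a c) X :=
  Commute.sum_left _ _ _ fun _ _ => ι_mul_ι_commute _ _ X

theorem curv_mem (a c : A) : curv x y a c ∈ degPart V 2 :=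
  Submodule.sum_mem _ fun _ _ => mul_mem_degPart (ι_mem_degPart _) (ι_mem_degPart _)

variable [Fintype A]

/-- The trace of the curvature. -/
def tr₁ (x y : A → B → V) : ExteriorAlgebra ℂ V := ∑ a, curv x y a a

/-- The trace of the square of the curvature. -/
def tr₂ (x y : A → B → V) : ExteriorAlgebra ℂ V := ∑ a, ∑ c, curv x y a c * curv x y c a

/-- The trace of the cube of the curvature. -/
def tr₃ (x y : A → B → V) : ExteriorAlgebra ℂ V :=
  ∑ a, ∑ c, ∑ e, curv x y a c * (curv x y c e * curv x y e a)

theorem tr₁_mem : tr₁ x y ∈ degPart V 2 := Submodule.sum_mem _ fun _ _ => curv_mem _ _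

theorem tr₁_pow_mem (j : ℕ) : tr₁ x y ^ j ∈ degPart V (2 * j) := by
  rw [degPart, pow_mul]
  exact Submodule.pow_mem_pow _ tr₁_mem j

theorem tr₂_mem : tr₂ x y ∈ degPart V 4 :=
  Submodule.sum_mem _ fun _ _ => Submodule.sum_mem _ fun _ _ =>
    mul_mem_degPart (curv_mem _ _) (curv_mem _ _)

theorem tr₁_commute (X : ExteriorAlgebra ℂ V) : Commute (tr₁ x y) X :=
  Commute.sum_left _ _ _ fun _ _ => curv_commute _ _ X

variable [DecidableEq A] [DecidableEq B] (hdx : ∀ a b c e, d a b (x c e) = 0)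
  (hdy : ∀ a b c e, d a b (y c e) = if a = c ∧ b = e then 1 else 0)

include hdx hdy

omit [Fintype A] in
-- The operator is a contraction followed by a multiplication, hence an even derivation, and the
-- Leibniz rule carries no sign. It turns `y f b` into `y c b` exactly when `f = a`.
theorem replaceOp_curv_mul (a c e f : A) (X : ExteriorAlgebra ℂ V) :
    replaceOp y d a c (curv x y e f * X) =
      (if a = f then curv x y e c * X else 0) + curv x y e f * replaceOp y d a c X := by
  have h1 : ∀ b, contractLeft (d a b) (curv x y e f * X) =
      -(if a = f then ExteriorAlgebra.ι ℂ (x e b) * X else 0) +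
        curv x y e f * contractLeft (d a b) X := by
    intro b
    rw [curv, Finset.sum_mul, map_sum, Finset.sum_mul]
    simp only [contractLeft_ι_mul_ι_mul, hdx, hdy, zero_smul, zero_sub, Finset.sum_add_distrib]
    congr 1
    by_cases h : a = f
    · simp [h]
    · simp [h]
  have h2 : ∀ b, ExteriorAlgebra.ι ℂ (y c b) * contractLeft (d a b) (curv x y e f * X) =
      (if a = f then ExteriorAlgebra.ι ℂ (x e b) * ExteriorAlgebra.ι ℂ (y c b) * X else 0) +
        curv x y e f * (ExteriorAlgebra.ι ℂ (y c b) * contractLeft (d a b) X) := by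
    intro b
    rw [h1, mul_add, ← mul_assoc, ← (curv_commute e f (ExteriorAlgebra.ι ℂ (y c b))).eq, mul_assoc]
    congr 1
    split_ifs with h
    · have h3 := eq_neg_of_add_eq_zero_left
        (ExteriorAlgebra.ι_add_mul_swap (R := ℂ) (x e b) (y c b))
      rw [h3, mul_neg, neg_mul, mul_assoc]
    · simp
  rw [replaceOp_apply, Finset.sum_congr rfl fun b _ => h2 b, Finset.sum_add_distrib,
    ← Finset.mul_sum, ← replaceOp_apply]
  congr 1
  split_ifs with h
  · rw [curv, Finset.sum_mul]
  · simp

omit [Fintype A] in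
theorem replaceOp_curv (a c e f : A) :
    replaceOp y d a c (curv x y e f) = if a = f then curv x y e c else 0 := by
  have h := replaceOp_curv_mul hdx hdy a c e f 1
  have h1 : replaceOp y d a c 1 = 0 := by
    rw [replaceOp_apply]
    refine Finset.sum_eq_zero fun b _ => ?_
    erw [CliffordAlgebra.contractLeft_one]
    rw [mul_zero]
  simpa [h1] using h

theorem replaceOp_tr₁_mul (a c : A) (X : ExteriorAlgebra ℂ V) :
    replaceOp y d a c (tr₁ x y * X) = curv x y a c * X + tr₁ x y * replaceOp y d a c X := by
  rw [tr₁, Finset.sum_mul, map_sum]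
  simp only [replaceOp_curv_mul hdx hdy, Finset.sum_add_distrib, Finset.sum_mul]
  simp

theorem replaceOp_tr₁_pow_mul (a c : A) (j : ℕ) (X : ExteriorAlgebra ℂ V) :
    replaceOp y d a c (tr₁ x y ^ (j + 1) * X) =
      (j + 1 : ℂ) • (tr₁ x y ^ j * (curv x y a c * X)) +
        tr₁ x y ^ (j + 1) * replaceOp y d a c X := by
  induction j with
  | zero => simp [replaceOp_tr₁_mul hdx hdy]
  | succ j ih =>
    rw [pow_succ', mul_assoc, replaceOp_tr₁_mul hdx hdy, ih, mul_add, mul_smul_comm, ← mul_assoc,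
      ← mul_assoc, ← mul_assoc, ← pow_succ', (curv_commute a c (tr₁ x y ^ (j + 1))).eq, mul_assoc]
    push_cast
    rw [add_smul ((j : ℂ) + 1) 1, one_smul]
    simp only [mul_assoc]
    abel

theorem replaceOp_tr₂ (a c : A) :
    replaceOp y d a c (tr₂ x y) = (2 : ℂ) • ∑ e, curv x y a e * curv x y e c := by
  have h : ∀ e f, replaceOp y d a c (curv x y e f * curv x y f e) =
      (if a = f then curv x y f e * curv x y e c else 0) +
        (if a = e then curv x y e f * curv x y f c else 0) := by
    intro e f
    rw [replaceOp_curv_mul hdx hdy, replaceOp_curv hdx hdy]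
    congr 1
    · split_ifs with h
      · exact (curv_commute e c _).eq
      · rfl
    · split_ifs with h
      · rfl
      · simp
  rw [tr₂, map_sum]
  simp only [map_sum, h, Finset.sum_add_distrib]
  rw [two_smul]
  congr 1
  · simp
  · rw [Finset.sum_comm]; simp

variable [FiniteDimensional ℂ V] {N : ℕ} (hV : Module.finrank ℂ V ≤ 2 * N)

include hV

omit [Fintype A] hdx in
-- The product of `y c b` and `X` is zero for reasons of degree. Contracting this relation with `d a
-- b` evaluates each summand of the operator.
theorem replaceOp_top (a c : A) {X : ExteriorAlgebra ℂ V} (hX : X ∈ degPart V (2 * N)) :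
    replaceOp y d a c X = if a = c then (Fintype.card B : ℂ) • X else 0 := by
  have h0 : ∀ b, ExteriorAlgebra.ι ℂ (y c b) * X = 0 := by
    intro b
    have h := mul_mem_degPart (ι_mem_degPart (y c b)) hX
    rw [degPart_eq_bot (by omega)] at h
    exact (Submodule.mem_bot ℂ).1 h
  have h1 : ∀ b, ExteriorAlgebra.ι ℂ (y c b) * contractLeft (d a b) X =
      if a = c then X else 0 := by
    intro b
    have h := congrArg (contractLeft (d a b)) (h0 b)
    erw [CliffordAlgebra.contractLeft_ι_mul] at h
    rw [hdy, map_zero, sub_eq_zero] at h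
    rw [← h]
    by_cases h2 : a = c <;> simp [h2]
  rw [replaceOp_apply, Finset.sum_congr rfl fun b _ => h1 b]
  split_ifs with h
  · rw [Finset.sum_const, Finset.card_univ, Nat.cast_smul_eq_nsmul]
  · simp

/-- The operator is evaluated on `tr₁ ^ (j + 1) * X` in two ways: by the Leibniz rule and as a
scalar in top degree. This removes one curvature factor from a product of top degree. -/
theorem wick (a c : A) {j : ℕ} {X : ExteriorAlgebra ℂ V}
    (hX : tr₁ x y ^ (j + 1) * X ∈ degPart V (2 * N)) :
    (j + 1 : ℂ) • (tr₁ x y ^ j * (curv x y a c * X)) =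
      (if a = c then (Fintype.card B : ℂ) • (tr₁ x y ^ (j + 1) * X) else 0) -
        tr₁ x y ^ (j + 1) * replaceOp y d a c X := by
  rw [← replaceOp_top hdy hV a c hX, replaceOp_tr₁_pow_mul hdx hdy]
  abel

/-- `wick` with `X = curv c a`, which the operator turns into `curv c c`. The scalar term gives
`card B`, the free sum over the other index gives `card A`. -/
theorem tr₁_pow_mul_tr₂ {j : ℕ} (hj : j + 2 = N) :
    (j + 1 : ℂ) • (tr₁ x y ^ j * tr₂ x y) =
      ((Fintype.card B : ℂ) - Fintype.card A) • (tr₁ x y ^ (j + 1) * tr₁ x y) := by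
  have hm : ∀ a c, tr₁ x y ^ (j + 1) * curv x y a c ∈ degPart V (2 * N) := fun a c => by
    have := mul_mem_degPart (tr₁_pow_mem (x := x) (y := y) (j + 1)) (curv_mem (x := x) (y := y) a c)
    rwa [show 2 * (j + 1) + 2 = 2 * N by omega] at this
  rw [tr₂]
  simp only [Finset.mul_sum, Finset.smul_sum]
  simp only [wick hdx hdy hV _ _ (hm _ _), replaceOp_curv hdx hdy, if_true,
    Finset.sum_sub_distrib, Finset.sum_ite_eq, Finset.mem_univ]
  rw [← Finset.smul_sum, Finset.sum_const, Finset.card_univ, ← Finset.mul_sum,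
    sub_smul, Nat.cast_smul_eq_nsmul ℂ (Fintype.card A)]
  rfl

/-- `wick` with `X = curv c e * curv e a`. The operator hits the first factor only for `e = a`,
which yields `tr₁ * tr₁`; hitting the second yields `tr₂`. -/
theorem tr₁_pow_mul_tr₃ {j : ℕ} (hj : j + 3 = N) :
    (j + 1 : ℂ) • (tr₁ x y ^ j * tr₃ x y) =
      tr₁ x y ^ (j + 1) * (((Fintype.card B : ℂ) - Fintype.card A) • tr₂ x y -
        tr₁ x y * tr₁ x y) := by
  have hm : ∀ a c e, tr₁ x y ^ (j + 1) * (curv x y c e * curv x y e a) ∈ degPart V (2 * N) :=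
    fun a c e => by
      have := mul_mem_degPart (tr₁_pow_mem (x := x) (y := y) (j + 1))
        (mul_mem_degPart (curv_mem (x := x) (y := y) c e) (curv_mem (x := x) (y := y) e a))
      rwa [show 2 * (j + 1) + (2 + 2) = 2 * N by omega] at this
  have h1 : ∀ a c, ∑ e, (j + 1 : ℂ) • (tr₁ x y ^ j * (curv x y a c *
      (curv x y c e * curv x y e a))) =
      (if a = c then (Fintype.card B : ℂ) • (tr₁ x y ^ (j + 1) *
        ∑ e, curv x y c e * curv x y e a) else 0) -
      tr₁ x y ^ (j + 1) * (curv x y c c * curv x y a a) -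
      tr₁ x y ^ (j + 1) * ∑ e, curv x y c e * curv x y e c := by
    intro a c
    simp only [wick hdx hdy hV _ _ (hm _ _ _), replaceOp_curv_mul hdx hdy, replaceOp_curv hdx hdy,
      if_true, Finset.sum_sub_distrib, mul_add, Finset.sum_add_distrib]
    rw [← sub_sub, Finset.mul_sum, Finset.mul_sum, Finset.smul_sum]
    congr 1
    congr 1
    · split_ifs with h
      · rfl
      · simp
    · simp
  rw [tr₃]
  simp only [Finset.mul_sum, Finset.smul_sum]
  rw [Finset.sum_congr rfl fun a _ => Finset.sum_congr rfl fun c _ => h1 a c]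
  simp only [Finset.sum_sub_distrib, Finset.sum_ite_eq, Finset.mem_univ, if_true,
    Finset.sum_const, Finset.card_univ]
  simp only [← Finset.mul_sum, ← Finset.smul_sum]
  have h2 : ∑ a, ∑ c, curv x y c c * curv x y a a = tr₁ x y * tr₁ x y := by
    rw [tr₁, Finset.sum_mul_sum, Finset.sum_comm]
  have h3 : ∑ a, ∑ c, curv x y a c * curv x y c a = tr₂ x y := rfl
  rw [h2, h3, mul_sub, mul_smul_comm, sub_smul, Nat.cast_smul_eq_nsmul ℂ (Fintype.card A)]
  abel

/-- `wick` with `X = curv c a * tr₂`. The term with `tr₃` arises when the operator hits either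
factor in the second trace, whence the coefficient `2`. -/
theorem tr₁_pow_mul_tr₂_mul_tr₂ {j : ℕ} (hj : j + 4 = N) :
    (j + 1 : ℂ) • (tr₁ x y ^ j * (tr₂ x y * tr₂ x y)) =
      tr₁ x y ^ (j + 1) * (((Fintype.card B : ℂ) - Fintype.card A) • (tr₁ x y * tr₂ x y) -
        (2 : ℂ) • tr₃ x y) := by
  have hm : ∀ a c, tr₁ x y ^ (j + 1) * (curv x y c a * tr₂ x y) ∈ degPart V (2 * N) :=
    fun a c => by
      have := mul_mem_degPart (tr₁_pow_mem (x := x) (y := y) (j + 1))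
        (mul_mem_degPart (curv_mem (x := x) (y := y) c a) (tr₂_mem (x := x) (y := y)))
      rwa [show 2 * (j + 1) + (2 + 4) = 2 * N by omega] at this
  have h1 : ∀ a c, (j + 1 : ℂ) • (tr₁ x y ^ j * (curv x y a c * (curv x y c a * tr₂ x y))) =
      (if a = c then (Fintype.card B : ℂ) • (tr₁ x y ^ (j + 1) *
        (curv x y c a * tr₂ x y)) else 0) -
      tr₁ x y ^ (j + 1) * (curv x y c c * tr₂ x y) -
      (2 : ℂ) • (tr₁ x y ^ (j + 1) * ∑ e, curv x y c a * (curv x y a e * curv x y e c)) := by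
    intro a c
    rw [wick hdx hdy hV _ _ (hm _ _), replaceOp_curv_mul hdx hdy, replaceOp_tr₂ hdx hdy,
      if_pos rfl, mul_add, ← sub_sub, mul_smul_comm, mul_smul_comm, Finset.mul_sum]
  have h0 : tr₂ x y * tr₂ x y = ∑ a, ∑ c, curv x y a c * (curv x y c a * tr₂ x y) := by
    conv_lhs => rw [tr₂]
    simp only [Finset.sum_mul, mul_assoc]
    rfl
  rw [h0, Finset.mul_sum, Finset.smul_sum]
  simp only [Finset.mul_sum (Finset.univ : Finset A) _ (tr₁ x y ^ j), Finset.smul_sum]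
  rw [Finset.sum_congr rfl fun a _ => Finset.sum_congr rfl fun c _ => h1 a c]
  simp only [Finset.sum_sub_distrib, Finset.sum_ite_eq, Finset.mem_univ, if_true,
    Finset.sum_const, Finset.card_univ]
  simp only [← Finset.mul_sum, ← Finset.smul_sum, ← Finset.sum_mul]
  have h3 : ∑ a, ∑ c, curv x y c a * ∑ e, curv x y a e * curv x y e c = tr₃ x y := by
    rw [Finset.sum_comm, tr₃]
    simp only [Finset.mul_sum]
  have h4 : ∑ a, curv x y a a = tr₁ x y := rfl
  rw [h3, h4, mul_sub, mul_smul_comm, mul_smul_comm, sub_smul,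
    Nat.cast_smul_eq_nsmul ℂ (Fintype.card A)]

end Pointwise

end ComplexGrassmann

end

/-! ### The curvature at the origin of a chart -/

noncomputable section

namespace ComplexGrassmann

open Filter Topology Matrix MeasureTheory

variable {n k p : ℕ}

/-! ### The curvature at the origin of a chart -/

theorem proj_zero_inl (e : ChartIndex n k) (i : Fin n) (b : Fin k) :
    proj e 0 i (e (Sum.inl b)) = 0 := by
  have h := congrFun (congrFun (proj_mul_frame e (0 : Model n k)) i) b
  rw [Matrix.mul_apply, ← e.sum_comp, Fintype.sum_sum_type] at h
  simpa using h

theorem proj_zero_inl' (e : ChartIndex n k) (i : Fin n) (b : Fin k) :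
    proj e 0 (e (Sum.inl b)) i = 0 := by
  have h := congrFun (congrFun (proj_conjTranspose e (0 : Model n k)) (e (Sum.inl b))) i
  rw [← h, Matrix.conjTranspose_apply, proj_zero_inl, star_zero]

theorem proj_zero_inr (e : ChartIndex n k) (a c : Fin (n - k)) :
    proj e 0 (e (Sum.inr a)) (e (Sum.inr c)) = if a = c then 1 else 0 := by
  rw [proj, Matrix.sub_apply, Matrix.mul_apply]
  simp [Matrix.one_apply]

theorem hasFDerivAt_proj (e : ChartIndex n k) (i j : Fin n) (Z : Model n k) :
    HasFDerivAt (fun W => proj e W i j) (fderiv ℝ (fun W => proj e W i j) Z) Z :=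
  (((contDiff_proj e i j (m := 1)).differentiable one_ne_zero).differentiableAt).hasFDerivAt

variable (n k) in
/-- The coordinate forms `dz`. -/
def dz (a : Fin (n - k)) (b : Fin k) : Model n k →L[ℝ] ℂ :=
  (ContinuousLinearMap.proj b).comp
    (ContinuousLinearMap.proj (R := ℝ) (φ := fun _ : Fin (n - k) => Fin k → ℂ) a)

variable (n k) in
/-- The conjugate coordinate forms. -/
def dzbar (a : Fin (n - k)) (b : Fin k) : Model n k →L[ℝ] ℂ :=
  (Complex.conjCLE : ℂ →L[ℝ] ℂ).comp (dz n k a b)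

@[simp] theorem dz_apply (a : Fin (n - k)) (b : Fin k) (Z : Model n k) : dz n k a b Z = Z a b := rfl

@[simp] theorem dzbar_apply (a : Fin (n - k)) (b : Fin k) (Z : Model n k) :
    dzbar n k a b Z = (starRingEnd ℂ) (Z a b) := rfl

/-- Differentiates a column of `proj * frame = 0`; at the origin the terms in which `proj` is
differentiated against `Z` drop out. -/
theorem fderiv_proj_zero_inl (e : ChartIndex n k) (i : Fin n) (b : Fin k) :
    fderiv ℝ (fun W => proj e W i (e (Sum.inl b))) 0 =
      -∑ a, proj e 0 i (e (Sum.inr a)) • dz n k a b := by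
  have h0 : (fun W : Model n k => proj e W i (e (Sum.inl b)) +
      ∑ a, proj e W i (e (Sum.inr a)) * dz n k a b W) = fun _ => 0 := by
    funext W
    have h := congrFun (congrFun (proj_mul_frame e W) i) b
    rw [Matrix.mul_apply, ← e.sum_comp, Fintype.sum_sum_type] at h
    simpa using h
  have h1 := (hasFDerivAt_proj e i (e (Sum.inl b)) (0 : Model n k)).add
    (HasFDerivAt.fun_sum (u := Finset.univ) fun a _ =>
      (hasFDerivAt_proj e i (e (Sum.inr a)) (0 : Model n k)).mul (dz n k a b).hasFDerivAt)
  have h2 := h1.unique (h0 ▸ hasFDerivAt_const (0 : ℂ) (0 : Model n k))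
  rw [eq_neg_iff_add_eq_zero]
  ext v
  simpa using DFunLike.congr_fun h2 v

theorem fderiv_proj_inr_inl (e : ChartIndex n k) (a : Fin (n - k)) (b : Fin k) :
    fderiv ℝ (fun W => proj e W (e (Sum.inr a)) (e (Sum.inl b))) 0 = -dz n k a b := by
  rw [fderiv_proj_zero_inl]
  ext v
  simp only [_root_.neg_apply, _root_.sum_apply,
    _root_.smul_apply, proj_zero_inr, smul_eq_mul, ite_mul, one_mul, zero_mul,
    Finset.sum_ite_eq, Finset.mem_univ, if_true]

theorem fderiv_proj_inl_inr (e : ChartIndex n k) (a : Fin (n - k)) (b : Fin k) :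
    fderiv ℝ (fun W => proj e W (e (Sum.inl b)) (e (Sum.inr a))) 0 = -dzbar n k a b := by
  have h0 : (fun W => proj e W (e (Sum.inl b)) (e (Sum.inr a))) =
      (Complex.conjCLE : ℂ →L[ℝ] ℂ) ∘ fun W => proj e W (e (Sum.inr a)) (e (Sum.inl b)) := by
    funext W
    exact (congrFun (congrFun (proj_conjTranspose e W) (e (Sum.inl b))) (e (Sum.inr a))).symm
  rw [h0, ((Complex.conjCLE : ℂ →L[ℝ] ℂ).hasFDerivAt.comp 0
    (hasFDerivAt_proj e (e (Sum.inr a)) (e (Sum.inl b)) 0)).fderiv, fderiv_proj_inr_inl]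
  ext v
  simp

/-- Differentiating `P² = P` in the block where `P` is the identity gives `dP + dP = dP`. -/
theorem fderiv_proj_inr_inr (e : ChartIndex n k) (a c : Fin (n - k)) :
    fderiv ℝ (fun W => proj e W (e (Sum.inr a)) (e (Sum.inr c))) 0 = 0 := by
  have h0 : (fun W : Model n k => ∑ j, proj e W (e (Sum.inr a)) j * proj e W j (e (Sum.inr c))) =
      fun W => proj e W (e (Sum.inr a)) (e (Sum.inr c)) := by
    funext W
    rw [← Matrix.mul_apply, proj_mul_proj]
  have h1 : HasFDerivAt (fun W : Model n k => ∑ j, proj e W (e (Sum.inr a)) j *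
      proj e W j (e (Sum.inr c))) _ 0 := HasFDerivAt.fun_sum (u := Finset.univ) fun j _ =>
    (hasFDerivAt_proj e (e (Sum.inr a)) j (0 : Model n k)).mul
      (hasFDerivAt_proj e j (e (Sum.inr c)) (0 : Model n k))
  rw [h0] at h1
  have h2 := h1.unique (hasFDerivAt_proj e (e (Sum.inr a)) (e (Sum.inr c)) 0)
  rw [← e.sum_comp, Fintype.sum_sum_type] at h2
  ext v
  have h3 := DFunLike.congr_fun h2 v
  simp only [_root_.add_apply, _root_.sum_apply,
    _root_.smul_apply, proj_zero_inr, proj_zero_inl, proj_zero_inl', smul_eq_mul,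
    ite_mul, one_mul, zero_mul, Finset.sum_add_distrib, Finset.sum_const_zero, zero_add,
    Finset.sum_ite_eq, Finset.sum_ite_eq', Finset.mem_univ, if_true] at h3
  simpa using h3

theorem toExt_wedgeAt_ofSubsingleton {E : Type*} [NormedAddCommGroup E] [NormedSpace ℝ E]
    [FiniteDimensional ℝ E] (φ ψ : E →L[ℝ] ℂ) :
    toExt (wedgeAt (ContinuousAlternatingMap.ofSubsingleton ℝ E ℂ (0 : Fin 1) φ)
      (ContinuousAlternatingMap.ofSubsingleton ℝ E ℂ (0 : Fin 1) ψ)) =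
      ExteriorAlgebra.ι ℂ φ * ExteriorAlgebra.ι ℂ ψ := by
  rw [toExt_wedgeAt, toExt_ofSubsingleton, toExt_ofSubsingleton]

theorem toExt_curvature (e : ChartIndex n k) (i j : Fin n) (Z : Model n k) :
    toExt (curvature i j e Z) = ∑ a, ∑ b, proj e Z i a •
      (ExteriorAlgebra.ι ℂ (fderiv ℝ (fun W => proj e W a b) Z) *
        ExteriorAlgebra.ι ℂ (fderiv ℝ (fun W => proj e W b j) Z)) := by
  simp only [curvature, map_sum, map_smul, complProjection_chart, dProjection_eq]
  refine Finset.sum_congr rfl fun a _ => Finset.sum_congr rfl fun b _ => congrArg _ ?_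
  exact toExt_wedgeAt_ofSubsingleton _ _

theorem toExt_curvature_zero_inl (e : ChartIndex n k) (b : Fin k) (j : Fin n) :
    toExt (curvature (e (Sum.inl b)) j e 0) = 0 := by
  simp [toExt_curvature, proj_zero_inl']

/-- `P` selects the row `a`, and only intermediate indices among the chosen coordinates survive; the
signs of `-dz` and `-dz̄` cancel. -/
theorem toExt_curvature_zero_inr_inr (e : ChartIndex n k) (a c : Fin (n - k)) :
    toExt (curvature (e (Sum.inr a)) (e (Sum.inr c)) e 0) = curv (dz n k) (dzbar n k) a c := by
  rw [toExt_curvature, ← e.sum_comp, Fintype.sum_sum_type]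
  simp only [proj_zero_inl, proj_zero_inr, zero_smul, Finset.sum_const_zero, zero_add]
  rw [Finset.sum_eq_single a]
  · rw [← e.sum_comp, Fintype.sum_sum_type]
    simp [fderiv_proj_inr_inl, fderiv_proj_inl_inr, fderiv_proj_inr_inr, curv]
  · intro b _ hb
    simp [hb.symm]
  · simp

theorem toExt_traceF_zero (e : ChartIndex n k) :
    toExt (traceF n k e 0) = tr₁ (dz n k) (dzbar n k) := by
  simp only [traceF, Finset.sum_apply, map_sum]
  rw [← e.sum_comp, Fintype.sum_sum_type]
  simp only [toExt_curvature_zero_inl, toExt_curvature_zero_inr_inr, Finset.sum_const_zero,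
    zero_add]
  rfl

theorem toExt_traceFF_zero (e : ChartIndex n k) :
    toExt (traceFF n k e 0) = tr₂ (dz n k) (dzbar n k) := by
  have h : ∀ i j, toExt (wedge (curvature i j) (curvature j i) e (0 : Model n k)) =
      toExt (curvature i j e 0) * toExt (curvature j i e 0) := fun i j => toExt_wedgeAt _ _
  have h' : toExt (traceFF n k e 0) =
      ∑ i, ∑ j, toExt (curvature i j e (0 : Model n k)) * toExt (curvature j i e 0) := by
    simp only [← h]
    simp only [traceFF, Finset.sum_apply]
    rw [map_sum]
    exact Finset.sum_congr rfl fun i _ => map_sum _ _ _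
  rw [h', ← e.sum_comp, Fintype.sum_sum_type]
  simp only [toExt_curvature_zero_inl, zero_mul, Finset.sum_const_zero, zero_add]
  rw [tr₂]
  refine Finset.sum_congr rfl fun a _ => ?_
  rw [← e.sum_comp, Fintype.sum_sum_type]
  simp [toExt_curvature_zero_inl, toExt_curvature_zero_inr_inr]

/-! ### The algebra at the origin -/

theorem span_coordForm : Submodule.span ℂ (Set.range
    (coordForm : Fin (Module.finrank ℝ (Model n k)) → Model n k →L[ℝ] ℂ)) = ⊤ := by
  refine eq_top_iff.2 fun φ _ => ?_
  rw [← sum_coordForm φ]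
  exact Submodule.sum_mem _ fun i _ => Submodule.smul_mem _ _ (Submodule.subset_span ⟨i, rfl⟩)

instance finiteDimensional_forms : FiniteDimensional ℂ (Model n k →L[ℝ] ℂ) :=
  ⟨⟨(Set.finite_range (coordForm (E := Model n k))).toFinset, by
    rw [Set.Finite.coe_toFinset, span_coordForm]⟩⟩

theorem finrank_forms_le : Module.finrank ℂ (Model n k →L[ℝ] ℂ) ≤ 2 * (k * (n - k)) := by
  have h := finrank_range_le_card (R := ℂ) (coordForm (E := Model n k))
  rw [Set.finrank, span_coordForm, finrank_top, Fintype.card_fin, finrank_model] at h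
  exact h

variable (n k) in
/-- The matrix units. -/
def unitVec (a : Fin (n - k)) (b : Fin k) (z : ℂ) : Model n k :=
  fun a' b' => if a = a' ∧ b = b' then z else 0

variable (n k) in
/-- The functional dual to a coordinate form, for the sign `s = -i`, or to a conjugate coordinate
form, for the sign `s = i`. -/
def dualForm (s : ℂ) (a : Fin (n - k)) (b : Fin k) : Module.Dual ℂ (Model n k →L[ℝ] ℂ) where
  toFun φ := (φ (unitVec n k a b 1) + s * φ (unitVec n k a b Complex.I)) / 2
  map_add' φ ψ := by simp; ring
  map_smul' c φ := by simp; ring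

theorem dualForm_I_dz (a : Fin (n - k)) (b : Fin k) (c : Fin (n - k)) (f : Fin k) :
    dualForm n k Complex.I a b (dz n k c f) = 0 := by
  by_cases h : a = c ∧ b = f <;> simp [dualForm, unitVec, h]

theorem dualForm_I_dzbar (a : Fin (n - k)) (b : Fin k) (c : Fin (n - k)) (f : Fin k) :
    dualForm n k Complex.I a b (dzbar n k c f) = if a = c ∧ b = f then 1 else 0 := by
  by_cases h : a = c ∧ b = f
  · simp [dualForm, unitVec, h]
  · simp [dualForm, unitVec, h]

theorem dualForm_neg_I_dz (a : Fin (n - k)) (b : Fin k) (c : Fin (n - k)) (f : Fin k) :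
    dualForm n k (-Complex.I) a b (dz n k c f) = if a = c ∧ b = f then 1 else 0 := by
  by_cases h : a = c ∧ b = f
  · simp [dualForm, unitVec, h]
  · simp [dualForm, unitVec, h]

theorem dualForm_neg_I_dzbar (a : Fin (n - k)) (b : Fin k) (c : Fin (n - k)) (f : Fin k) :
    dualForm n k (-Complex.I) a b (dzbar n k c f) = 0 := by
  by_cases h : a = c ∧ b = f <;> simp [dualForm, unitVec, h]

/-- The trace is the sum of the `k (n - k)` areas `dz ∧ dz̄`, one for each matrix entry. -/
theorem tr₁_pow_ne_zero (n k : ℕ) : tr₁ (dz n k) (dzbar n k) ^ (k * (n - k)) ≠ 0 := by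
  have h := (sum_area_pow_card (S := Fin (n - k) × Fin k) (x := fun s => dz n k s.1 s.2)
    (y := fun s => dzbar n k s.1 s.2) (d := fun s => dualForm n k Complex.I s.1 s.2)
    (d' := fun s => dualForm n k (-Complex.I) s.1 s.2)
    (fun s t => dualForm_I_dz _ _ _ _)
    (fun s t => by rw [dualForm_I_dzbar]; simp only [Prod.ext_iff])
    (fun s t => by rw [dualForm_neg_I_dz]; simp only [Prod.ext_iff])
    (fun s t => dualForm_neg_I_dzbar _ _ _ _) Finset.univ).1
  rw [Finset.card_univ, Fintype.card_prod, Fintype.card_fin, Fintype.card_fin,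
    Fintype.sum_prod_type, mul_comm (n - k)] at h
  exact h

end ComplexGrassmann

end

/-! ### De Rham classes, integrals and intersection numbers -/

noncomputable section

namespace ComplexGrassmann

open Filter Topology Matrix MeasureTheory

variable {n k p q : ℕ}

/-! ### Forms as sections of the exterior algebra -/

/-- The algebra in which forms of all degrees are multiplied. -/
abbrev ExtSections (n k : ℕ) : Type := ChartIndex n k → Model n k → Ext (Model n k)

/-- A form as a section of the exterior algebra. -/
def sect (α : LocalForms n k p) : ExtSections n k := fun e Z => toExt (α e Z)

theorem sect_wedge (α : LocalForms n k p) (β : LocalForms n k q) :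
    sect (wedge α β) = sect α * sect β := by
  funext e Z
  exact toExt_wedgeAt _ _

theorem sect_wedgePow (ω : LocalForms n k 2) (j : ℕ) : sect (wedgePow ω j) = sect ω ^ j := by
  induction j with
  | zero =>
    rw [pow_zero]
    funext e Z
    exact (toExt_constOfIsEmpty 1).trans (map_one (algebraMap ℂ (Ext (Model n k))))
  | succ j ih => rw [pow_succ, ← ih, ← sect_wedge]; rfl

theorem sect_add (α β : LocalForms n k p) : sect (α + β) = sect α + sect β := by
  funext e Z
  exact map_add toExt _ _

theorem sect_sub (α β : LocalForms n k p) : sect (α - β) = sect α - sect β := by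
  funext e Z
  exact map_sub toExt _ _

theorem sect_smul (c : ℂ) (α : LocalForms n k p) : sect (c • α) = c • sect α := by
  funext e Z
  exact map_smul toExt _ _

theorem sect_zero : sect (0 : LocalForms n k p) = 0 := by
  funext e Z
  exact map_zero toExt

theorem differentiableAt_form {α : LocalForms n k p} (hα : IsForm α) (e : ChartIndex n k)
    (Z : Model n k) : DifferentiableAt ℝ (α e) Z :=
  ((hα.1 e).differentiable (by simp)).differentiableAt

theorem sect_extD_wedge {α : LocalForms n k p} {β : LocalForms n k q} (hα : IsForm α)
    (hβ : IsForm β) : sect (extD (wedge α β)) =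
      sect (extD α) * sect β + (-1 : ℂ) ^ p • (sect α * sect (extD β)) := by
  funext e Z
  exact toExt_extDeriv_wedgeAt (differentiableAt_form hα e Z) (differentiableAt_form hβ e Z)

theorem extD_add {α β : LocalForms n k p} (hα : IsForm α) (hβ : IsForm β) :
    extD (α + β) = extD α + extD β := by
  funext e Z
  exact extDeriv_add (differentiableAt_form hα e Z) (differentiableAt_form hβ e Z)

theorem extD_smul (c : ℂ) {α : LocalForms n k p} (hα : IsForm α) :
    extD (c • α) = c • extD α := by
  funext e Z
  have h : fderiv ℝ (c • α e) Z = c • fderiv ℝ (α e) Z :=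
    fderiv_const_smul (differentiableAt_form hα e Z) c
  ext v
  change ContinuousAlternatingMap.alternatizeUncurryFin (fderiv ℝ (c • α e) Z) v =
    c • ContinuousAlternatingMap.alternatizeUncurryFin (fderiv ℝ (α e) Z) v
  rw [h, ContinuousAlternatingMap.alternatizeUncurryFin_apply,
    ContinuousAlternatingMap.alternatizeUncurryFin_apply, Finset.smul_sum]
  refine Finset.sum_congr rfl fun i _ => ?_
  rw [smul_comm]
  rfl

theorem extD_extD {α : LocalForms n k p} (hα : IsForm α) : extD (extD α) = 0 := by
  funext e
  refine extDeriv_extDeriv (hα.1 e) ?_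
  rw [minSmoothness_of_isRCLikeNormedField]
  exact WithTop.coe_le_coe.2 le_top

/-! ### The de Rham complex -/

/-- `f` is a differential form of degree `p` with exterior derivative `g`. -/
def HasExtD (p : ℕ) (f g : ExtSections n k) : Prop :=
  ∃ α : LocalForms n k p, IsForm α ∧ sect α = f ∧ sect (extD α) = g

variable {f f' g g' h : ExtSections n k}

theorem HasExtD.mul (hf : HasExtD p f f') (hg : HasExtD q g g') :
    HasExtD (p + q) (f * g) (f' * g + (-1 : ℂ) ^ p • (f * g')) := by
  obtain ⟨α, hα, rfl, rfl⟩ := hf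
  obtain ⟨β, hβ, rfl, rfl⟩ := hg
  exact ⟨wedge α β, hα.wedge hβ, sect_wedge _ _, sect_extD_wedge hα hβ⟩

theorem HasExtD.add (hf : HasExtD p f f') (hg : HasExtD p g g') :
    HasExtD p (f + g) (f' + g') := by
  obtain ⟨α, hα, rfl, rfl⟩ := hf
  obtain ⟨β, hβ, rfl, rfl⟩ := hg
  exact ⟨α + β, hα.add hβ, sect_add _ _, by rw [extD_add hα hβ, sect_add]⟩

theorem HasExtD.smul (c : ℂ) (hf : HasExtD p f f') : HasExtD p (c • f) (c • f') := by
  obtain ⟨α, hα, rfl, rfl⟩ := hf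
  exact ⟨c • α, hα.smul c, sect_smul _ _, by rw [extD_smul c hα, sect_smul]⟩

/-- `f` is zero or the exterior derivative of a form, of degree `p`. -/
def IsExact (p : ℕ) (f : ExtSections n k) : Prop :=
  f = 0 ∨ ∃ q g, q + 1 = p ∧ HasExtD q g f

theorem IsExact.add (hf : IsExact p f) (hg : IsExact p g) : IsExact p (f + g) := by
  rcases hf with rfl | ⟨a, f₁, ha, hf⟩
  · rwa [zero_add]
  rcases hg with rfl | ⟨b, g₁, hb, hg⟩
  · rw [add_zero]
    exact Or.inr ⟨a, f₁, ha, hf⟩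
  obtain rfl : a = b := by omega
  exact Or.inr ⟨a, _, ha, hf.add hg⟩

theorem IsExact.smul (c : ℂ) (hf : IsExact p f) : IsExact p (c • f) := by
  rcases hf with rfl | ⟨a, f₁, ha, hf⟩
  · exact Or.inl (smul_zero c)
  · exact Or.inr ⟨a, _, ha, hf.smul c⟩

theorem IsExact.mul_closed (hf : IsExact p f) (hg : HasExtD q g 0) : IsExact (p + q) (f * g) := by
  rcases hf with rfl | ⟨a, f₁, ha, hf⟩
  · exact Or.inl (zero_mul g)
  · refine Or.inr ⟨a + q, f₁ * g, by omega, ?_⟩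
    simpa using hf.mul hg

theorem IsExact.closed_mul (hp : Even p) (hf : HasExtD p f 0) (hg : IsExact q g) :
    IsExact (p + q) (f * g) := by
  rcases hg with rfl | ⟨a, g₁, ha, hg⟩
  · exact Or.inl (mul_zero f)
  · refine Or.inr ⟨p + a, f * g₁, by omega, ?_⟩
    simpa [hp.neg_one_pow] using hf.mul hg

/-- Two closed forms of degree `p` in the same de Rham class. -/
structure SameClass (p : ℕ) (f g : ExtSections n k) : Prop where
  left : HasExtD p f 0
  right : HasExtD p g 0
  exact_sub : IsExact p (f - g)

theorem SameClass.trans (hf : SameClass p f g) (hg : SameClass p g h) : SameClass p f h :=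
  ⟨hf.left, hg.right, by simpa using hf.exact_sub.add hg.exact_sub⟩

/-- `f g - f' g' = (f - f') g + f' (g - g')`, each summand being exact times closed; evenness of `p`
removes the sign in the Leibniz rule. -/
theorem SameClass.mul (hp : Even p) (hf : SameClass p f f') (hg : SameClass q g g') :
    SameClass (p + q) (f * g) (f' * g') := by
  refine ⟨by simpa using hf.left.mul hg.left, by simpa using hf.right.mul hg.right, ?_⟩
  have h := (hf.exact_sub.mul_closed hg.left).add (IsExact.closed_mul hp hf.right hg.exact_sub)
  rwa [sub_mul, mul_sub, sub_add_sub_cancel] at h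

theorem SameClass.smul (c : ℂ) (hf : SameClass p f f') : SameClass p (c • f) (c • f') :=
  ⟨by simpa using hf.left.smul c, by simpa using hf.right.smul c, by
    simpa [smul_sub] using hf.exact_sub.smul c⟩

theorem SameClass.add (hf : SameClass p f f') (hg : SameClass p g g') :
    SameClass p (f + g) (f' + g') :=
  ⟨by simpa using hf.left.add hg.left, by simpa using hf.right.add hg.right, by
    simpa [add_sub_add_comm] using hf.exact_sub.add hg.exact_sub⟩

theorem SameClass.sub (hf : SameClass p f f') (hg : SameClass p g g') :
    SameClass p (f - g) (f' - g') := by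
  have h := hf.add (hg.smul (-1))
  simpa only [neg_smul, one_smul, ← sub_eq_add_neg] using h

theorem SameClass.pow (hf : SameClass 2 f f') (j : ℕ) : SameClass (2 * j) (f ^ j) (f' ^ j) := by
  induction j with
  | zero =>
    have h : HasExtD 0 (1 : ExtSections n k) 0 := by
      -- The constant function `1` is realized as the zeroth power of the zero form.
      refine ⟨wedgePow 0 0, isForm_wedgePow isForm_zero 0, by rw [sect_wedgePow, pow_zero], ?_⟩
      rw [← sect_zero (p := 1)]
      congr 1
      funext e Z
      have h0 : fderiv ℝ (wedgePow (0 : LocalForms n k 2) 0 e) Z = 0 :=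
        congrFun (fderiv_fun_const _) Z
      rw [extD, extDeriv, h0]
      exact map_zero (ContinuousAlternatingMap.alternatizeUncurryFinCLM ℝ (Model n k) ℂ)
    simpa using SameClass.mk h h (Or.inl (sub_self 1))
  | succ j ih =>
    rw [pow_succ, pow_succ]
    exact ih.mul (even_two_mul j) hf

theorem IsClosedForm.hasExtD {α : LocalForms n k p} (h : IsClosedForm α) :
    HasExtD p (sect α) 0 :=
  ⟨α, h.1, rfl, by rw [h.2, sect_zero]⟩

theorem Cohomologous.sameClass {α β : LocalForms n k (p + 1)} (h : Cohomologous α β)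
    (hβ : HasExtD (p + 1) (sect β) 0) : SameClass (p + 1) (sect α) (sect β) := by
  obtain ⟨η, hη, h⟩ := h
  have h1 : HasExtD (p + 1) (sect (extD η)) 0 :=
    ⟨extD η, hη.extD, rfl, by rw [extD_extD hη, sect_zero]⟩
  have h2 : sect α = sect β + sect (extD η) := by
    rw [← h, sect_sub, add_sub_cancel]
  refine ⟨?_, hβ, Or.inr ⟨p, sect η, rfl, η, hη, rfl, ?_⟩⟩
  · rw [h2]
    simpa using hβ.add h1
  · rw [h2, add_sub_cancel_left]

/-! ### The integral -/

/-- The integral over the standard chart of the component of top degree. -/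
def sectIntegral (hkn : k ≤ n) (f : ExtSections n k) : ℂ :=
  ∫ Z : Model n k, evalExt (fun i : Fin (2 * (k * (n - k))) => orientedFrame n k i.val)
    (f (stdChart hkn) Z)

theorem topCoeff_eq_evalExt (hp : p = 2 * (k * (n - k))) (α : LocalForms n k p)
    (e : ChartIndex n k) (Z : Model n k) :
    topCoeff α e Z = evalExt (fun i : Fin (2 * (k * (n - k))) => orientedFrame n k i.val)
      (sect α e Z) := by
  subst hp
  exact (evalExt_toExt _ _).symm

theorem integral_eq_sectIntegral (hkn : k ≤ n) (hp : p = 2 * (k * (n - k)))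
    (α : LocalForms n k p) : integral hkn α = sectIntegral hkn (sect α) := by
  rw [integral, if_pos hp, sectIntegral]
  simp only [← topCoeff_eq_evalExt hp]
  rfl

theorem SameClass.sectIntegral_eq (hkn : k ≤ n) (hf : SameClass (2 * (k * (n - k))) f g) :
    sectIntegral hkn f = sectIntegral hkn g := by
  rcases hf with ⟨⟨α, hα, rfl, -⟩, ⟨β, hβ, rfl, -⟩, h⟩
  rcases h with h | ⟨q, g, hq, η, hη, -, h⟩
  · rw [sub_eq_zero.1 h]
  · have h0 : ∀ Z, topCoeff α (stdChart hkn) Z - topCoeff β (stdChart hkn) Z =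
        topCoeff (extD η) (stdChart hkn) Z := by
      intro Z
      rw [topCoeff_eq_evalExt rfl, topCoeff_eq_evalExt rfl, topCoeff_eq_evalExt hq, h,
        ← map_sub]
      rfl
    have h1 := integral_topCoeff_extD hη hq (stdChart hkn)
    simp only [← h0] at h1
    rw [integral_sub (hα.integrable rfl _) (hβ.integrable rfl _), sub_eq_zero] at h1
    simpa only [topCoeff_eq_evalExt rfl, sectIntegral] using h1

/-- Invariant forms of top degree are determined by their values at the origin of a chart. -/
theorem Invariant.topCoeff_eq_mul {α : LocalForms n k p} {β : LocalForms n k q}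
    (hα : Invariant α) (hβ : Invariant β) (hp : p = 2 * (k * (n - k)))
    (hq : q = 2 * (k * (n - k))) {s : ℂ} {e : ChartIndex n k}
    (h : topCoeff α e 0 = s * topCoeff β e 0) (Z : Model n k) :
    topCoeff α e Z = s * topCoeff β e Z := by
  obtain ⟨M, hM, h1, h2⟩ := exists_unitary_coordChange_eq_zero e Z
  rw [topCoeff_eq hp (hα M hM e e Z h1), topCoeff_eq hq (hβ M hM e e Z h1), h2, h,
    mul_smul_comm]

/-- A form of top degree is determined by its value on one basis. -/
theorem topCoeff_ne_zero (hp : p = 2 * (k * (n - k))) {α : LocalForms n k p}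
    {e : ChartIndex n k} {Z : Model n k} (h : sect α e Z ≠ 0) : topCoeff α e Z ≠ 0 := by
  intro h0
  refine h ?_
  have h1 : α e Z = 0 := by
    subst hp
    ext v
    have h2 := top_form_comp rfl (α e Z)
      (LinearMap.toContinuousLinearMap ((orientedBasis n k).constr ℝ v))
    rw [show (α e Z fun i => orientedFrame n k i.val) = 0 from h0, smul_zero] at h2
    refine Eq.trans (congrArg _ (funext fun i => ?_)) h2
    rw [← orientedBasis_apply]
    exact ((orientedBasis n k).constr_basis ℝ v i).symm
  rw [sect, h1, map_zero]

/-- By transitivity and orientation, the integrand is a positive real function times its value at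
the origin. -/
theorem Invariant.integral_ne_zero (hkn : k ≤ n) {α : LocalForms n k p} (hα : Invariant α)
    (hs : IsForm α) (hp : p = 2 * (k * (n - k))) (h : sect α (stdChart hkn) 0 ≠ 0) :
    integral hkn α ≠ 0 := by
  have h0 := topCoeff_ne_zero hp h
  have hr : ∀ Z, ∃ r : ℝ, 0 < r ∧ topCoeff α (stdChart hkn) Z =
      (r : ℂ) * topCoeff α (stdChart hkn) 0 := by
    intro Z
    obtain ⟨M, hM, h1, h2⟩ := exists_unitary_coordChange_eq_zero (stdChart hkn) Z
    refine ⟨_, det_fderiv_coordChange_pos hM h1, ?_⟩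
    rw [topCoeff_eq hp (hα M hM _ _ Z h1), h2, Complex.real_smul]
  choose r hr0 hr using hr
  have h1 : integral hkn α = ((∫ Z, r Z : ℝ) : ℂ) * topCoeff α (stdChart hkn) 0 := by
    rw [integral, if_pos hp, ← integral_complex_ofReal, ← integral_mul_const]
    exact integral_congr_ae (Eventually.of_forall hr)
  have h2 : Integrable r := by
    have h3 : r = fun Z => (topCoeff α (stdChart hkn) Z * (topCoeff α (stdChart hkn) 0)⁻¹).re := by
      funext Z
      rw [hr, mul_inv_cancel_right₀ h0, Complex.ofReal_re]
    rw [h3]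
    exact ((hs.integrable hp (stdChart hkn)).mul_const _).re
  rw [h1]
  refine mul_ne_zero (Complex.ofReal_ne_zero.2 (ne_of_gt ?_)) h0
  rw [integral_pos_iff_support_of_nonneg (fun Z => (hr0 Z).le) h2,
    show Function.support r = Set.univ from Set.eq_univ_of_forall fun Z => (hr0 Z).ne']
  exact isOpen_univ.measure_pos _ Set.univ_nonempty

/-! ### The intersection numbers at the origin -/

section Algebra

variable {R : Type*} [Ring R] [Algebra ℂ R] {W T : R} {j : ℕ} {τ σ : ℂ}

/-- Here `W` and `T` stand for the traces of the curvature and of its square, and `κ` for `i/2π`. -/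
theorem second_class_mul_pow (hc : ∀ x, Commute W x) (h : W ^ (j + 2) * T = τ • W ^ (j + 4))
    (κ : ℂ) : ((κ ^ 2 / 2) • (W * W - T)) * (κ • W) ^ (j + 2) =
      ((1 - τ) / 2) • (κ • W) ^ (j + 4) := by
  rw [smul_pow, smul_pow, smul_mul_smul_comm, ((hc _).pow_left (j + 2)).eq.symm, mul_sub, h,
    ← mul_assoc, ← pow_succ, ← pow_succ, smul_smul]
  rw [show W ^ (j + 2 + 1 + 1) - τ • W ^ (j + 4) = (1 - τ) • W ^ (j + 4) by
    rw [sub_smul, one_smul], smul_smul]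
  congr 1
  ring

/-- The class simplifies to `(κ² / 2) (τ W² - T)`, and squaring gives `τ² - 2τ² + σ = σ - τ²`. -/
theorem primitive_class_sq_mul_pow (hc : ∀ x, Commute W x)
    (h : W ^ (j + 2) * T = τ • W ^ (j + 4)) (h' : W ^ j * (T * T) = σ • W ^ (j + 4)) (κ : ℂ) :
    ((κ ^ 2 / 2) • (W * W - T) - ((1 - τ) / 2) • (κ • W * κ • W)) *
      ((κ ^ 2 / 2) • (W * W - T) - ((1 - τ) / 2) • (κ • W * κ • W)) * (κ • W) ^ j =
      ((σ - τ ^ 2) / 4) • (κ • W) ^ (j + 4) := by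
  have h1 : (κ ^ 2 / 2) • (W * W - T) - ((1 - τ) / 2) • (κ • W * κ • W) =
      (κ ^ 2 / 2) • (τ • W ^ 2 - T) := by
    rw [smul_mul_smul_comm, ← pow_two W, smul_sub, smul_sub, smul_smul, smul_smul]
    module
  have h2 : W ^ j * ((τ • W ^ 2 - T) * (τ • W ^ 2 - T)) = (σ - τ ^ 2) • W ^ (j + 4) := by
    have h3 : W ^ j * (W ^ 2 * W ^ 2) = W ^ (j + 4) := by
      rw [← pow_add, ← pow_add]
    have h4 : W ^ j * (W ^ 2 * T) = τ • W ^ (j + 4) := by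
      rw [← mul_assoc, ← pow_add, h]
    simp only [mul_sub, sub_mul, smul_mul_assoc, mul_smul_comm, ((hc T).pow_left 2).eq.symm, h3,
      h4, h']
    module
  rw [h1, smul_pow, smul_pow, smul_mul_smul_comm, smul_mul_smul_comm,
    ((hc _).pow_left j).eq.symm, h2, smul_smul, smul_smul]
  congr 1
  ring

end Algebra

section Origin

variable {j : ℕ} (hj : j + 4 = k * (n - k))

include hj

/-- With `N = k (n - k) = j + 4`, the denominators `j + 3`, `j + 2`, `j + 1` of this and the next
two results are `N - 1`, `N - 2`, `N - 3`. -/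
theorem tr₁_pow_mul_tr₂_origin :
    tr₁ (dz n k) (dzbar n k) ^ (j + 2) * tr₂ (dz n k) (dzbar n k) =
      (((k : ℂ) - (n - k : ℕ)) / (j + 3)) • tr₁ (dz n k) (dzbar n k) ^ (j + 4) := by
  have h := tr₁_pow_mul_tr₂ (dualForm_I_dz (n := n) (k := k)) dualForm_I_dzbar finrank_forms_le
    (j := j + 2) hj
  have h0 : (j + 3 : ℂ) ≠ 0 := by exact_mod_cast (show j + 3 ≠ 0 by omega)
  rw [Fintype.card_fin, Fintype.card_fin, ← pow_succ] at h
  rw [div_eq_inv_mul, mul_smul, ← h, smul_smul]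
  push_cast
  rw [show (j + 2 + 1 : ℂ) = j + 3 by ring, inv_mul_cancel₀ h0, one_smul]

theorem tr₁_pow_mul_tr₃_origin :
    tr₁ (dz n k) (dzbar n k) ^ (j + 1) * tr₃ (dz n k) (dzbar n k) =
      ((((k : ℂ) - (n - k : ℕ)) * (((k : ℂ) - (n - k : ℕ)) / (j + 3)) - 1) / (j + 2)) •
        tr₁ (dz n k) (dzbar n k) ^ (j + 4) := by
  have h := tr₁_pow_mul_tr₃ (dualForm_I_dz (n := n) (k := k)) dualForm_I_dzbar finrank_forms_le
    (j := j + 1) hj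
  have h0 : (j + 2 : ℂ) ≠ 0 := by exact_mod_cast (show j + 2 ≠ 0 by omega)
  rw [Fintype.card_fin, Fintype.card_fin, mul_sub, mul_smul_comm, tr₁_pow_mul_tr₂_origin hj,
    ← mul_assoc, ← pow_succ, ← pow_succ, smul_smul,
    show ∀ (c : ℂ) (X : Ext (Model n k)), c • X - X = (c - 1) • X from
      fun c X => by rw [sub_smul, one_smul]] at h
  rw [div_eq_inv_mul, mul_smul, ← h, smul_smul]
  push_cast
  rw [show (j + 1 + 1 : ℂ) = j + 2 by ring, inv_mul_cancel₀ h0, one_smul]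

theorem tr₁_pow_mul_tr₂_mul_tr₂_origin :
    tr₁ (dz n k) (dzbar n k) ^ j * (tr₂ (dz n k) (dzbar n k) * tr₂ (dz n k) (dzbar n k)) =
      ((((k : ℂ) - (n - k : ℕ)) * (((k : ℂ) - (n - k : ℕ)) / (j + 3)) -
        2 * ((((k : ℂ) - (n - k : ℕ)) * (((k : ℂ) - (n - k : ℕ)) / (j + 3)) - 1) / (j + 2))) /
          (j + 1)) • tr₁ (dz n k) (dzbar n k) ^ (j + 4) := by
  have h := tr₁_pow_mul_tr₂_mul_tr₂ (dualForm_I_dz (n := n) (k := k)) dualForm_I_dzbar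
    finrank_forms_le (j := j) hj
  have h0 : (j + 1 : ℂ) ≠ 0 := by exact_mod_cast (show j + 1 ≠ 0 by omega)
  rw [Fintype.card_fin, Fintype.card_fin, mul_sub, mul_smul_comm, mul_smul_comm,
    ← mul_assoc (tr₁ _ _ ^ (j + 1)), ← pow_succ, tr₁_pow_mul_tr₂_origin hj, tr₁_pow_mul_tr₃_origin hj, smul_smul, smul_smul,
    ← sub_smul] at h
  rw [div_eq_inv_mul, mul_smul, ← h, smul_smul, inv_mul_cancel₀ h0, one_smul]

end Origin

theorem sect_chernForm₁_zero (e : ChartIndex n k) :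
    sect (chernForm₁ n k) e 0 = (Complex.I / (2 * Real.pi)) • tr₁ (dz n k) (dzbar n k) := by
  rw [chernForm₁, sect_smul, ← toExt_traceF_zero e]
  rfl

theorem sect_chernForm₂_zero (e : ChartIndex n k) :
    sect (chernForm₂ n k) e 0 = ((Complex.I / (2 * Real.pi)) ^ 2 / 2) •
      (tr₁ (dz n k) (dzbar n k) * tr₁ (dz n k) (dzbar n k) - tr₂ (dz n k) (dzbar n k)) := by
  have h : sect (wedge (traceF n k) (traceF n k) - traceFF n k) =
      sect (traceF n k) * sect (traceF n k) - sect (traceFF n k) := by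
    rw [← sect_wedge]
    exact sect_sub _ _
  rw [chernForm₂, sect_smul, h, ← toExt_traceF_zero e, ← toExt_traceFF_zero e]
  rfl

theorem Invariant.integral_eq_mul (hkn : k ≤ n) {α : LocalForms n k p} {β : LocalForms n k q}
    (hα : Invariant α) (hβ : Invariant β) (hp : p = 2 * (k * (n - k)))
    (hq : q = 2 * (k * (n - k))) {s : ℂ}
    (h : sect α (stdChart hkn) 0 = s • sect β (stdChart hkn) 0) :
    sectIntegral hkn (sect α) = s * sectIntegral hkn (sect β) := by
  rw [sectIntegral, sectIntegral, ← integral_const_mul]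
  refine integral_congr_ae (Eventually.of_forall fun Z => ?_)
  have h1 : topCoeff α (stdChart hkn) 0 = s * topCoeff β (stdChart hkn) 0 := by
    rw [topCoeff_eq_evalExt hp, topCoeff_eq_evalExt hq, h, map_smul, smul_eq_mul]
  have h2 := hα.topCoeff_eq_mul hβ hp hq h1 Z
  rwa [topCoeff_eq_evalExt hp, topCoeff_eq_evalExt hq] at h2

theorem sectIntegral_chernForm₁_pow_ne_zero (hkn : k ≤ n) :
    sectIntegral hkn (sect (chernForm₁ n k) ^ (k * (n - k))) ≠ 0 := by
  rw [← sect_wedgePow, ← integral_eq_sectIntegral hkn rfl]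
  refine (invariant_wedgePow (invariant_chernForm₁ n k) _).integral_ne_zero hkn
    (isForm_wedgePow (isClosedForm_chernForm₁ n k).1 _) rfl ?_
  rw [sect_wedgePow, Pi.pow_apply, Pi.pow_apply, sect_chernForm₁_zero, smul_pow]
  refine smul_ne_zero (pow_ne_zero _ (div_ne_zero Complex.I_ne_zero ?_)) (tr₁_pow_ne_zero n k)
  exact mul_ne_zero two_ne_zero (Complex.ofReal_ne_zero.2 Real.pi_ne_zero)

theorem sectIntegral_chernForm₂ (hkn : k ≤ n) {j : ℕ} (hj : j + 4 = k * (n - k)) :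
    sectIntegral hkn (sect (chernForm₂ n k) * sect (chernForm₁ n k) ^ (j + 2)) =
      (1 - ((k : ℂ) - (n - k : ℕ)) / (j + 3)) / 2 *
        sectIntegral hkn (sect (chernForm₁ n k) ^ (k * (n - k))) := by
  rw [← sect_wedgePow, ← sect_wedge, ← sect_wedgePow]
  refine ((invariant_chernForm₂ n k).wedge
    (invariant_wedgePow (invariant_chernForm₁ n k) _)).integral_eq_mul hkn
    (invariant_wedgePow (invariant_chernForm₁ n k) _) (by omega) rfl ?_
  rw [sect_wedge, sect_wedgePow, sect_wedgePow, ← hj]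
  simp only [Pi.mul_apply, Pi.pow_apply, sect_chernForm₁_zero, sect_chernForm₂_zero]
  exact second_class_mul_pow tr₁_commute (tr₁_pow_mul_tr₂_origin hj) _

theorem sectIntegral_primitive_sq (hkn : k ≤ n) {j : ℕ} (hj : j + 4 = k * (n - k)) {l : ℂ}
    (hl : l = (1 - ((k : ℂ) - (n - k : ℕ)) / (j + 3)) / 2) :
    sectIntegral hkn ((sect (chernForm₂ n k) - l • (sect (chernForm₁ n k) * sect (chernForm₁ n k))) *
      (sect (chernForm₂ n k) - l • (sect (chernForm₁ n k) * sect (chernForm₁ n k))) *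
        sect (chernForm₁ n k) ^ j) =
      (((((k : ℂ) - (n - k : ℕ)) * (((k : ℂ) - (n - k : ℕ)) / (j + 3)) -
        2 * ((((k : ℂ) - (n - k : ℕ)) * (((k : ℂ) - (n - k : ℕ)) / (j + 3)) - 1) / (j + 2))) /
          (j + 1) - (((k : ℂ) - (n - k : ℕ)) / (j + 3)) ^ 2) / 4) *
        sectIntegral hkn (sect (chernForm₁ n k) ^ (k * (n - k))) := by
  have hv : sect (chernForm₂ n k) - l • (sect (chernForm₁ n k) * sect (chernForm₁ n k)) =
      sect (p := 4) (chernForm₂ n k - l • wedge (chernForm₁ n k) (chernForm₁ n k)) := by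
    rw [sect_sub, sect_smul]
    exact congrArg _ (congrArg _ (sect_wedge _ _).symm)
  have hi : Invariant (p := 4) (chernForm₂ n k - l • wedge (chernForm₁ n k) (chernForm₁ n k)) :=
    (invariant_chernForm₂ n k).sub
      (((invariant_chernForm₁ n k).wedge (invariant_chernForm₁ n k)).smul l)
  rw [hv, ← sect_wedge, ← sect_wedgePow, ← sect_wedge, ← sect_wedgePow]
  refine ((hi.wedge hi).wedge
    (invariant_wedgePow (invariant_chernForm₁ n k) _)).integral_eq_mul hkn
    (invariant_wedgePow (invariant_chernForm₁ n k) _) (by omega) rfl ?_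
  rw [sect_wedge, sect_wedge, sect_wedgePow, sect_wedgePow, ← hj, ← hv]
  simp only [Pi.mul_apply, Pi.pow_apply, Pi.sub_apply, Pi.smul_apply, sect_chernForm₁_zero,
    sect_chernForm₂_zero, hl]
  exact primitive_class_sq_mul_pow tr₁_commute (tr₁_pow_mul_tr₂_origin hj)
    (tr₁_pow_mul_tr₂_mul_tr₂_origin hj) _

theorem intersection_constant {j : ℕ} {a b : ℂ} (h : (j + 4 : ℂ) = a * b) :
    (((a - b) * ((a - b) / (j + 3)) - 2 * (((a - b) * ((a - b) / (j + 3)) - 1) / (j + 2))) /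
      (j + 1) - ((a - b) / (j + 3)) ^ 2) / 4 =
      ((a ^ 2 - 1) * (b ^ 2 - 1)) / (2 * (a * b - 1) ^ 2 * (a * b - 2) * (a * b - 3)) := by
  have h1 : (j + 1 : ℂ) ≠ 0 := by exact_mod_cast (show j + 1 ≠ 0 by omega)
  have h2 : (j + 2 : ℂ) ≠ 0 := by exact_mod_cast (show j + 2 ≠ 0 by omega)
  have h3 : (j + 3 : ℂ) ≠ 0 := by exact_mod_cast (show j + 3 ≠ 0 by omega)
  -- The identity `(a² - 1)(b² - 1) = (ab - 1)² - (a - b)²` with `ab - 1 = j + 3`.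
  have h4 : (a ^ 2 - 1) * (b ^ 2 - 1) = (j + 3 : ℂ) ^ 2 - (a - b) ^ 2 := by
    linear_combination (-(a * b + j + 2)) * h
  rw [h4, ← h, show (j + 4 - 1 : ℂ) = j + 3 by ring, show (j + 4 - 2 : ℂ) = j + 2 by ring,
    show (j + 4 - 3 : ℂ) = j + 1 by ring]
  field_simp
  ring

end ComplexGrassmann

end

/-! ### The self-intersection of the primitive class -/

open ComplexGrassmann in
theorem mainTheorem6 (n k : ℕ) (hkn : k ≤ n) (hN : 4 ≤ k * (n - k)) :
    IsClosedForm (chernForm₁ n k) ∧ IsClosedForm (chernForm₂ n k) ∧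
    ∀ (ω : LocalForms n k 2) (c v : LocalForms n k 4),
      Cohomologous (p := 1) ω (chernForm₁ n k) →
      Cohomologous (p := 3) c (chernForm₂ n k) →
      Cohomologous (p := 3) v
        (c - (degree hkn ω 2 c / degreeGrassmannian hkn ω) • wedge ω ω) →
      degreeGrassmannian hkn ω ≠ 0 ∧
      pairing hkn ω v v =
        degreeGrassmannian hkn ω *
          ((((k : ℂ) ^ 2 - 1) * (((n : ℂ) - k) ^ 2 - 1)) /
            (2 * ((k * (n - k) : ℂ) - 1) ^ 2 * ((k * (n - k) : ℂ) - 2) *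
              ((k * (n - k) : ℂ) - 3))) := by
  have hc1 := isClosedForm_chernForm₁ n k
  have hc2 := isClosedForm_chernForm₂ n k
  refine ⟨hc1, hc2, fun ω c v hω hc hv => ?_⟩
  obtain ⟨j, hj⟩ : ∃ j, j + 4 = k * (n - k) := ⟨k * (n - k) - 4, by omega⟩
  have hω' : SameClass 2 (sect ω) (sect (chernForm₁ n k)) := hω.sameClass hc1.hasExtD
  have hc' : SameClass 4 (sect c) (sect (chernForm₂ n k)) := hc.sameClass hc2.hasExtD
  have hD : degreeGrassmannian hkn ω =
      sectIntegral hkn (sect (chernForm₁ n k) ^ (k * (n - k))) := by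
    rw [degreeGrassmannian, integral_eq_sectIntegral hkn rfl, sect_wedgePow]
    exact (hω'.pow _).sectIntegral_eq hkn
  have hD0 := sectIntegral_chernForm₁_pow_ne_zero (n := n) hkn
  -- The coefficient depends only on the classes, so it is computed on the Chern forms.
  have hl : degree hkn ω 2 c / degreeGrassmannian hkn ω =
      (1 - ((k : ℂ) - (n - k : ℕ)) / (j + 3)) / 2 := by
    rw [hD, div_eq_iff hD0, ← sectIntegral_chernForm₂ hkn hj, degree,
      integral_eq_sectIntegral hkn (by omega), sect_wedge, sect_wedgePow,
      show k * (n - k) - 2 = j + 2 by omega]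
    refine SameClass.sectIntegral_eq hkn ?_
    rw [show 2 * (k * (n - k)) = 4 + 2 * (j + 2) by omega]
    exact hc'.mul (by decide) (hω'.pow _)
  generalize degree hkn ω 2 c / degreeGrassmannian hkn ω = l at hv hl
  have hsub : sect (p := 4) (c - l • wedge ω ω) = sect c - l • (sect ω * sect ω) := by
    rw [sect_sub, sect_smul]
    exact congrArg _ (congrArg _ (sect_wedge _ _))
  have hu : SameClass 4 (sect c - l • (sect ω * sect ω))
      (sect (chernForm₂ n k) - l • (sect (chernForm₁ n k) * sect (chernForm₁ n k))) :=
    hc'.sub ((hω'.mul (by decide) hω').smul l)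
  have hv' : SameClass 4 (sect v) (sect c - l • (sect ω * sect ω)) := by
    have := hu.left
    rw [← hsub] at this ⊢
    exact hv.sameClass this
  have hvu := hv'.trans hu
  rw [hD]
  refine ⟨hD0, ?_⟩
  -- Truncated subtraction is genuine because `k ≤ n`.
  have hm : ((n - k : ℕ) : ℂ) = n - k := Nat.cast_sub hkn
  rw [pairing, integral_eq_sectIntegral hkn (by omega), sect_wedge, sect_wedge, sect_wedgePow,
    show k * (n - k) - 4 = j by omega, ← hm, ← intersection_constant (j := j)
      (by exact_mod_cast hj), mul_comm, ← sectIntegral_primitive_sq hkn hj hl]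
  refine SameClass.sectIntegral_eq hkn ?_
  rw [show 2 * (k * (n - k)) = 4 + 4 + 2 * j by omega]
  exact (hvu.mul (by decide) hvu).mul (by decide) (hω'.pow _)
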